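/- **Setting.** Let $Q$ be an inner product on $\mathbb R^\infty=\bigcup_n\mathbb R^n$ (equivalently, a family of inner products $Q_n$ on $\mathbb R^n$ with $Q_{n+1}|_{\mathbb R^n}=Q_n$). Let $\mathcal L=\varinjlim(\mathbb R^n)^*$ be the space of linear forms, the limit being taken along pull-back by the $Q$-orthogonal projections $\mathbb R^{n+1}\to\mathbb R^n$, with the inner product induced by $Q$; write $\perp$ for orthogonality. Let $\mathcal M_+$ be the real algebra of germs at $0$ of the form $h(\ell_1,\dots,\ell_k)$, with $\ell_i\in\mathcal L$ and $h$ holomorphic at $0\in\mathbb C^k$ with real Taylor coefficients, and let $\mathcal M$ be the algebra of meromorphic germs $h/(L_1\cdots L_n)$ with $h\in\mathcal M_+$ and $L_j\in\mathcal L\setminus\{0\}$. Let $\mathcal M_-\subseteq\mathcal M$ be the real span of the polar germs $h(\ell_1,\dots,\ell_k)/(L_1\cdots L_n)$, where $n\ge 1$, $L_j\neq0$ and $\ell_i\perp L_j$ for all $i,j$. Let $\mathcal M[\mathcal L]$ be the group ring of finite sums $\sum_i f_i x^{L_i}$ with $f_i\in\mathcal M$, $L_i\in\mathcal L$. For $L\ne\ell$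 in $\mathcal L$, let $\mathcal I^L(x^\ell)\in\mathcal M[\mathcal L]$ be the element which, as a function of $x>0$ and of the parameter $\zeta$ near $0$ at which the linear forms are evaluated, is equal to the absolutely convergent integral $\int_0^\infty \frac{y^{\ell(\zeta)}\,y^{-L(\zeta)}}{y+x}\,dy$ wherever $\mathrm{Re}\,(L-\ell)(\zeta)>0$. Extend $\mathcal I^L$ by $\mathcal M$-linearity (with $\mathcal I^L(x^L)$ set to $0$; this value is never used below). Let $\mathcal F$ be the set of (non-planar) rooted forests, including the empty forest $1$, with all vertices decorated by nonzero elements of $\mathcal L$ in such a way that the decorations of any two distinct vertices are orthogonal. Two such forests are independent if every decoration of one is orthogonal to every decoration of the other; two elements of the span $\mathbb R\mathcal F$ are independent if every forest occurring in one is independent of every forest occurring in the other. With the concatenation of independent forests as product, $\mathbb R\mathcal F$ is a locality algebra with unit $1$. Let $\mathcal R:\mathbb R\mathcal F\to\mathcal M[\mathcal L]$ be the linear map given by $\mathcal R(1)=1$, $\mathcal R(FG)=\mathcal R(F)\mathcal R(G)$ for independent $F,G\in\mathcal F$, and $\mathcal R(B_+^L(F))=\mathcal I^L(\mathcal R(F))$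 when $L$ is orthogonal to the decorations of $F$, where $B_+^L(F)$ is the tree obtained by grafting $F$ on a root decorated by $L$. Let $\mathrm{ev}_1:\mathcal M[\mathcal L]\to\mathcal M$, $\sum_i f_ix^{L_i}\mapsto\sum_i f_i$, be evaluation at $x=1$, put $\mathcal R_1=\mathrm{ev}_1\circ\mathcal R$, let $\pi_+:\mathcal M\to\mathcal M_+$ be the projection along $\mathcal M_-$, and let $\mathrm{ev}_0:\mathcal M_+\to\mathbb C$ be evaluation at $0$. **Statement.** For all $L\neq\ell$ in $\mathcal L$ there is exactly one element $\mathcal I^L(x^\ell)$ of $\mathcal M[\mathcal L]$ as above; every $f\in\mathcal M$ is in exactly one way the sum of an element $\pi_+(f)$ of $\mathcal M_+$ and an element of $\mathcal M_-$; and the map $$\mathcal R^{\rm ren}:=\mathrm{ev}_0\circ\pi_+\circ\mathcal R_1:\ \mathbb R\mathcal F\to\mathbb C$$ is a locality character (the renormalised character), i.e. a morphism of locality algebras to $\mathbb C$, in which any two numbers count as independent: it is $\mathbb R$-linear, $\mathcal R^{\rm ren}(1)=1$, and $\mathcal R^{\rm ren}(ab)=\mathcal R^{\rm ren}(a)\,\mathcal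 R^{\rm ren}(b)$ for all independent $a,b\in\mathbb R\mathcal F$. -/

import Mathlib

open Filter Topology MeasureTheory

noncomputable section

namespace BranchedRen

/-! ### Locality algebras and their characters -/

/-- The polar subset `U^⊤` of `U` for a binary relation `⊤`. -/
def polarSet {A : Type*} (rel : A → A → Prop) (U : Set A) : Set A :=
  {a | ∀ u ∈ U, rel a u}

/-- A (unital) locality algebra over the field `K`, with underlying vector space `A`: a symmetric
relation `rel` whose polar subsets are linear subspaces, with a product `mul` that is only
defined on pairs in relation, is locality bilinear, preserves polar subsets, is associative on
triples of pairwise related elements, and has a unit that is related to every element. -/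
structure LocalityAlgebra (K A : Type*) [Field K] [AddCommGroup A] [Module K A] where
  rel : A → A → Prop
  symm : ∀ {a b}, rel a b → rel b a
  polar_subspace : ∀ U : Set A, ∃ W : Submodule K A, (W : Set A) = polarSet rel U
  mul : ∀ a b, rel a b → A
  add_mul : ∀ a a' b (h : rel a b) (h' : rel a' b) (h'' : rel (a + a') b),
    mul (a + a') b h'' = mul a b h + mul a' b h'
  mul_add : ∀ a b b' (h : rel a b) (h' : rel a b') (h'' : rel a (b + b')),
    mul a (b + b') h'' = mul a b h + mul a b' h'
  smul_mul : ∀ (c : K) a b (h : rel a b) (h' : rel (c • a) b),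
    mul (c • a) b h' = c • mul a b h
  mul_smul : ∀ (c : K) a b (h : rel a b) (h' : rel a (c • b)),
    mul a (c • b) h' = c • mul a b h
  mul_mem_polar : ∀ (U : Set A) a b (h : rel a b),
    a ∈ polarSet rel U → b ∈ polarSet rel U → mul a b h ∈ polarSet rel U
  assoc : ∀ a b c (hab : rel a b) (hbc : rel b c), rel a c →
    ∀ (h₁ : rel (mul a b hab) c) (h₂ : rel a (mul b c hbc)),
      mul (mul a b hab) c h₁ = mul a (mul b c hbc) h₂
  one : A
  rel_one : ∀ a, rel a one
  one_mul : ∀ a (h : rel one a), mul one a h = a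
  mul_one : ∀ a (h : rel a one), mul a one h = a

/-- An ordinary commutative algebra, seen as a locality algebra in which any two elements are
related. -/
def fullLocality (K B : Type*) [Field K] [CommRing B] [Algebra K B] : LocalityAlgebra K B where
  rel _ _ := True
  symm _ := trivial
  polar_subspace U := ⟨⊤, by ext; simp [polarSet]⟩
  mul a b _ := a * b
  add_mul a a' b _ _ _ := _root_.add_mul a a' b
  mul_add a b b' _ _ _ := _root_.mul_add a b b'
  smul_mul c a b _ _ := smul_mul_assoc c a b
  mul_smul c a b _ _ := mul_smul_comm c a b
  mul_mem_polar _ _ _ _ _ _ := fun _ _ => trivial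
  assoc a b c _ _ _ _ _ := mul_assoc a b c
  one := 1
  rel_one _ := trivial
  one_mul a _ := _root_.one_mul a
  mul_one a _ := _root_.mul_one a

/-- Morphisms of locality algebras. -/
structure IsLocalityHom {K A B : Type*} [Field K] [AddCommGroup A] [Module K A]
    [AddCommGroup B] [Module K B] (SA : LocalityAlgebra K A) (SB : LocalityAlgebra K B)
    (f : A → B) : Prop where
  linear : IsLinearMap K f
  map_rel : ∀ a b, SA.rel a b → SB.rel (f a) (f b)
  map_mul : ∀ a b (h : SA.rel a b) (h' : SB.rel (f a) (f b)),
    f (SA.mul a b h) = SB.mul (f a) (f b) h'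
  map_one : f SA.one = SB.one

/-- A complex valued locality character of a real locality algebra: a morphism of locality
algebras to `ℂ`, where any two complex numbers are independent. -/
def IsLocalityCharacter {A : Type*} [AddCommGroup A] [Module ℝ A] (SA : LocalityAlgebra ℝ A)
    (f : A → ℂ) : Prop :=
  IsLocalityHom SA (fullLocality ℝ ℂ) f

/-! ### Decorated rooted forests -/

/-- Planar rooted forests with all vertices decorated by `Ω`: `nil` is the empty forest, and
`cons ω c s` is the forest whose first tree has root decorated by `ω`, the planar forest of
branches above that root being `c`, and whose remaining trees are those of `s`. -/
inductive PForest (Ω : Type*) where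
  | nil : PForest Ω
  | cons (ω : Ω) (c s : PForest Ω) : PForest Ω

namespace PForest

variable {Ω : Type*}

/-- Concatenation of planar forests. -/
def append : PForest Ω → PForest Ω → PForest Ω
  | nil, t => t
  | cons ω c s, t => cons ω c (append s t)

/-- The decorations of all vertices, with multiplicity. -/
def decs : PForest Ω → Multiset Ω
  | nil => 0
  | cons ω c s => ω ::ₘ (decs c + decs s)

/-- Two planar forests represent the same (non-planar) decorated rooted forest if they differ by
permutations of the trees and, at every vertex, of the branches. -/
inductive Equivalent : PForest Ω → PForest Ω → Prop
  | nil : Equivalent nil nil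
  | cons (ω : Ω) {c c' s s' : PForest Ω} : Equivalent c c' → Equivalent s s' →
      Equivalent (cons ω c s) (cons ω c' s')
  | swap (ω ω' : Ω) (c c' s : PForest Ω) :
      Equivalent (cons ω c (cons ω' c' s)) (cons ω' c' (cons ω c s))
  | trans {s t u : PForest Ω} : Equivalent s t → Equivalent t u → Equivalent s u

theorem Equivalent.refl : ∀ s : PForest Ω, Equivalent s s
  | .nil => .nil
  | .cons ω c s => .cons ω (refl c) (refl s)

theorem Equivalent.symm {s t : PForest Ω} (h : Equivalent s t) : Equivalent t s := by
  induction h with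
  | nil => exact .nil
  | cons ω _ _ h₁ h₂ => exact .cons ω h₁ h₂
  | swap ω ω' c c' s => exact .swap ω' ω c' c s
  | trans _ _ h₁ h₂ => exact .trans h₂ h₁

instance setoid (Ω : Type*) : Setoid (PForest Ω) where
  r := Equivalent
  iseqv := ⟨Equivalent.refl, Equivalent.symm, Equivalent.trans⟩

theorem append_nil : ∀ s : PForest Ω, append s nil = s
  | nil => rfl
  | cons ω c s => by rw [append, append_nil s]

theorem append_assoc (t u : PForest Ω) :
    ∀ s : PForest Ω, append (append s t) u = append s (append t u)
  | nil => rfl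
  | cons ω c s => by simp only [append, append_assoc t u s]

theorem append_left (t : PForest Ω) {s s' : PForest Ω} (h : Equivalent s s') :
    Equivalent (append s t) (append s' t) := by
  induction h with
  | nil => exact .refl _
  | cons ω h₁ _ _ h₂ => exact .cons ω h₁ h₂
  | swap ω ω' c c' s => exact .swap ω ω' c c' _
  | trans _ _ h₁ h₂ => exact .trans h₁ h₂

theorem append_right {t t' : PForest Ω} (h : Equivalent t t') :
    ∀ s : PForest Ω, Equivalent (append s t) (append s t')
  | nil => h
  | cons ω c s => .cons ω (.refl c) (append_right h s)

theorem append_cons (ω : Ω) (c s : PForest Ω) :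
    ∀ t : PForest Ω, Equivalent (append t (cons ω c s)) (cons ω c (append t s))
  | nil => .refl _
  | cons ω' c' t => .trans (.cons ω' (.refl c') (append_cons ω c s t)) (.swap ω' ω c' c _)

theorem append_comm (t : PForest Ω) : ∀ s : PForest Ω, Equivalent (append s t) (append t s)
  | nil => by rw [append_nil]; exact .refl _
  | cons ω c s => .trans (.cons ω (.refl c) (append_comm t s)) (append_cons ω c s t).symm

theorem decs_append (t : PForest Ω) : ∀ s : PForest Ω, decs (append s t) = decs s + decs t
  | nil => by simp [append, decs]
  | cons ω c s => by simp [append, decs, decs_append t s, add_assoc]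

theorem decs_congr {s t : PForest Ω} (h : Equivalent s t) : decs s = decs t := by
  induction h with
  | nil => rfl
  | cons ω _ _ h₁ h₂ => simp only [decs, h₁, h₂]
  | swap ω ω' c c' s =>
    simp only [decs, ← Multiset.singleton_add]
    abel
  | trans _ _ h₁ h₂ => exact h₁.trans h₂

end PForest

/-- (Non-planar) rooted forests with all vertices decorated by `Ω`. -/
def Forest (Ω : Type*) : Type _ := Quotient (PForest.setoid Ω)

namespace Forest

variable {Ω : Type*}

/-- Forests form a commutative monoid under concatenation, with the empty forest as unit. -/
instance : CommMonoid (Forest Ω) where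
  mul := Quotient.map₂ PForest.append fun _ _ h₁ _ _ h₂ =>
    .trans (PForest.append_left _ h₁) (PForest.append_right h₂ _)
  one := Quotient.mk _ PForest.nil
  mul_assoc := by
    rintro ⟨s⟩ ⟨t⟩ ⟨u⟩
    exact congrArg (Quotient.mk _) (PForest.append_assoc t u s)
  one_mul := by
    rintro ⟨s⟩
    rfl
  mul_one := by
    rintro ⟨s⟩
    exact congrArg (Quotient.mk _) (PForest.append_nil s)
  mul_comm := by
    rintro ⟨s⟩ ⟨t⟩
    exact Quotient.sound (PForest.append_comm t s)

/-- The decorations of all vertices, with multiplicity. -/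
def decs : Forest Ω → Multiset Ω := Quotient.lift PForest.decs fun _ _ h => PForest.decs_congr h

theorem decs_mul (F G : Forest Ω) : decs (F * G) = decs F + decs G := by
  rcases F with ⟨s⟩
  rcases G with ⟨t⟩
  exact PForest.decs_append t s

theorem decs_one : decs (1 : Forest Ω) = 0 := rfl

/-- A forest is properly decorated if its vertices are decorated by mutually independent
elements: the decorations of any two distinct vertices are independent. -/
def Proper (ind : Ω → Ω → Prop) (F : Forest Ω) : Prop := (decs F).Pairwise ind

/-- Two forests are independent if every decoration of the first is independent of every
decoration of the second. -/
def Indep (ind : Ω → Ω → Prop) (F G : Forest Ω) : Prop :=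
  ∀ a ∈ decs F, ∀ b ∈ decs G, ind a b

theorem Indep.symm {ind : Ω → Ω → Prop} (hs : ∀ {a b}, ind a b → ind b a) {F G : Forest Ω}
    (h : Indep ind F G) : Indep ind G F :=
  fun a ha b hb => hs (h b hb a ha)

theorem Indep.mul_left {ind : Ω → Ω → Prop} {F F' G : Forest Ω}
    (h : Indep ind F G) (h' : Indep ind F' G) : Indep ind (F * F') G := by
  intro a ha b hb
  rw [decs_mul, Multiset.mem_add] at ha
  exact ha.elim (fun ha => h a ha b hb) (fun ha => h' a ha b hb)

theorem indep_one (ind : Ω → Ω → Prop) (F : Forest Ω) : Indep ind F 1 := by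
  intro a _ b hb
  simp [decs_one] at hb

theorem proper_one (ind : Ω → Ω → Prop) : Proper ind (1 : Forest Ω) :=
  ⟨[], rfl, List.Pairwise.nil⟩

theorem Proper.mul {ind : Ω → Ω → Prop} {F G : Forest Ω} (hF : Proper ind F)
    (hG : Proper ind G) (h : Indep ind F G) : Proper ind (F * G) := by
  obtain ⟨l, hl, hl'⟩ := hF
  obtain ⟨m, hm, hm'⟩ := hG
  refine ⟨l ++ m, by rw [decs_mul, hl, hm]; rfl, ?_⟩
  rw [List.pairwise_append]
  refine ⟨hl', hm', fun a ha b hb => h a ?_ b ?_⟩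
  · rw [hl]; exact ha
  · rw [hm]; exact hb

end Forest

/-! ### The locality algebra of properly decorated forests -/

/-- The real span of the properly decorated forests, inside the real span of all forests. -/
def properSpan {Ω : Type*} (ind : Ω → Ω → Prop) : Submodule ℝ (MonoidAlgebra ℝ (Forest Ω)) where
  carrier := {a | ∀ F ∈ a.coeff.support, Forest.Proper ind F}
  zero_mem' := by simp
  add_mem' := by
    classical
    intro a b ha hb F hF
    rw [MonoidAlgebra.coeff_add] at hF
    rcases Finset.mem_union.1 (Finsupp.support_add hF) with h | h
    · exact ha F h
    · exact hb F h
  smul_mem' := by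
    intro c a ha F hF
    rw [MonoidAlgebra.coeff_smul] at hF
    exact ha F (Finsupp.support_smul hF)

section SpanLocality

variable {Ω : Type*} (ind : Ω → Ω → Prop)

/-- Two linear combinations of forests are independent if every forest that occurs in the first
is independent of every forest that occurs in the second. -/
def SpanIndep (a b : MonoidAlgebra ℝ (Forest Ω)) : Prop :=
  ∀ F ∈ a.coeff.support, ∀ G ∈ b.coeff.support, Forest.Indep ind F G

variable {ind}

theorem exists_of_mem_support_mul {a b : MonoidAlgebra ℝ (Forest Ω)} {F : Forest Ω}
    (hF : F ∈ (a * b).coeff.support) :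
    ∃ G ∈ a.coeff.support, ∃ H ∈ b.coeff.support, F = G * H := by
  classical
  have h := MonoidAlgebra.support_coeff_mul_subset a b hF
  obtain ⟨G, hG, H, hH, rfl⟩ := Finset.mem_mul.1 h
  exact ⟨G, hG, H, hH, rfl⟩

theorem mul_mem_properSpan {a b : MonoidAlgebra ℝ (Forest Ω)} (ha : a ∈ properSpan ind)
    (hb : b ∈ properSpan ind) (h : SpanIndep ind a b) : a * b ∈ properSpan ind := by
  intro F hF
  obtain ⟨G, hG, H, hH, rfl⟩ := exists_of_mem_support_mul hF
  exact (ha G hG).mul (hb H hH) (h G hG H hH)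

theorem SpanIndep.mul_left {a b c : MonoidAlgebra ℝ (Forest Ω)} (h : SpanIndep ind a c)
    (h' : SpanIndep ind b c) : SpanIndep ind (a * b) c := by
  intro F hF K hK
  obtain ⟨G, hG, H, hH, rfl⟩ := exists_of_mem_support_mul hF
  exact (h G hG K hK).mul_left (h' H hH K hK)

theorem SpanIndep.add_left {a b c : MonoidAlgebra ℝ (Forest Ω)} (h : SpanIndep ind a c)
    (h' : SpanIndep ind b c) : SpanIndep ind (a + b) c := by
  classical
  intro F hF K hK
  rw [MonoidAlgebra.coeff_add] at hF
  rcases Finset.mem_union.1 (Finsupp.support_add hF) with hF | hF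
  · exact h F hF K hK
  · exact h' F hF K hK

theorem SpanIndep.smul_left {a c : MonoidAlgebra ℝ (Forest Ω)} (r : ℝ)
    (h : SpanIndep ind a c) : SpanIndep ind (r • a) c := by
  intro F hF K hK
  rw [MonoidAlgebra.coeff_smul] at hF
  exact h F (Finsupp.support_smul hF) K hK

theorem spanIndep_one (a : MonoidAlgebra ℝ (Forest Ω)) : SpanIndep ind a 1 := by
  intro F _ G hG
  have : G = 1 := by
    rw [MonoidAlgebra.one_def] at hG
    simpa using hG
  subst this
  exact Forest.indep_one ind F

theorem one_mem_properSpan : (1 : MonoidAlgebra ℝ (Forest Ω)) ∈ properSpan ind := by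
  intro G hG
  have : G = 1 := by
    rw [MonoidAlgebra.one_def] at hG
    simpa using hG
  subst this
  exact Forest.proper_one ind

variable (ind)

/-- The locality algebra of properly `Ω`-decorated rooted forests, for a symmetric independence
relation on `Ω`; the product is the concatenation of forests. -/
def forestAlgebra (hs : ∀ {a b}, ind a b → ind b a) :
    LocalityAlgebra ℝ (properSpan ind) where
  rel a b := SpanIndep ind a.1 b.1
  symm h := fun F hF G hG => (h G hG F hF).symm hs
  polar_subspace U := by
    refine ⟨{ carrier := polarSet (fun a b : properSpan ind => SpanIndep ind a.1 b.1) U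
              zero_mem' := ?_, add_mem' := ?_, smul_mem' := ?_ }, rfl⟩
    · exact fun ha hb u hu => (ha u hu).add_left (hb u hu)
    · intro u _ F hF
      simp at hF
    · exact fun c a ha u hu => (ha u hu).smul_left c
  mul a b h := ⟨a.1 * b.1, mul_mem_properSpan a.2 b.2 h⟩
  add_mul a a' b _ _ _ := Subtype.ext (_root_.add_mul a.1 a'.1 b.1)
  mul_add a b b' _ _ _ := Subtype.ext (_root_.mul_add a.1 b.1 b'.1)
  smul_mul c a b _ _ := Subtype.ext (smul_mul_assoc c a.1 b.1)
  mul_smul c a b _ _ := Subtype.ext (mul_smul_comm c a.1 b.1)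
  mul_mem_polar U a b _ ha hb := fun u hu => (ha u hu).mul_left (hb u hu)
  assoc a b c _ _ _ _ _ := Subtype.ext (mul_assoc a.1 b.1 c.1)
  one := ⟨1, one_mem_properSpan⟩
  rel_one a := spanIndep_one a.1
  one_mul a _ := Subtype.ext (_root_.one_mul a.1)
  mul_one a _ := Subtype.ext (_root_.mul_one a.1)

end SpanLocality

/-! ### Linear forms, holomorphic germs and meromorphic germs with linear poles -/

/-- An inner product `Q` on `ℝ^∞ = ⋃ ℝⁿ`, i.e. a family of inner products `Q_n` on `ℝⁿ` such that
`Q_{n+1}` restricts to `Q_n`. -/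
structure InnerProd where
  form : LinearMap.BilinForm ℝ (ℕ →₀ ℝ)
  symm : ∀ v w, form v w = form w v
  pos : ∀ v, v ≠ 0 → 0 < form v v

/-- The direct limit `ℒ` of the dual spaces `(ℝⁿ)^*` along the pull-backs by the `Q`-orthogonal
projections `ℝ^{n+1} → ℝⁿ`. The isomorphisms `v ↦ Q(v, ·)` from `ℝⁿ` to `(ℝⁿ)^*` carry these
pull-backs to the inclusions `ℝⁿ → ℝ^{n+1}`, so `ℒ` is `ℝ^∞`, the vector `v` standing for the
linear form `Q(v, ·)`. The inner product of the linear forms `v` and `w` is `Q(v, w)`. -/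
abbrev LinForm : Type := ℕ →₀ ℝ

/-- The nonzero linear forms. -/
abbrev NzForm : Type := {v : LinForm // v ≠ 0}

/-- The value of a linear form at a point. A point `ζ` is given by the values `ζ i = Q(e_i, ·)` of
the basic linear forms. The first `n` of these are linear coordinates on `ℂⁿ`, and in these
coordinates pull-back by the complexified orthogonal projection `ℂ^{n+1} → ℂⁿ` turns a function of
`ζ 0, …, ζ (n-1)` into the same function, seen as a function of `ζ 0, …, ζ n`. -/
def LinForm.eval (v : LinForm) (ζ : ℕ → ℂ) : ℂ := v.sum fun i a => (a : ℂ) * ζ i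

/-- Germs at `0` of arbitrary complex valued functions. The topology on `ℕ → ℂ` is the product
topology, so that a neighbourhood of `0` restricts only finitely many coordinates. -/
abbrev PointGerm : Type := Germ (𝓝 (0 : ℕ → ℂ)) ℂ

/-- `F` is holomorphic at `0 ∈ ℂᵏ` and its Taylor expansion at `0` has real coefficients, i.e. `F`
takes real values at the real points near `0`. -/
def IsRealHolo {k : ℕ} (F : (Fin k → ℂ) → ℂ) : Prop :=
  AnalyticAt ℂ F 0 ∧ ∀ᶠ t : Fin k → ℝ in 𝓝 0, ∃ r : ℝ, F (fun i => (t i : ℂ)) = r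

/-- The germ `F(ℓ_1, …, ℓ_k)`. -/
def compGerm {k : ℕ} (F : (Fin k → ℂ) → ℂ) (ℓ : Fin k → LinForm) : PointGerm :=
  ((fun ζ : ℕ → ℂ => F fun i => (ℓ i).eval ζ : (ℕ → ℂ) → ℂ) : PointGerm)

/-- The condition to be a holomorphic germ, with real coefficients, of finitely many linear
forms. -/
def IsHoloGerm (γ : PointGerm) : Prop :=
  ∃ (k : ℕ) (F : (Fin k → ℂ) → ℂ) (ℓ : Fin k → LinForm), IsRealHolo F ∧ γ = compGerm F ℓ

theorem isHoloGerm_const (c : ℝ) : IsHoloGerm ((c : ℂ) : PointGerm) :=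
  ⟨0, fun _ => c, Fin.elim0, ⟨analyticAt_const, .of_forall fun _ => ⟨c, rfl⟩⟩, rfl⟩

theorem IsHoloGerm.map₂ (op : ℂ → ℂ → ℂ) (opR : ℝ → ℝ → ℝ)
    (hop : ∀ a b : ℝ, op a b = (opR a b : ℝ))
    (han : ∀ (n : ℕ) (F G : (Fin n → ℂ) → ℂ), AnalyticAt ℂ F 0 → AnalyticAt ℂ G 0 →
      AnalyticAt ℂ (fun z => op (F z) (G z)) 0)
    {γ δ : PointGerm} (hγ : IsHoloGerm γ) (hδ : IsHoloGerm δ) :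
    IsHoloGerm (Germ.map₂ op γ δ) := by
  obtain ⟨k, F, ℓ, ⟨hF, hF'⟩, rfl⟩ := hγ
  obtain ⟨m, G, ℓ', ⟨hG, hG'⟩, rfl⟩ := hδ
  refine ⟨k + m, fun z => op (F fun i => z (Fin.castAdd m i)) (G fun i => z (Fin.natAdd k i)),
    Fin.append ℓ ℓ', ⟨?_, ?_⟩, ?_⟩
  · apply han
    · exact AnalyticAt.fun_comp (f := fun (z : Fin (k + m) → ℂ) (i : Fin k) => z (Fin.castAdd m i))
        (g := F) hF (by rw [analyticAt_pi_iff]; intro i; exact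
          (ContinuousLinearMap.proj (R := ℂ) (φ := fun _ : Fin (k + m) => ℂ)
            (Fin.castAdd m i)).analyticAt 0)
    · exact AnalyticAt.fun_comp (f := fun (z : Fin (k + m) → ℂ) (i : Fin m) => z (Fin.natAdd k i))
        (g := G) hG (by rw [analyticAt_pi_iff]; intro i; exact
          (ContinuousLinearMap.proj (R := ℂ) (φ := fun _ : Fin (k + m) => ℂ)
            (Fin.natAdd k i)).analyticAt 0)
  · have h₁ : Tendsto (fun (t : Fin (k + m) → ℝ) (i : Fin k) => t (Fin.castAdd m i))
        (𝓝 0) (𝓝 0) := Continuous.tendsto' (by fun_prop) _ _ rfl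
    have h₂ : Tendsto (fun (t : Fin (k + m) → ℝ) (i : Fin m) => t (Fin.natAdd k i))
        (𝓝 0) (𝓝 0) := Continuous.tendsto' (by fun_prop) _ _ rfl
    filter_upwards [h₁.eventually hF', h₂.eventually hG'] with t ht ht'
    obtain ⟨a, ha⟩ := ht
    obtain ⟨b, hb⟩ := ht'
    exact ⟨opR a b, by rw [ha, hb, hop]⟩
  · simp [compGerm, Germ.map₂_coe]

theorem IsHoloGerm.add {γ δ : PointGerm} (hγ : IsHoloGerm γ) (hδ : IsHoloGerm δ) :
    IsHoloGerm (γ + δ) :=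
  IsHoloGerm.map₂ (· + ·) (· + ·) (fun a b => by push_cast; rfl)
    (fun _ _ _ hF hG => hF.add hG) hγ hδ

theorem IsHoloGerm.mul {γ δ : PointGerm} (hγ : IsHoloGerm γ) (hδ : IsHoloGerm δ) :
    IsHoloGerm (γ * δ) :=
  IsHoloGerm.map₂ (· * ·) (· * ·) (fun a b => by push_cast; rfl)
    (fun _ _ _ hF hG => hF.mul hG) hγ hδ

/-- The algebra `ℳ_+` of holomorphic germs at `0`, with real coefficients, in finitely many
linear forms. -/
def holoGerms : Subring PointGerm where
  carrier := {γ | IsHoloGerm γ}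
  zero_mem' := by
    have h := isHoloGerm_const 0
    rw [Complex.ofReal_zero] at h
    exact h
  one_mem' := by
    have h := isHoloGerm_const 1
    rw [Complex.ofReal_one] at h
    exact h
  add_mem' := IsHoloGerm.add
  mul_mem' := IsHoloGerm.mul
  neg_mem' := by
    intro γ h
    have := (isHoloGerm_const (-1)).mul h
    have e : (((-1 : ℝ) : ℂ) : PointGerm) * γ = -γ := by
      have : (((-1 : ℝ) : ℂ) : PointGerm) = -1 := by
        push_cast
        rfl
      rw [this, neg_one_mul]
    rwa [e] at this

/-- `ℳ_+`. -/
abbrev HoloGerm : Type := holoGerms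

instance : Algebra ℝ HoloGerm :=
  RingHom.toAlgebra
    { toFun := fun c => ⟨((c : ℂ) : PointGerm), isHoloGerm_const c⟩
      map_one' := Subtype.ext (by push_cast; rfl)
      map_zero' := Subtype.ext (by push_cast; rfl)
      map_add' := fun a b => Subtype.ext (by push_cast; rfl)
      map_mul' := fun a b => Subtype.ext (by push_cast; rfl) }

/-- Evaluation of a holomorphic germ at `0`. -/
def evZero (h : HoloGerm) : ℂ := Germ.value h.1

theorem isHoloGerm_lin (v : LinForm) : IsHoloGerm ((v.eval : (ℕ → ℂ) → ℂ) : PointGerm) :=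
  ⟨1, fun z => z 0, fun _ => v,
    ⟨(ContinuousLinearMap.proj (R := ℂ) (φ := fun _ : Fin 1 => ℂ) 0).analyticAt 0,
      .of_forall fun t => ⟨t 0, rfl⟩⟩, rfl⟩

/-- A linear form as a holomorphic germ. -/
def linGerm (v : LinForm) : HoloGerm := ⟨((v.eval : (ℕ → ℂ) → ℂ) : PointGerm), isHoloGerm_lin v⟩

/-- The multiplicative set of all products of nonzero linear forms. -/
def linDenoms : Submonoid HoloGerm := Submonoid.closure {h | ∃ v : NzForm, h = linGerm v.1}

/-- A nonzero linear form as a denominator. -/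
def linDenom (v : NzForm) : linDenoms := ⟨linGerm v.1, Submonoid.subset_closure ⟨v, rfl⟩⟩

/-- The algebra `ℳ` of meromorphic germs at `0` with linear poles and real coefficients: the
fractions `h / (L_1 ⋯ L_n)` with `h` a holomorphic germ and `L_1, …, L_n` nonzero linear forms. -/
abbrev Mero : Type := Localization linDenoms

/-- A polar germ is a fraction `h(ℓ_1, …, ℓ_k) / (L_1 ⋯ L_n)` with `n ≥ 1`, `h` a holomorphic germ
and `ℓ_i`, `L_j` linear forms such that `L_j ≠ 0` and `ℓ_i` is orthogonal to `L_j` for all `i`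
and `j`. -/
def IsPolarGerm (Q : InnerProd) (f : Mero) : Prop :=
  ∃ (k n : ℕ) (F : (Fin k → ℂ) → ℂ) (hF : IsRealHolo F) (ℓ : Fin k → LinForm)
    (L : Fin n → NzForm), 0 < n ∧ (∀ i j, Q.form (ℓ i) (L j).1 = 0) ∧
      f = Localization.mk ⟨compGerm F ℓ, ⟨k, F, ℓ, hF, rfl⟩⟩ (∏ j, linDenom (L j))

/-- The space `ℳ_-` spanned by the polar germs. -/
def meroMinus (Q : InnerProd) : Submodule ℝ Mero := Submodule.span ℝ {f | IsPolarGerm Q f}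

/-- `p` is the holomorphic component of `f` along `ℳ_-`. -/
def IsHoloPart (Q : InnerProd) (f : Mero) (p : HoloGerm) : Prop :=
  f - algebraMap HoloGerm Mero p ∈ meroMinus Q

open Classical in
/-- The projection `π_+ : ℳ → ℳ_+` along `ℳ_-`. -/
def piPlus (Q : InnerProd) (f : Mero) : HoloGerm :=
  if h : ∃ p, IsHoloPart Q f p then h.choose else 0

/-! ### The algebra `ℳ[ℒ]` and the integral operators -/

/-- The group ring `ℳ[ℒ]`: `single L f` stands for `f x^L`. -/
abbrev MeroL : Type := AddMonoidAlgebra Mero LinForm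

/-- The meromorphic germ `f` is represented by the function `φ` on `U` near `0`. -/
def HasValues (f : Mero) (U : Set (ℕ → ℂ)) (φ : (ℕ → ℂ) → ℂ) : Prop :=
  ∃ (h : HoloGerm) (s : linDenoms) (H S : (ℕ → ℂ) → ℂ), f = Localization.mk h s ∧
    (H : PointGerm) = h.1 ∧ (S : PointGerm) = s.1.1 ∧
    ∀ᶠ ζ in 𝓝[U] 0, S ζ ≠ 0 ∧ φ ζ = H ζ / S ζ

/-- The element `u` of `ℳ[ℒ]` is the integral `∫_0^∞ y^ℓ y^{-L} / (y + x) dy`, as a function of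
`x > 0` and of the parameter `ζ` at which the linear forms are evaluated: near `ζ = 0`, and where
`Re (L - ℓ)(ζ) > 0`, the integral converges absolutely and is equal to the value of `u`. Such a `u`
is the meromorphic extension of the integral to a neighbourhood of `ζ = 0`. -/
def IsIntegralElt (L ℓ : LinForm) (u : MeroL) : Prop :=
  ∃ c : LinForm → (ℕ → ℂ) → ℂ,
    (∀ μ ∈ u.coeff.support, HasValues (u.coeff μ) {ζ | 0 < ((L - ℓ).eval ζ).re} (c μ)) ∧
    ∀ᶠ ζ in 𝓝[{ζ | 0 < ((L - ℓ).eval ζ).re}] 0, ∀ x : ℝ, 0 < x →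
      IntegrableOn (fun y : ℝ => (y : ℂ) ^ ℓ.eval ζ * (y : ℂ) ^ (-L.eval ζ) / ((y : ℂ) + x))
        (Set.Ioi 0) ∧
      ∫ y in Set.Ioi (0 : ℝ), (y : ℂ) ^ ℓ.eval ζ * (y : ℂ) ^ (-L.eval ζ) / ((y : ℂ) + x) =
        ∑ μ ∈ u.coeff.support, c μ ζ * (x : ℂ) ^ μ.eval ζ

open Classical in
/-- The element `ℐ^L(x^ℓ)` of `ℳ[ℒ]`. (For `ℓ = L` the integral never converges, and the value is
set to be `0`.) -/
def integralElt (L ℓ : LinForm) : MeroL :=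
  if h : L ≠ ℓ ∧ ∃ u, IsIntegralElt L ℓ u then h.2.choose else 0

/-- The `ℳ`-linear operator `ℐ^L(f)(x) = ∫_0^∞ f(y) y^{-L} / (y + x) dy` on `ℳ[ℒ]`. -/
def integralOp (L : LinForm) (u : MeroL) : MeroL :=
  u.coeff.sum fun ℓ f => f • integralElt L ℓ

/-! ### The branched integrals and the renormalised map -/

/-- The recursion for the branched integrals, on planar forests: `1 ↦ 1`, the concatenation is sent
to the product, and the grafting `B_+^L` to the operator `ℐ^L`. -/
def branchedPlanar : PForest NzForm → MeroL
  | .nil => 1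
  | .cons L c s => integralOp L.1 (branchedPlanar c) * branchedPlanar s

theorem branchedPlanar_congr {s t : PForest NzForm} (h : s.Equivalent t) :
    branchedPlanar s = branchedPlanar t := by
  induction h with
  | nil => rfl
  | cons ω _ _ h₁ h₂ => simp only [branchedPlanar, h₁, h₂]
  | swap ω ω' c c' s => simp only [branchedPlanar]; exact mul_left_comm _ _ _
  | trans _ _ h₁ h₂ => exact h₁.trans h₂

theorem branchedPlanar_append (t : PForest NzForm) : ∀ s : PForest NzForm,
    branchedPlanar (s.append t) = branchedPlanar s * branchedPlanar t
  | .nil => (_root_.one_mul _).symm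
  | .cons L c s => by
    simp only [PForest.append, branchedPlanar, branchedPlanar_append t s, mul_assoc]

/-- The branched integrals, as a multiplicative map on forests. -/
def branchedForest : Forest NzForm →* MeroL where
  toFun := Quotient.lift branchedPlanar fun _ _ h => branchedPlanar_congr h
  map_one' := rfl
  map_mul' := by
    rintro ⟨s⟩ ⟨t⟩
    exact branchedPlanar_append t s

/-- Independence of nonzero linear forms: orthogonality. -/
def orth (Q : InnerProd) (v w : NzForm) : Prop := Q.form v.1 w.1 = 0

theorem orth_symm (Q : InnerProd) {v w : NzForm} (h : orth Q v w) : orth Q w v :=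
  (Q.symm w.1 v.1).trans h

/-- The locality algebra of the rooted forests properly decorated by nonzero linear forms. -/
abbrev orthForestAlgebra (Q : InnerProd) : LocalityAlgebra ℝ (properSpan (orth Q)) :=
  forestAlgebra (orth Q) (orth_symm Q)

/-- The linear map `ℛ` from the span of the properly decorated forests to `ℳ[ℒ]`. -/
def branched (Q : InnerProd) : properSpan (orth Q) →ₗ[ℝ] MeroL :=
  (MonoidAlgebra.lift ℝ MeroL (Forest NzForm) branchedForest).toLinearMap.comp
    (properSpan (orth Q)).subtype

/-- Evaluation at `x = 1`, the map `∑ f_i x^{L_i} ↦ ∑ f_i` from `ℳ[ℒ]` to `ℳ`. -/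
def evOne (u : MeroL) : Mero := u.coeff.sum fun _ f => f

/-- The map `ℛ_1 = ev_1 ∘ ℛ`. -/
def branchedOne (Q : InnerProd) (a : properSpan (orth Q)) : Mero := evOne (branched Q a)

/-- The renormalised map `ℛ^ren = ev_0 ∘ π_+ ∘ ℛ_1`. -/
def renormalised (Q : InnerProd) (a : properSpan (orth Q)) : ℂ :=
  evZero (piPlus Q (branchedOne Q a))

end BranchedRen

end

noncomputable section

namespace BranchedRen

/-! ### Orthogonal decompositions -/

/-! The integrals. With `a = L - ℓ`, the substitution `y = x u / (1 - u)` turns the integral into a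
Beta integral, with value `Γ(a) Γ(1 - a) x^{-a}` for `0 < Re a < 1`. Since `Γ(a) Γ(1 - a) = Γ(1 + a)
Γ(1 - a) / a`, this is one monomial of `ℳ[ℒ]` whose coefficient has a linear pole
(`isIntegralElt_single`). It is unique because at a generic point the exponents of two candidates
take distinct values, distinct powers of `x` are linearly independent, and a meromorphic germ
vanishing at the generic points of a half space is zero (`isIntegralElt_unique`).

The splitting `ℳ = ℳ_+ ⊕ ℳ_-`. To decompose `h / (L_1 ⋯ L_n)`, write the variables of `h` as
combinations of the `L_j` plus forms orthogonal to them. Hadamard's lemma gives `h = h₀ + ∑ L_j h_j`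
with `h₀` depending on the orthogonal forms only. The `h₀` term is polar if `n ≥ 1`, each other term
loses a denominator, and induction on `n` finishes (`exists_decomposition`).

For directness (`eq_zero_of_mem_meroMinus`), expand along lines `t ↦ t z` with `z` real. Each
Laurent coefficient of a polar germ, as a function of `z`, is a polynomial in the `ℓ_i` divided by
`∏ L_j`: it tends to `0` in the nonzero directions of the span `W ≠ 0` of the `L_j`, and is
polynomial in directions orthogonal to `W`. The coefficients of a holomorphic germ are of this kind
with `W = 0`. Such functions for distinct `W` are independent: a suitable power of a difference
operator kills the functions belonging to one `U` but is injective on those belonging to any `W` not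
contained in `U`. Peeling off maximal `W` one at a time leaves a polynomial that vanishes almost
everywhere.

The character. The decomposition stays within the linear forms of a given subspace `V`. For
orthogonal `V` and `W`, a product of a holomorphic germ in one and a polar germ in the other, or of
polar germs in both, is again polar; hence `π_+` is multiplicative on such pairs (`piPlus_mul`). The
branched integral of a forest only involves the span of its decorations, so independent forests give
such a pair. All other maps in the composite are multiplicative without restriction. -/

theorem exists_orthogonal_decomposition {V : Type*} [AddCommGroup V] [Module ℝ V]
    (B : LinearMap.BilinForm ℝ V) (hs : ∀ v w, B v w = B w v) (hp : ∀ v, v ≠ 0 → 0 < B v v)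
    (W : Submodule ℝ V) [FiniteDimensional ℝ W] (x : V) :
    ∃ w ∈ W, ∃ u, (∀ w' ∈ W, B w' u = 0) ∧ x = w + u := by
  have hr : B.IsRefl := fun v w h => (hs w v).trans h
  have hn : (B.restrict W).Nondegenerate := by
    refine (LinearMap.IsRefl.nondegenerate_iff_separatingLeft
      (B := B.restrict W) fun v w h => (hs w v).trans h).2 fun v hv => ?_
    by_contra h
    have h' : (v : V) ≠ 0 := fun h0 => h (Subtype.ext h0)
    exact (hp v h').ne' (hv v)
  -- The vector of `W` representing the functional `B x` on `W`. Only `W` has to be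
  -- finite-dimensional, so this also applies in `ℝ^∞`.
  let w := ((B.restrict W).toDual hn).symm ((B x).comp W.subtype)
  have hw : ∀ w' : W, B w w' = B x w' := fun w' =>
    LinearMap.BilinForm.apply_toDual_symm_apply (B := B.restrict W) (hB := hn) _ w'
  refine ⟨w, w.2, x - w, fun w' hw' => ?_, (add_sub_cancel _ _).symm⟩
  rw [hs, map_sub, LinearMap.sub_apply, hw ⟨w', hw'⟩, sub_self]

/-! ### Functions decaying along a subspace and polynomial across it -/

section Tame

set_option linter.unusedSectionVars false

variable {V : Type*} [AddCommGroup V]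

/-- Translation of functions by `ξ`. -/
def shift (ξ : V) : Module.End ℂ (V → ℂ) := LinearMap.funLeft ℂ ℂ fun z => z + ξ

/-- The difference operator `f ↦ f(· + ξ) - f`. -/
def diff (ξ : V) : Module.End ℂ (V → ℂ) := shift ξ - 1

@[simp] theorem shift_apply (ξ : V) (f : V → ℂ) (z : V) : shift ξ f z = f (z + ξ) := rfl

theorem diff_apply (ξ : V) (f : V → ℂ) (z : V) : diff ξ f z = f (z + ξ) - f z := rfl

theorem shift_commute (ξ η : V) : Commute (shift ξ) (shift η) := by
  ext f z
  simp [Module.End.mul_apply, add_right_comm]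

theorem shift_diff_commute (ξ η : V) : Commute (shift ξ) (diff η) :=
  (shift_commute ξ η).sub_right (Commute.one_right _)

theorem diff_commute (ξ η : V) : Commute (diff ξ) (diff η) :=
  (shift_diff_commute ξ η).sub_left (Commute.one_left _)

theorem shift_add (ξ η : V) : shift (ξ + η) = shift ξ * shift η := by
  ext f z
  simp [Module.End.mul_apply, add_assoc]

theorem diff_pow_eq_fwdDiff (ξ : V) (n : ℕ) (f : V → ℂ) : (diff ξ ^ n) f = (fwdDiff ξ)^[n] f := by
  induction n generalizing f with
  | zero => rfl
  | succ n ih => rw [pow_succ, Module.End.mul_apply, ih, Function.iterate_succ_apply]; rfl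

variable [MeasurableSpace V] (μ : Measure V)

/-- Functions vanishing almost everywhere. -/
def nullFun : Submodule ℂ (V → ℂ) where
  carrier := {f | f =ᵐ[μ] 0}
  zero_mem' := ae_eq_refl 0
  add_mem' {f g} hf hg := by
    filter_upwards [show ∀ᵐ z ∂μ, f z = 0 from hf, show ∀ᵐ z ∂μ, g z = 0 from hg] with z h₁ h₂
    simp [h₁, h₂]
  smul_mem' c f hf := by
    filter_upwards [show ∀ᵐ z ∂μ, f z = 0 from hf] with z h₁
    simp [h₁]

theorem mem_nullFun {f : V → ℂ} : f ∈ nullFun μ ↔ ∀ᵐ z ∂μ, f z = 0 := Iff.rfl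

theorem ae_shift [MeasurableAdd V] [μ.IsAddRightInvariant] {p : V → Prop} (h : ∀ᵐ z ∂μ, p z)
    (ξ : V) : ∀ᵐ z ∂μ, p (z + ξ) :=
  (measurePreserving_add_right μ ξ).quasiMeasurePreserving.ae h

variable [MeasurableAdd V] [μ.IsAddRightInvariant]

theorem shift_mem_nullFun (ξ : V) {f : V → ℂ} (hf : f ∈ nullFun μ) : shift ξ f ∈ nullFun μ :=
  ae_shift μ hf ξ

theorem diff_mem_nullFun (ξ : V) {f : V → ℂ} (hf : f ∈ nullFun μ) : diff ξ f ∈ nullFun μ :=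
  (nullFun μ).sub_mem (shift_mem_nullFun μ ξ hf) hf

theorem pow_mem_nullFun {T : Module.End ℂ (V → ℂ)} (hT : ∀ f ∈ nullFun μ, T f ∈ nullFun μ)
    (n : ℕ) {f : V → ℂ} (hf : f ∈ nullFun μ) : (T ^ n) f ∈ nullFun μ := by
  induction n with
  | zero => exact hf
  | succ n ih => rw [pow_succ']; exact hT _ ih

theorem pow_mem_nullFun_of_le {T : Module.End ℂ (V → ℂ)}
    (hT : ∀ f ∈ nullFun μ, T f ∈ nullFun μ) {m n : ℕ} (h : m ≤ n) {f : V → ℂ}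
    (hf : (T ^ m) f ∈ nullFun μ) : (T ^ n) f ∈ nullFun μ := by
  obtain ⟨k, rfl⟩ := Nat.exists_eq_add_of_le' h
  rw [pow_add]
  exact pow_mem_nullFun μ hT k hf

/-- For almost every `z` the sequence `f (z + n • η)` is constant, and its limit is `0`. -/
theorem mem_nullFun_of_diff_of_tendsto {f : V → ℂ} {η : V} (hd : diff η f ∈ nullFun μ)
    (ht : ∀ᵐ z ∂μ, Tendsto (fun n : ℕ => f (z + n • η)) atTop (𝓝 0)) : f ∈ nullFun μ := by
  have h : ∀ᵐ z ∂μ, ∀ n : ℕ, diff η f (z + n • η) = 0 :=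
    ae_all_iff.2 fun n => ae_shift μ hd (n • η)
  filter_upwards [h, ht] with z hz hz'
  have : ∀ n : ℕ, f (z + n • η) = f z := by
    intro n
    induction n with
    | zero => simp
    | succ n ih =>
      have := hz n
      rw [diff_apply, sub_eq_zero, add_assoc, ← succ_nsmul] at this
      rw [this, ih]
  simp only [this] at hz'
  exact tendsto_nhds_unique tendsto_const_nhds hz'

variable [Module ℝ V] (B : LinearMap.BilinForm ℝ V)

/-- Functions that tend to `0` in all nonzero directions of `W`, and are polynomial in all
directions orthogonal to `W`. -/
def tame (W : Submodule ℝ V) : Submodule ℂ (V → ℂ) where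
  carrier := {f | (∀ η ∈ W, η ≠ 0 → ∀ᵐ z ∂μ, Tendsto (fun n : ℕ => f (z + n • η)) atTop (𝓝 0)) ∧
    ∀ ξ, (∀ w ∈ W, B w ξ = 0) → ∃ N, (diff ξ ^ N) f ∈ nullFun μ}
  zero_mem' := ⟨fun _ _ _ => .of_forall fun _ => tendsto_const_nhds,
    fun _ _ => ⟨0, (nullFun μ).zero_mem⟩⟩
  add_mem' := by
    rintro f g ⟨hf, hf'⟩ ⟨hg, hg'⟩
    refine ⟨fun η h h' => ?_, fun ξ h => ?_⟩
    · filter_upwards [hf η h h', hg η h h'] with z h₁ h₂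
      simpa using h₁.add h₂
    · obtain ⟨m, hm⟩ := hf' ξ h
      obtain ⟨n, hn⟩ := hg' ξ h
      refine ⟨max m n, ?_⟩
      rw [map_add]
      exact (nullFun μ).add_mem
        (pow_mem_nullFun_of_le μ (fun _ => diff_mem_nullFun μ ξ) (le_max_left _ _) hm)
        (pow_mem_nullFun_of_le μ (fun _ => diff_mem_nullFun μ ξ) (le_max_right _ _) hn)
  smul_mem' := by
    rintro c f ⟨hf, hf'⟩
    refine ⟨fun η h h' => ?_, fun ξ h => ?_⟩
    · filter_upwards [hf η h h'] with z h₁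
      simpa using h₁.const_mul c
    · obtain ⟨m, hm⟩ := hf' ξ h
      exact ⟨m, by rw [map_smul]; exact (nullFun μ).smul_mem c hm⟩

variable {B} {W : Submodule ℝ V}

theorem shift_mem_tame (ξ : V) {f : V → ℂ} (hf : f ∈ tame μ B W) : shift ξ f ∈ tame μ B W := by
  refine ⟨fun η h h' => ?_, fun υ h => ?_⟩
  · filter_upwards [ae_shift μ (hf.1 η h h') ξ] with z hz
    simpa [add_right_comm] using hz
  · obtain ⟨N, hN⟩ := hf.2 υ h
    refine ⟨N, ?_⟩
    rw [← Module.End.mul_apply, ← ((shift_diff_commute ξ υ).pow_right N).eq]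
    exact shift_mem_nullFun μ ξ hN

theorem diff_mem_tame (ξ : V) {f : V → ℂ} (hf : f ∈ tame μ B W) : diff ξ f ∈ tame μ B W :=
  (tame μ B W).sub_mem (shift_mem_tame μ ξ hf) hf

theorem diff_pow_mem_tame (ξ : V) (n : ℕ) {f : V → ℂ} (hf : f ∈ tame μ B W) :
    (diff ξ ^ n) f ∈ tame μ B W := by
  induction n with
  | zero => exact hf
  | succ n ih => rw [pow_succ']; exact diff_mem_tame μ ξ ih

theorem mem_nullFun_of_diff_pow_of_mem {f : V → ℂ} (hf : f ∈ tame μ B W) {η : V} (hη : η ∈ W)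
    (h0 : η ≠ 0) (n : ℕ) (h : (diff η ^ n) f ∈ nullFun μ) : f ∈ nullFun μ := by
  induction n with
  | zero => exact h
  | succ n ih =>
    rw [pow_succ'] at h
    exact ih (mem_nullFun_of_diff_of_tendsto μ h ((diff_pow_mem_tame μ η n hf).1 η hη h0))

variable (hs : ∀ v w, B v w = B w v) (hp : ∀ v, v ≠ 0 → 0 < B v v)
include hs hp

/-- Write `ξ = η + υ` with `η ∈ W` nonzero and `υ` orthogonal to `W`. Invariance under `ξ` makes
translation by `η` act on `f` like translation by `-υ`. A power of `diff (-υ)` kills `f`, hence so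
does the same power of `diff η`; decay along `η` then forces `f = 0`. -/
theorem mem_nullFun_of_diff [FiniteDimensional ℝ W] {f : V → ℂ} (hf : f ∈ tame μ B W) {ξ w : V}
    (hw : w ∈ W) (h : B w ξ ≠ 0) (hd : diff ξ f ∈ nullFun μ) : f ∈ nullFun μ := by
  obtain ⟨η, hη, υ, hυ, rfl⟩ := exists_orthogonal_decomposition B hs hp W ξ
  have h0 : η ≠ 0 := by
    rintro rfl
    rw [zero_add, hυ w hw] at h
    exact h rfl
  obtain ⟨N, hN⟩ := hf.2 (-υ) fun w' hw' => by rw [map_neg, hυ w' hw', neg_zero]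
  refine mem_nullFun_of_diff_pow_of_mem μ hf hη h0 N ?_
  have h1 : (diff η - diff (-υ)) f ∈ nullFun μ := by
    have e : diff η - diff (-υ) = shift (-υ) * diff (η + υ) := by
      have : shift η = shift (-υ) * shift (η + υ) := by
        rw [← shift_add]; congr 1; abel
      simp only [diff]
      rw [mul_sub, ← this, mul_one]
      abel
    rw [e]
    exact shift_mem_nullFun μ _ hd
  -- The two operators commute, so the difference of their `N`-th powers is a multiple of their
  -- difference.
  have h2 : (diff η ^ N - diff (-υ) ^ N) f ∈ nullFun μ := by
    rw [← (diff_commute η (-υ)).geom_sum₂_mul, Module.End.mul_apply, LinearMap.sum_apply]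
    refine Submodule.sum_mem _ fun i _ => ?_
    rw [Module.End.mul_apply]
    exact pow_mem_nullFun μ (fun _ => diff_mem_nullFun μ _) _
      (pow_mem_nullFun μ (fun _ => diff_mem_nullFun μ _) _ h1)
  have := (nullFun μ).add_mem h2 hN
  rwa [LinearMap.sub_apply, sub_add_cancel] at this

theorem mem_nullFun_of_diff_pow [FiniteDimensional ℝ W] {f : V → ℂ} (hf : f ∈ tame μ B W)
    {ξ w : V} (hw : w ∈ W) (h : B w ξ ≠ 0) (n : ℕ) (hd : (diff ξ ^ n) f ∈ nullFun μ) :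
    f ∈ nullFun μ := by
  induction n with
  | zero => exact hd
  | succ n ih =>
    rw [pow_succ'] at hd
    exact ih (mem_nullFun_of_diff μ hs hp (diff_pow_mem_tame μ ξ n hf) hw h hd)

/-- The members of `T` are eliminated one by one: a difference operator in a direction orthogonal to
`U` but not to `W` kills `g U` after finitely many applications, preserves all the other decay
spaces, and is injective on `tame μ B W` modulo null functions. -/
theorem mem_nullFun_of_add_sum [FiniteDimensional ℝ V] (T : Finset (Submodule ℝ V))
    (hT : ∀ W' ∈ T, ¬ W ≤ W') (f : V → ℂ) (hf : f ∈ tame μ B W) (g : Submodule ℝ V → V → ℂ)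
    (hg : ∀ W' ∈ T, g W' ∈ tame μ B W') (h : f + ∑ W' ∈ T, g W' ∈ nullFun μ) :
    f ∈ nullFun μ := by
  classical
  induction T using Finset.induction_on generalizing f g with
  | empty => simpa using h
  | insert U T hU ih =>
    obtain ⟨w, hw, hwU⟩ := SetLike.not_le_iff_exists.1 (hT U (Finset.mem_insert_self _ _))
    -- The component `ξ` of `w ∈ W ∖ U` orthogonal to `U` is nonzero, and `B w ξ = B ξ ξ > 0`, so
    -- `ξ` is not orthogonal to `W`.
    obtain ⟨η, hη, ξ, hξ, rfl⟩ := exists_orthogonal_decomposition B hs hp U w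
    have hξ0 : ξ ≠ 0 := by
      rintro rfl
      exact hwU (by simpa using hη)
    have hB : B (η + ξ) ξ ≠ 0 := by
      rw [map_add, LinearMap.add_apply, hξ η hη, zero_add]
      exact (hp ξ hξ0).ne'
    obtain ⟨N, hN⟩ := (hg U (Finset.mem_insert_self _ _)).2 ξ hξ
    refine mem_nullFun_of_diff_pow μ hs hp hf hw hB N (ih
      (fun W' hW' => hT W' (Finset.mem_insert_of_mem hW')) _ (diff_pow_mem_tame μ ξ N hf)
      (fun W' => (diff ξ ^ N) (g W'))
      (fun W' hW' => diff_pow_mem_tame μ ξ N (hg W' (Finset.mem_insert_of_mem hW'))) ?_)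
    have h1 := pow_mem_nullFun μ (fun _ => diff_mem_nullFun μ ξ) N h
    rw [Finset.sum_insert hU, map_add, map_add, map_sum, ← add_assoc, add_right_comm] at h1
    exact ((nullFun μ).add_mem_iff_left hN).1 h1

theorem mem_nullFun_of_sum [FiniteDimensional ℝ V] (T : Finset (Submodule ℝ V))
    (hT : ∀ W' ∈ T, W' ≠ ⊥) (f : V → ℂ) (hf : f ∈ tame μ B ⊥) (g : Submodule ℝ V → V → ℂ)
    (hg : ∀ W' ∈ T, g W' ∈ tame μ B W') (h : f + ∑ W' ∈ T, g W' ∈ nullFun μ) :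
    f ∈ nullFun μ := by
  classical
  induction T using Finset.strongInduction with
  | H T ih =>
    rcases T.eq_empty_or_nonempty with rfl | hne
    · simpa using h
    -- A maximal `W` is contained in no other member of `T`, nor in `⊥`. The previous lemma
    -- therefore applies to `g W`, with `f` treated as the summand belonging to `⊥`.
    obtain ⟨W, hW⟩ := T.exists_maximal hne
    have hWT := hW.1
    have key : g W ∈ nullFun μ := by
      refine mem_nullFun_of_add_sum μ hs hp (insert ⊥ (T.erase W)) ?_ _ (hg W hWT)
        (Function.update g ⊥ f) ?_ ?_
      · intro W' hW' hle
        rcases Finset.mem_insert.1 hW' with rfl | hW'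
        · exact hT W hWT (le_bot_iff.1 hle)
        · have := hW.2 (Finset.mem_of_mem_erase hW') hle
          exact (Finset.ne_of_mem_erase hW') (le_antisymm this hle)
      · intro W' hW'
        rcases Finset.mem_insert.1 hW' with rfl | hW'
        · simpa using hf
        · have h' := Finset.mem_of_mem_erase hW'
          rw [Function.update_of_ne (hT W' h')]
          exact hg W' h'
      · have hb : (⊥ : Submodule ℝ V) ∉ T.erase W := fun hb => hT ⊥ (Finset.mem_of_mem_erase hb) rfl
        rw [Finset.sum_insert hb, Function.update_self, Finset.sum_congr rfl
          fun W' hW' => Function.update_of_ne (hT W' (Finset.mem_of_mem_erase hW')) f g,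
          add_left_comm, Finset.add_sum_erase T g hWT]
        exact h
    refine ih (T.erase W) (Finset.erase_ssubset hWT)
      (fun W' hW' => hT W' (Finset.mem_of_mem_erase hW'))
      (fun W' hW' => hg W' (Finset.mem_of_mem_erase hW')) ?_
    rw [← Finset.add_sum_erase T g hWT, add_left_comm] at h
    exact ((nullFun μ).add_mem_iff_right key).1 h

/-- A polynomial function is only a sum of functions decaying along nonzero subspaces if it
vanishes. -/
theorem mem_nullFun_of_mem_iSup_tame [FiniteDimensional ℝ V] {f g : V → ℂ}
    (hf : f ∈ tame μ B ⊥) (hg : g ∈ ⨆ W : {W : Submodule ℝ V // W ≠ ⊥}, tame μ B W.1)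
    (h : f - g ∈ nullFun μ) : f ∈ nullFun μ := by
  classical
  obtain ⟨G, hG, rfl⟩ := (Submodule.mem_iSup_iff_exists_finsupp _ _).1 hg
  refine mem_nullFun_of_sum μ hs hp (G.support.map (Function.Embedding.subtype _)) ?_ f hf
    (fun W => if hW : W ≠ ⊥ then - G ⟨W, hW⟩ else 0) ?_ ?_
  · intro W hW
    obtain ⟨W, -, rfl⟩ := Finset.mem_map.1 hW
    exact W.2
  · intro W hW
    obtain ⟨W, -, rfl⟩ := Finset.mem_map.1 hW
    simpa [W.2] using hG W
  · rw [Finset.sum_map]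
    have : ∀ W : {W : Submodule ℝ V // W ≠ ⊥},
        (if hW : (Function.Embedding.subtype _ W : Submodule ℝ V) ≠ ⊥ then
          - G ⟨Function.Embedding.subtype _ W, hW⟩ else 0) = - G W := by
      intro W
      rw [dif_pos (show (Function.Embedding.subtype _ W : Submodule ℝ V) ≠ ⊥ from W.2)]
      rfl
    simp only [this, Finset.sum_neg_distrib, ← sub_eq_add_neg]
    exact h

end Tame

/-! ### Linear forms as functions -/

namespace LinForm

theorem eval_add (v w : LinForm) (ζ : ℕ → ℂ) : eval (v + w) ζ = eval v ζ + eval w ζ :=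
  Finsupp.sum_add_index' (by simp) (by intros; push_cast; ring)

theorem eval_smul (c : ℝ) (v : LinForm) (ζ : ℕ → ℂ) : eval (c • v) ζ = c * eval v ζ := by
  rw [eval, Finsupp.sum_smul_index' (by simp), eval, Finsupp.mul_sum]
  refine Finsupp.sum_congr fun i _ => ?_
  rw [smul_eq_mul]
  push_cast
  ring

theorem eval_zero (ζ : ℕ → ℂ) : eval 0 ζ = 0 := Finsupp.sum_zero_index

theorem eval_neg (v : LinForm) (ζ : ℕ → ℂ) : eval (-v) ζ = -eval v ζ := by
  have := eval_smul (-1) v ζ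
  simpa using this

theorem eval_sub (v w : LinForm) (ζ : ℕ → ℂ) : eval (v - w) ζ = eval v ζ - eval w ζ := by
  rw [sub_eq_add_neg, eval_add, eval_neg, sub_eq_add_neg]

theorem eval_sum {ι : Type*} (s : Finset ι) (v : ι → LinForm) (ζ : ℕ → ℂ) :
    eval (∑ i ∈ s, v i) ζ = ∑ i ∈ s, eval (v i) ζ := by
  classical
  induction s using Finset.induction_on with
  | empty => simp [eval_zero]
  | insert i s hi ih => rw [Finset.sum_insert hi, Finset.sum_insert hi, eval_add, ih]

theorem eval_smul_right (v : LinForm) (c : ℂ) (ζ : ℕ → ℂ) : eval v (c • ζ) = c * eval v ζ := by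
  rw [eval, eval, Finsupp.mul_sum]
  refine Finsupp.sum_congr fun i _ => ?_
  rw [Pi.smul_apply, smul_eq_mul]
  ring

theorem continuous_eval (v : LinForm) : Continuous (eval v) :=
  continuous_finsetSum _ fun i _ => continuous_const.mul (continuous_apply i)

theorem eval_zero_right (v : LinForm) : eval v 0 = 0 := by simp [eval]

/-- The linear form only involves the first `m` coordinates. -/
def SupportedBelow (m : ℕ) (v : LinForm) : Prop := ∀ i, m ≤ i → v i = 0

theorem eventually_supportedBelow (v : LinForm) : ∀ᶠ m in atTop, SupportedBelow m v := by
  filter_upwards [eventually_gt_atTop (v.support.sup id)] with m hm i hi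
  by_contra h
  have := Finset.le_sup (f := id) (Finsupp.mem_support_iff.2 h)
  simp only [id] at this
  omega

theorem SupportedBelow.eval_eq {m : ℕ} {v : LinForm} (h : SupportedBelow m v) (ζ : ℕ → ℂ) :
    eval v ζ = ∑ i : Fin m, (v i : ℂ) * ζ i := by
  rw [Fin.sum_univ_eq_sum_range fun i => (v i : ℂ) * ζ i]
  refine Finset.sum_subset (fun i hi => ?_) (fun i _ hi => ?_)
  · by_contra h'
    exact Finsupp.mem_support_iff.1 hi (h i (by simpa using h'))
  · simp [Finsupp.notMem_support_iff.1 hi]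

end LinForm

/-- The first `m` coordinates of a point. -/
def trunc (m : ℕ) (ζ : ℕ → ℂ) : Fin m → ℂ := fun i => ζ i

theorem continuous_trunc (m : ℕ) : Continuous (trunc m) := continuous_pi fun _ => continuous_apply _

/-- The point with given first `m` coordinates and vanishing further coordinates. -/
def extend (m : ℕ) (x : Fin m → ℂ) : ℕ → ℂ := fun i => if h : i < m then x ⟨i, h⟩ else 0

theorem continuous_extend (m : ℕ) : Continuous (extend m) := by
  refine continuous_pi fun i => ?_
  unfold extend
  split_ifs with h
  · exact continuous_apply _
  · exact continuous_const

theorem extend_zero (m : ℕ) : extend m 0 = 0 := by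
  ext i
  simp [extend]

theorem tendsto_trunc (m : ℕ) : Tendsto (trunc m) (𝓝 0) (𝓝 0) :=
  (continuous_trunc m).tendsto' _ _ rfl

theorem tendsto_extend (m : ℕ) : Tendsto (extend m) (𝓝 0) (𝓝 0) :=
  (continuous_extend m).tendsto' _ _ (extend_zero m)

theorem LinForm.SupportedBelow.eval_extend_trunc {m : ℕ} {v : LinForm} (h : v.SupportedBelow m)
    (ζ : ℕ → ℂ) : v.eval (extend m (trunc m ζ)) = v.eval ζ := by
  rw [h.eval_eq, h.eval_eq]
  refine Finset.sum_congr rfl fun i _ => ?_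
  rw [show extend m (trunc m ζ) i = ζ i by simp [extend, trunc]]

/-- Finitely many linear forms involve finitely many coordinates. Stating this for all large `m`
allows a common `m` to be chosen together with other conditions. -/
theorem IsHoloGerm.eventually_exists {γ : PointGerm} (h : IsHoloGerm γ) :
    ∀ᶠ m in atTop, ∃ F : (Fin m → ℂ) → ℂ, IsRealHolo F ∧
      γ = ((fun ζ => F (trunc m ζ) : (ℕ → ℂ) → ℂ) : PointGerm) := by
  obtain ⟨k, F, ℓ, ⟨hF, hF'⟩, rfl⟩ := h
  filter_upwards [eventually_all.2 fun i => (ℓ i).eventually_supportedBelow] with m hm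
  let A : (Fin m → ℂ) →L[ℂ] (Fin k → ℂ) :=
    ContinuousLinearMap.pi fun j => ∑ i : Fin m, (ℓ j i : ℂ) • ContinuousLinearMap.proj i
  have hA : ∀ x j, A x j = ∑ i : Fin m, (ℓ j i : ℂ) * x i := by
    intro x j
    simp [A]
  refine ⟨fun x => F (A x), ⟨?_, ?_⟩, ?_⟩
  · refine AnalyticAt.fun_comp (g := F) ?_ (A.analyticAt 0)
    rwa [map_zero]
  · have ht : Tendsto (fun (t : Fin m → ℝ) (j : Fin k) => ∑ i : Fin m, ℓ j i * t i)
        (𝓝 0) (𝓝 0) := Continuous.tendsto' (by fun_prop) _ _ (by ext; simp)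
    filter_upwards [ht.eventually hF'] with t ⟨r, hr⟩
    refine ⟨r, ?_⟩
    rw [← hr]
    congr 1
    ext j
    rw [hA]
    push_cast
    rfl
  · refine Germ.coe_eq.2 (.of_forall fun ζ => congrArg F ?_)
    ext j
    rw [hA, (hm j).eval_eq]
    rfl

/-! ### Points in general position -/

/-- On the moment curve `τ ↦ (τ ^ i)` a nonzero form becomes a nonzero polynomial in `τ`; take `τ`
outside the finitely many roots. -/
theorem exists_forall_eval_ne_zero (T : Finset NzForm) :
    ∃ z : ℕ → ℝ, ∀ v ∈ T, v.1.eval (fun i => (z i : ℂ)) ≠ 0 := by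
  classical
  let P : NzForm → Polynomial ℝ := fun v => ∑ i ∈ v.1.support, Polynomial.monomial i (v.1 i)
  have hP : ∀ v, P v ≠ 0 := by
    intro v hv
    refine v.2 (Finsupp.ext fun i => ?_)
    have : (P v).coeff i = v.1 i := by
      simp only [P, Polynomial.finsetSum_coeff, Polynomial.coeff_monomial]
      rw [Finset.sum_ite_eq']
      split_ifs with h
      · rfl
      · exact (Finsupp.notMem_support_iff.1 h).symm
    rw [← this, hv]
    simp
  obtain ⟨τ, hτ⟩ := Infinite.exists_notMem_finset (∏ v ∈ T, P v).roots.toFinset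
  have h0 : ∏ v ∈ T, P v ≠ 0 := Finset.prod_ne_zero_iff.2 fun v _ => hP v
  rw [Multiset.mem_toFinset, Polynomial.mem_roots h0, Polynomial.IsRoot, Polynomial.eval_prod] at hτ
  refine ⟨fun i => τ ^ i, fun v hv => ?_⟩
  have h1 : (P v).eval τ ≠ 0 := fun h => hτ (Finset.prod_eq_zero hv h)
  have h2 : v.1.eval (fun i => ((τ ^ i : ℝ) : ℂ)) = ((P v).eval τ : ℝ) := by
    simp only [LinForm.eval, P, Polynomial.eval_finsetSum, Polynomial.eval_monomial, Finsupp.sum]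
    push_cast
    rfl
  rw [h2]
  exact_mod_cast h1

/-- The points near `0` at which no nonzero linear form vanishes; of course, only finitely many
linear forms can be avoided at a time. -/
def genericNhds : Filter (ℕ → ℂ) where
  sets := {s | ∃ T : Finset NzForm, ∀ᶠ ζ in 𝓝 0, (∀ v ∈ T, v.1.eval ζ ≠ 0) → ζ ∈ s}
  univ_sets := ⟨∅, by simp⟩
  sets_of_superset := fun ⟨T, hT⟩ h => ⟨T, hT.mono fun ζ hζ h' => h (hζ h')⟩
  inter_sets := by
    classical
    rintro s t ⟨T, hT⟩ ⟨T', hT'⟩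
    refine ⟨T ∪ T', ?_⟩
    filter_upwards [hT, hT'] with ζ h h' h''
    exact ⟨h fun v hv => h'' v (Finset.mem_union_left _ hv),
      h' fun v hv => h'' v (Finset.mem_union_right _ hv)⟩

theorem eventually_genericNhds {p : (ℕ → ℂ) → Prop} : (∀ᶠ ζ in genericNhds, p ζ) ↔
    ∃ T : Finset NzForm, ∀ᶠ ζ in 𝓝 0, (∀ v ∈ T, v.1.eval ζ ≠ 0) → p ζ := Iff.rfl

theorem genericNhds_le : genericNhds ≤ 𝓝 0 := fun _ hs => ⟨∅, mem_of_superset hs fun _ h _ => h⟩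

theorem eventually_eval_ne_zero (v : NzForm) : ∀ᶠ ζ in genericNhds, v.1.eval ζ ≠ 0 :=
  ⟨{v}, .of_forall fun _ h => h v (Finset.mem_singleton_self v)⟩

/-- A germ of an analytic function that vanishes at the generic points of a half space is zero. -/
theorem eventually_eq_zero_of_halfSpace {m : ℕ} {F : (Fin m → ℂ) → ℂ} (hF : AnalyticAt ℂ F 0)
    (a : NzForm) (h : ∀ᶠ ζ in genericNhds, 0 < (a.1.eval ζ).re → F (trunc m ζ) = 0)  :
    ∀ᶠ ζ in 𝓝 (0 : ℕ → ℂ), F (trunc m ζ) = 0 := by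
  classical
  obtain ⟨T, hT⟩ := eventually_genericNhds.1 h
  obtain ⟨M, hM, hMm⟩ := (((Finset.eventually_all (insert a T)).2
    fun v _ => v.1.eventually_supportedBelow).and (eventually_ge_atTop m)).exists
  -- `F` is pulled back to `ℂ^M`, with `M` large enough for all excluded forms and for `a`, so that
  -- the identity theorem can be used in finite dimension.
  let r : (Fin M → ℂ) → (Fin m → ℂ) := fun x => trunc m (extend M x)
  have hr : ∀ ζ, r (trunc M ζ) = trunc m ζ := by
    intro ζ
    ext i
    simp [r, trunc, extend, i.2.trans_le hMm]
  have hr' : AnalyticAt ℂ (fun x => F (r x)) 0 := by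
    refine AnalyticAt.fun_comp (g := F) (f := r) ?_ ?_
    · have : r 0 = 0 := by simp only [r, extend_zero]; rfl
      rwa [this]
    · rw [analyticAt_pi_iff]
      intro i
      have : (fun x : Fin M → ℂ => r x i) = fun x => x ⟨i, i.2.trans_le hMm⟩ := by
        funext x
        simp [r, trunc, extend, i.2.trans_le hMm]
      rw [this]
      exact (ContinuousLinearMap.proj (R := ℂ) (φ := fun _ : Fin M => ℂ) _).analyticAt 0
  have h1 : ∀ᶠ x in 𝓝 (0 : Fin M → ℂ), (∀ v ∈ T, v.1.eval (extend M x) ≠ 0) →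
      0 < (a.1.eval (extend M x)).re → F (r x) = 0 := (tendsto_extend M).eventually hT
  obtain ⟨ε, hε, hball⟩ := Metric.eventually_nhds_iff_ball.1 (h1.and hr'.eventually_analyticAt)
  obtain ⟨z, hz⟩ := exists_forall_eval_ne_zero (insert a T)
  obtain ⟨s, hs⟩ : ∃ s : ℝ, 0 < s * (a.1.eval fun i => (z i : ℂ)).re := by
    have him : (a.1.eval fun i => (z i : ℂ)).im = 0 := by
      simp [LinForm.eval, Finsupp.sum, ← Complex.ofReal_mul]
    have hne : (a.1.eval fun i => (z i : ℂ)).re ≠ 0 := fun h0 =>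
      hz a (Finset.mem_insert_self _ _) (Complex.ext h0 him)
    exact ⟨(a.1.eval fun i => (z i : ℂ)).re, mul_self_pos.2 hne⟩
  have hs0 : s ≠ 0 := by
    rintro rfl
    simp at hs
  -- The generic real point, rescaled so that `a` is positive on it. A small positive multiple of
  -- `y` lies in the ball and satisfies the open conditions strictly, so `F ∘ r` vanishes near it,
  -- hence on the whole ball.
  let y : Fin M → ℂ := s • trunc M fun i => (z i : ℂ)
  have hev : ∀ (t : ℝ) (v : NzForm), v ∈ insert a T →
      v.1.eval (extend M (t • y)) = ((t * s : ℝ) : ℂ) * v.1.eval fun i => (z i : ℂ) := by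
    intro t v hv
    have : t • y = trunc M (((t * s : ℝ) : ℂ) • fun i => (z i : ℂ)) := by
      ext i
      simp [y, trunc, mul_assoc]
    rw [this, (hM v hv).eval_extend_trunc, LinForm.eval_smul_right]
  have hty : Tendsto (fun t : ℝ => t • y) (𝓝[>] 0) (𝓝 0) :=
    ((continuous_id.smul continuous_const).tendsto' _ _ (zero_smul ℝ y)).mono_left
      nhdsWithin_le_nhds
  obtain ⟨t, ht, ht0⟩ :=
    ((hty.eventually (Metric.ball_mem_nhds 0 hε)).and self_mem_nhdsWithin).exists
  have ht0' : 0 < t := ht0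
  have hcT : ∀ v ∈ T, v.1.eval (extend M (t • y)) ≠ 0 := by
    intro v hv
    rw [hev t v (Finset.mem_insert_of_mem hv)]
    exact mul_ne_zero (Complex.ofReal_ne_zero.2 (mul_ne_zero ht0'.ne' hs0))
      (hz v (Finset.mem_insert_of_mem hv))
  have hca : 0 < (a.1.eval (extend M (t • y))).re := by
    rw [hev t a (Finset.mem_insert_self _ _), Complex.re_ofReal_mul, mul_assoc]
    exact mul_pos ht0' hs
  have hcont : ∀ v : NzForm, Continuous fun x => v.1.eval (extend M x) := fun v =>
    v.1.continuous_eval.comp (continuous_extend M)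
  have hnear : ∀ᶠ x in 𝓝 (t • y), F (r x) = 0 := by
    have e1 : ∀ᶠ x in 𝓝 (t • y), ∀ v ∈ T, v.1.eval (extend M x) ≠ 0 :=
      (Finset.eventually_all T).2 fun v hv => (hcont v).continuousAt.eventually_ne (hcT v hv)
    have e2 : ∀ᶠ x in 𝓝 (t • y), 0 < (a.1.eval (extend M x)).re :=
      (Complex.continuous_re.comp (hcont a)).continuousAt.eventually (lt_mem_nhds hca)
    filter_upwards [e1, e2, Metric.isOpen_ball.mem_nhds ht] with x h1 h2 h3
    exact (hball x h3).1 h1 h2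
  have hz0 : Set.EqOn (fun x => F (r x)) 0 (Metric.ball 0 ε) :=
    AnalyticOnNhd.eqOn_zero_of_preconnected_of_eventuallyEq_zero
      (fun x hx => (hball x hx).2) (convex_ball _ _).isPreconnected ht hnear
  filter_upwards [(tendsto_trunc M).eventually (Metric.ball_mem_nhds 0 hε)] with ζ hζ
  rw [← hr]
  exact hz0 hζ

/-! ### The values of meromorphic germs -/

/-- Holomorphic germs as germs at generic points. -/
def holoVal : HoloGerm →+* Germ genericNhds ℂ where
  toFun γ := γ.1.compTendsto id (tendsto_id'.2 genericNhds_le)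
  map_one' := rfl
  map_zero' := rfl
  map_add' := by
    rintro ⟨⟨γ⟩, _⟩ ⟨⟨δ⟩, _⟩
    rfl
  map_mul' := by
    rintro ⟨⟨γ⟩, _⟩ ⟨⟨δ⟩, _⟩
    rfl

theorem holoVal_eq {h : HoloGerm} {H : (ℕ → ℂ) → ℂ} (e : (H : PointGerm) = h.1) :
    holoVal h = (H : Germ genericNhds ℂ) := by
  obtain ⟨_, _⟩ := h
  subst e
  rfl

theorem isUnit_holoVal (s : linDenoms) : IsUnit (holoVal s) := by
  obtain ⟨s, hs⟩ := s
  induction hs using Submonoid.closure_induction with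
  | mem x hx =>
    obtain ⟨v, rfl⟩ := hx
    refine IsUnit.of_mul_eq_one ((fun ζ => (v.1.eval ζ)⁻¹ : (ℕ → ℂ) → ℂ) : Germ genericNhds ℂ) ?_
    change (((fun ζ => v.1.eval ζ * (v.1.eval ζ)⁻¹ : (ℕ → ℂ) → ℂ)) : Germ genericNhds ℂ) =
      ((fun _ => 1 : (ℕ → ℂ) → ℂ) : Germ genericNhds ℂ)
    exact Germ.coe_eq.2 ((eventually_eval_ne_zero v).mono fun ζ hζ => mul_inv_cancel₀ hζ)
  | one => simp
  | mul x y _ _ hx hy => rw [map_mul]; exact hx.mul hy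

/-- Meromorphic germs as germs of functions at generic points. -/
def val : Mero →+* Germ genericNhds ℂ := IsLocalization.lift (M := linDenoms) isUnit_holoVal

theorem val_algebraMap (h : HoloGerm) : val (algebraMap HoloGerm Mero h) = holoVal h :=
  IsLocalization.lift_eq _ _

theorem eventually_ne_zero {s : linDenoms} {S : (ℕ → ℂ) → ℂ} (hS : (S : PointGerm) = s.1.1) :
    ∀ᶠ ζ in genericNhds, S ζ ≠ 0 := by
  have h := isUnit_holoVal s
  rw [holoVal_eq hS] at h
  obtain ⟨⟨γ⟩, hγ⟩ := h.exists_right_inv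
  change (((fun ζ => S ζ * γ ζ : (ℕ → ℂ) → ℂ)) : Germ genericNhds ℂ) =
      ((fun _ => 1 : (ℕ → ℂ) → ℂ) : Germ genericNhds ℂ) at hγ
  refine (Germ.coe_eq.1 hγ).mono fun ζ hζ h0 => ?_
  simp [h0] at hζ

theorem val_mk {h : HoloGerm} {s : linDenoms} {H S : (ℕ → ℂ) → ℂ} (hH : (H : PointGerm) = h.1)
    (hS : (S : PointGerm) = s.1.1) :
    val (Localization.mk h s) = ((fun ζ => H ζ / S ζ : (ℕ → ℂ) → ℂ) : Germ genericNhds ℂ) := by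
  rw [Localization.mk_eq_mk', val, IsLocalization.lift_mk'_spec, holoVal_eq hH]
  change _ = holoVal s.1 * _
  rw [holoVal_eq hS]
  refine Germ.coe_eq.2 ((eventually_ne_zero hS).mono fun ζ hζ => ?_)
  exact (mul_div_cancel₀ _ hζ).symm

/-- A denominator has no zeros at generic points, so it is the numerator that vanishes on the half
space, and hence identically. -/
theorem eq_zero_of_val_halfSpace {f : Mero} {φ : (ℕ → ℂ) → ℂ}
    (hφ : val f = (φ : Germ genericNhds ℂ)) (a : NzForm)
    (h : ∀ᶠ ζ in genericNhds, 0 < (a.1.eval ζ).re → φ ζ = 0) : f = 0 := by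
  induction f using Localization.induction_on with
  | H x =>
    obtain ⟨p, s⟩ := x
    obtain ⟨m, F, ⟨hF, -⟩, hp⟩ := p.2.eventually_exists.exists
    obtain ⟨S, hS⟩ : ∃ S : (ℕ → ℂ) → ℂ, (S : PointGerm) = s.1.1 := Quotient.exists_rep s.1.1
    rw [val_mk hp.symm hS] at hφ
    have h0 : ∀ᶠ ζ in genericNhds, 0 < (a.1.eval ζ).re → F (trunc m ζ) = 0 := by
      filter_upwards [Germ.coe_eq.1 hφ, h, eventually_ne_zero hS] with ζ h1 h2 h3 h4
      rw [h2 h4, div_eq_zero_iff] at h1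
      exact h1.resolve_right h3
    have hp0 : p = 0 := Subtype.ext (by
      rw [hp]
      exact Germ.coe_eq.2 (eventually_eq_zero_of_halfSpace hF a h0))
    rw [hp0]
    exact Localization.mk_zero _

section

/-! ### Homogeneous expansions at real points -/

/-- Multilinear expansion over the set `s` of slots filled with `y`; the other slots contribute the
power `c ^ #sᶜ`. -/
theorem exists_polynomial_eval_line {k n : ℕ}
    (q : ContinuousMultilinearMap ℂ (fun _ : Fin n => Fin k → ℂ) ℂ) (y y' : Fin k → ℂ) :
    ∃ P : Polynomial ℂ, P.natDegree ≤ n ∧ ∀ c : ℂ, q (fun _ => y + c • y') = P.eval c := by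
  classical
  refine ⟨∑ s : Finset (Fin n), Polynomial.monomial (sᶜ).card
    (q (s.piecewise (fun _ => y) fun _ => y')), ?_, fun c => ?_⟩
  · refine Polynomial.natDegree_sum_le_of_forall_le _ _ fun s _ =>
      (Polynomial.natDegree_monomial_le _).trans ?_
    simpa using Finset.card_le_univ sᶜ
  · have h := q.toMultilinearMap.map_add_univ (fun _ => y) (fun _ => c • y')
    simp only [Polynomial.eval_finsetSum, Polynomial.eval_monomial]
    refine h.trans (Finset.sum_congr rfl fun s _ => ?_)
    have h2 := q.toMultilinearMap.map_piecewise_smul (fun _ => c)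
      (s.piecewise (fun _ => y) fun _ => y') sᶜ
    rw [Finset.prod_const, smul_eq_mul, mul_comm] at h2
    refine Eq.trans (congrArg q ?_) h2
    funext i
    by_cases hi : i ∈ s <;> simp [Finset.piecewise, hi]

/-- The iterated difference at `z` only sees the samples `f (z + k • ξ)`, so it equals that of `P`
at `0`. -/
theorem fwdDiff_iter_eq_zero_of_polynomial {V : Type*} [AddCommGroup V] (f : V → ℂ) (ξ z : V)
    (P : Polynomial ℂ) {N : ℕ} (hN : P.natDegree < N)
    (h : ∀ k : ℕ, f (z + k • ξ) = P.eval (k : ℂ)) : (fwdDiff ξ)^[N] f z = 0 := by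
  have h1 := congrFun (Polynomial.fwdDiff_iter_eq_zero_of_degree_lt hN) 0
  rw [fwdDiff_iter_eq_sum_shift] at h1 ⊢
  rw [← Pi.zero_apply (M := fun _ => ℂ) (0 : ℂ), ← h1]
  refine Finset.sum_congr rfl fun k _ => ?_
  rw [h k]
  simp

/-- The vectors with vanishing coordinates beyond the first `m`. -/
def emb (m : ℕ) : (Fin m → ℝ) →ₗ[ℝ] LinForm :=
  ∑ i : Fin m, (Finsupp.lsingle (i : ℕ)).comp (LinearMap.proj i)

theorem emb_apply_of_lt (m : ℕ) (z : Fin m → ℝ) (i : Fin m) : emb m z i = z i := by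
  classical
  simp only [emb, LinearMap.sum_apply, LinearMap.comp_apply, LinearMap.proj_apply,
    Finsupp.lsingle_apply, Finsupp.finsetSum_apply, Finsupp.single_apply, Fin.val_inj]
  simp

theorem emb_restrict {m : ℕ} {v : LinForm} (h : v.SupportedBelow m) :
    emb m (fun i => v i) = v := by
  ext i
  by_cases hi : i < m
  · exact emb_apply_of_lt m _ ⟨i, hi⟩
  · rw [h i (not_lt.1 hi)]
    simp only [emb, LinearMap.sum_apply, LinearMap.comp_apply, LinearMap.proj_apply,
      Finsupp.lsingle_apply, Finsupp.finsetSum_apply]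
    exact Finset.sum_eq_zero fun j _ => Finsupp.single_eq_of_ne (by have := j.2; omega)

theorem emb_injective (m : ℕ) : Function.Injective (emb m) := fun z w h => by
  ext i
  rw [← emb_apply_of_lt m z, h, emb_apply_of_lt]

variable (Q : InnerProd)

/-- The inner product of `ℝᵐ`. -/
def InnerProd.formOn (m : ℕ) : LinearMap.BilinForm ℝ (Fin m → ℝ) :=
  Q.form.compl₁₂ (emb m) (emb m)

theorem InnerProd.formOn_symm (m : ℕ) (v w : Fin m → ℝ) : Q.formOn m v w = Q.formOn m w v :=
  Q.symm _ _

theorem InnerProd.formOn_pos (m : ℕ) (v : Fin m → ℝ) (hv : v ≠ 0) : 0 < Q.formOn m v v :=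
  Q.pos _ fun h => hv (emb_injective m (h.trans (map_zero _).symm))

/-- The point of `ℝᵐ` given by a vector. -/
def pt (m : ℕ) (z : Fin m → ℝ) : ℕ → ℂ :=
  fun i => (Q.form (Finsupp.single i 1) (emb m z) : ℂ)

theorem eval_pt (v : LinForm) (m : ℕ) (z : Fin m → ℝ) :
    v.eval (pt Q m z) = (Q.form v (emb m z) : ℂ) := by
  have : v = v.sum fun i a => a • Finsupp.single i 1 := by
    conv_lhs => rw [← Finsupp.sum_single v]
    simp
  conv_rhs => rw [this, Finsupp.sum, map_sum, LinearMap.sum_apply]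
  simp only [LinForm.eval, Finsupp.sum, pt, map_smul, LinearMap.smul_apply, smul_eq_mul]
  push_cast
  rfl

variable {Q}

/-- Along the span of the `L_j` the numerator is constant, since every `ℓ_i` is orthogonal to it,
while the denominator grows. Orthogonally to the span the denominator is constant and the numerator
is polynomial of degree at most `d`, so `d + 1` differences kill it. -/
theorem div_prod_mem_tame {k n m d : ℕ}
    (q : ContinuousMultilinearMap ℂ (fun _ : Fin d => Fin k → ℂ) ℂ) (ℓ : Fin k → LinForm)
    (L : Fin n → LinForm) (hL : ∀ j, (L j).SupportedBelow m)
    (ho : ∀ i j, Q.form (ℓ i) (L j) = 0) :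
    (fun z => q (fun _ i => (ℓ i).eval (pt Q m z)) / ∏ j, (L j).eval (pt Q m z)) ∈
      tame volume (Q.formOn m)
        (Submodule.span ℝ (Set.range fun j (i : Fin m) => L j i)) := by
  have hLz : ∀ j z, (L j).eval (pt Q m z) = (Q.formOn m (fun i => L j i) z : ℂ) := by
    intro j z
    rw [eval_pt, InnerProd.formOn, LinearMap.compl₁₂_apply, emb_restrict (hL j)]
  have hℓ : ∀ i, ∀ η ∈ Submodule.span ℝ (Set.range fun j (i : Fin m) => L j i),
      Q.form (ℓ i) (emb m η) = 0 := by
    intro i η hη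
    induction hη using Submodule.span_induction with
    | mem x hx =>
      obtain ⟨j, rfl⟩ := hx
      simp only
      rw [emb_restrict (hL j), ho]
    | zero => simp
    | add x y _ _ hx hy => rw [map_add, map_add, hx, hy, add_zero]
    | smul c x _ hx => rw [map_smul, map_smul, hx, smul_zero]
  refine ⟨fun η hη h0 => .of_forall fun z => ?_, fun ξ hξ => ⟨d + 1, (mem_nullFun volume).2 (.of_forall fun z => ?_)⟩⟩
  -- Otherwise `η`, being in the span of the `L_j`, would be orthogonal to itself.
  · have hne : ∃ j, Q.formOn m (fun i => L j i) η ≠ 0 := by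
      by_contra! hcon
      refine (Q.formOn_pos m η h0).ne' ?_
      have : ∀ η' ∈ Submodule.span ℝ (Set.range fun j (i : Fin m) => L j i),
          Q.formOn m η' η = 0 := by
        intro η' hη'
        induction hη' using Submodule.span_induction with
        | mem x hx =>
          obtain ⟨j, rfl⟩ := hx
          exact hcon j
        | zero => simp
        | add x y _ _ hx hy => rw [map_add, LinearMap.add_apply, hx, hy, add_zero]
        | smul c x _ hx => rw [map_smul, LinearMap.smul_apply, hx, smul_zero]
      exact this η hη
    obtain ⟨j, hj⟩ := hne
    have hconst : ∀ (r : ℕ) i, (ℓ i).eval (pt Q m (z + r • η)) = (ℓ i).eval (pt Q m z) := by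
      intro r i
      rw [eval_pt, eval_pt, map_add, map_add, map_nsmul, map_nsmul, hℓ i η hη]
      simp
    simp only [hconst, div_eq_mul_inv, ← Finset.prod_inv_distrib]
    -- Each denominator is affine in `r` with slope `Q(L_j, η)`. Its inverse tends to `0` for
    -- nonzero slope and is constant for slope zero, also when it is `0⁻¹ = 0`; so every factor
    -- converges and at least one tends to `0`.
    have hfac : ∀ j, Tendsto (fun r : ℕ => ((L j).eval (pt Q m (z + r • η)))⁻¹) atTop
        (𝓝 (if Q.formOn m (fun i => L j i) η = 0 then ((L j).eval (pt Q m z))⁻¹ else 0)) := by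
      intro j
      have e : ∀ r : ℕ, (L j).eval (pt Q m (z + r • η)) =
          ((Q.formOn m (fun i => L j i) z + r * Q.formOn m (fun i => L j i) η : ℝ) : ℂ) := by
        intro r
        rw [hLz, map_add, map_nsmul, nsmul_eq_mul]
      simp only [e]
      split_ifs with h
      · simp only [h, mul_zero, add_zero, hLz]
        exact tendsto_const_nhds
      · have h1 : Tendsto (fun r : ℕ => (r : ℝ) * Q.formOn m (fun i => L j i) η) atTop
            (Bornology.cobounded ℝ) := by
          rw [← tendsto_norm_atTop_iff_cobounded]
          simp only [norm_mul, RCLike.norm_natCast]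
          exact tendsto_natCast_atTop_atTop.atTop_mul_const (norm_pos_iff.2 h)
        have h2 : Tendsto (fun r : ℕ => (Q.formOn m (fun i => L j i) z +
            (r : ℝ) * Q.formOn m (fun i => L j i) η)⁻¹) atTop (𝓝 0) :=
          tendsto_inv₀_cobounded.comp (tendsto_const_add_cobounded _ |>.comp h1)
        have := (Complex.continuous_ofReal.tendsto 0).comp h2
        simpa [Function.comp_def] using this
    have := (tendsto_finsetProd Finset.univ fun j _ => hfac j).const_mul
      (q fun _ i => (ℓ i).eval (pt Q m z))
    rwa [Finset.prod_eq_zero (Finset.mem_univ j) (if_neg hj), mul_zero] at this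
  · obtain ⟨P, hP, hP'⟩ := exists_polynomial_eval_line q (fun i => (ℓ i).eval (pt Q m z))
      (fun i => (ℓ i).eval (pt Q m ξ))
    have hconst : ∀ (r : ℕ) j, (L j).eval (pt Q m (z + r • ξ)) = (L j).eval (pt Q m z) := by
      intro r j
      rw [hLz, hLz, map_add, map_nsmul, hξ _ (Submodule.subset_span ⟨j, rfl⟩)]
      simp
    rw [diff_pow_eq_fwdDiff]
    refine fwdDiff_iter_eq_zero_of_polynomial _ ξ z
      (Polynomial.C (∏ j, (L j).eval (pt Q m z))⁻¹ * P) (N := d + 1)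
      (Nat.lt_succ_of_le ((Polynomial.natDegree_C_mul_le _ _).trans hP)) fun r => ?_
    simp only [hconst]
    rw [Polynomial.eval_mul, Polynomial.eval_C, div_eq_inv_mul, ← hP']
    congr 3
    funext _ i
    rw [eval_pt, map_add, map_add, map_nsmul, map_nsmul]
    simp [eval_pt]

/-- On the line through `z` the degree `d` part of `F` scales by `t ^ d` and the denominator by `t ^
n`, so the coefficient of `t ^ r` is the part of degree `r + n` over the denominator. With division
by zero equal to `0`, this also holds where some `L_j` vanishes at `z`. -/
theorem exists_laurent_coeff {k n m : ℕ} {F : (Fin k → ℂ) → ℂ} (hF : AnalyticAt ℂ F 0)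
    (ℓ : Fin k → LinForm) (L : Fin n → LinForm) (hL : ∀ j, (L j).SupportedBelow m)
    (ho : ∀ i j, Q.form (ℓ i) (L j) = 0) :
    ∃ c : ℤ → (Fin m → ℝ) → ℂ, (∀ r < -(n : ℤ), c r = 0) ∧
      (∀ r, c r ∈ tame volume (Q.formOn m)
        (Submodule.span ℝ (Set.range fun j (i : Fin m) => L j i))) ∧
      ∀ z, ∀ᶠ t in 𝓝[≠] (0 : ℂ), HasSum (fun r : ℤ => c r z * t ^ r)
        (F (fun i => (ℓ i).eval (t • pt Q m z)) / ∏ j, (L j).eval (t • pt Q m z)) := by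
  obtain ⟨p, hp⟩ := hF
  refine ⟨fun (r : ℤ) z => if 0 ≤ r + n then p (r + n).toNat (fun _ i => (ℓ i).eval (pt Q m z)) /
    (∏ j, (L j).eval (pt Q m z)) else 0, fun r hr => ?_, fun r => ?_, fun z => ?_⟩
  · funext z
    exact if_neg (by omega)
  · by_cases h : 0 ≤ r + n
    · simp only [h, if_true]
      exact div_prod_mem_tame _ ℓ L hL ho
    · simp only [h, if_false]
      exact Submodule.zero_mem _
  · have ht : Tendsto (fun t : ℂ => t • fun i => (ℓ i).eval (pt Q m z)) (𝓝[≠] 0) (𝓝 0) :=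
      ((continuous_id.smul continuous_const).tendsto' _ _ (zero_smul ℂ _)).mono_left
        nhdsWithin_le_nhds
    filter_upwards [ht.eventually hp.eventually_hasSum, self_mem_nhdsWithin] with t hsum ht0
    have ht0 : t ≠ 0 := ht0
    rw [zero_add] at hsum
    have e1 : (fun i => (ℓ i).eval (t • pt Q m z)) = t • fun i => (ℓ i).eval (pt Q m z) := by
      funext i
      rw [LinForm.eval_smul_right]
      rfl
    have e2 : ∏ j, (L j).eval (t • pt Q m z) = t ^ n * ∏ j, (L j).eval (pt Q m z) := by
      simp [LinForm.eval_smul_right, Finset.prod_mul_distrib]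
    rw [e1, e2]
    let e : ℕ → ℤ := fun r => r - n
    have he : Function.Injective e := fun a b h => by simp only [e] at h; omega
    refine (he.hasSum_iff fun r hr => ?_).1 ?_
    · rw [if_neg, zero_mul]
      intro h
      exact hr ⟨(r + n).toNat, by simp only [e]; omega⟩
    · have h4 := hsum.div_const (t ^ n * ∏ j, (L j).eval (pt Q m z))
      refine (congrArg (HasSum · _) (funext fun r => ?_)).mpr h4
      have h3 : (p r fun _ => t • fun i => (ℓ i).eval (pt Q m z)) =
          t ^ r * p r fun _ i => (ℓ i).eval (pt Q m z) := by
        have := (p r).map_smul_univ (fun _ => t) (fun _ i => (ℓ i).eval (pt Q m z))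
        simpa using this
      rw [h3]
      have e3 : ((r : ℤ) - n + n).toNat = r := by omega
      have e4 : (0 : ℤ) ≤ r - n + n := by omega
      simp only [Function.comp, e, e4, if_true]
      rw [e3]
      rw [zpow_sub₀ ht0, zpow_natCast, zpow_natCast]
      field_simp

/-- Multiplication by `t ^ (-N)` gives an ordinary power series whose sum vanishes off the origin.
-/
theorem laurent_coeff_eq_zero {d : ℤ → ℂ} {N : ℤ} (hN : ∀ k < N, d k = 0)
    (h : ∀ᶠ t in 𝓝[≠] (0 : ℂ), HasSum (fun k : ℤ => d k * t ^ k) 0) : d = 0 := by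
  let e : ℕ → ℤ := fun j => j + N
  have he : Function.Injective e := fun a b h => by simp only [e] at h; omega
  let p : FormalMultilinearSeries ℂ ℂ ℂ := FormalMultilinearSeries.ofScalars ℂ fun j => d (e j)
  -- The sum of the shifted series: `0` off the origin, and the constant term `d N` at the origin,
  -- where the hypothesis says nothing. Analyticity then makes it vanish at the origin as well.
  let g : ℂ → ℂ := Function.update 0 0 (d N)
  have hp : HasFPowerSeriesAt g p 0 := by
    rw [hasFPowerSeriesAt_iff]
    rw [eventually_nhdsWithin_iff] at h
    filter_upwards [h] with t ht
    simp only [p, FormalMultilinearSeries.coeff_ofScalars, zero_add, smul_eq_mul]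
    by_cases h0 : t = 0
    · subst h0
      have : g 0 = (0 : ℂ) ^ 0 * d (e 0) := by simp [g, e]
      rw [this]
      exact hasSum_single 0 fun j hj => by simp [hj]
    · have h1 := (he.hasSum_iff fun k hk => by
        rw [hN k, zero_mul]
        by_contra hk'
        exact hk ⟨(k - N).toNat, by simp only [e]; omega⟩).2 (ht h0)
      have h2 := h1.mul_left (t ^ (-N))
      have h3 : g t = t ^ (-N) * 0 := by simp [g, h0]
      rw [h3]
      refine (congrArg (HasSum · _) (funext fun j => ?_)).mpr h2
      simp only [Function.comp, e]
      rw [zpow_add₀ h0, zpow_natCast, zpow_neg]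
      field_simp
  have hg : ∀ᶠ t in 𝓝 (0 : ℂ), g t = 0 := by
    refine hp.analyticAt.frequently_zero_iff_eventually_zero.1 (Eventually.frequently ?_)
    filter_upwards [self_mem_nhdsWithin] with t ht
    simp [g, Function.update_of_ne (show t ≠ 0 from ht)]
  have hp0 : p = 0 := (hp.congr (g := 0) hg).eq_zero
  funext k
  by_cases hk : k < N
  · exact hN k hk
  · have : p.coeff (k - N).toNat = 0 := by rw [hp0]; rfl
    simp only [p, FormalMultilinearSeries.coeff_ofScalars, e] at this
    rwa [Int.toNat_of_nonneg (by omega), sub_add_cancel] at this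

end

section

/-! ### Holomorphic germs are not sums of polar germs -/

/-- The function `φ` has homogeneous expansions at all real points, in which every component
belongs to the space `E m`. -/
def HasLaurent (Q : InnerProd) (E : (m : ℕ) → Submodule ℂ ((Fin m → ℝ) → ℂ)) (m : ℕ)
    (φ : (ℕ → ℂ) → ℂ) : Prop :=
  ∃ c : ℤ → (Fin m → ℝ) → ℂ, (∃ N, ∀ r < N, c r = 0) ∧ (∀ r, c r ∈ E m) ∧
    ∀ z, ∀ᶠ t in 𝓝[≠] (0 : ℂ), HasSum (fun r : ℤ => c r z * t ^ r) (φ (t • pt Q m z))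

/-- Sums of functions decaying along nonzero subspaces. -/
def polarFun (Q : InnerProd) (m : ℕ) : Submodule ℂ ((Fin m → ℝ) → ℂ) :=
  ⨆ W : {W : Submodule ℝ (Fin m → ℝ) // W ≠ ⊥}, tame volume (Q.formOn m) W.1

variable {Q : InnerProd} {E : (m : ℕ) → Submodule ℂ ((Fin m → ℝ) → ℂ)} {m : ℕ}

theorem HasLaurent.add {φ ψ : (ℕ → ℂ) → ℂ} (hφ : HasLaurent Q E m φ) (hψ : HasLaurent Q E m ψ) :
    HasLaurent Q E m (φ + ψ) := by
  obtain ⟨c, ⟨N, hN⟩, hc, hc'⟩ := hφ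
  obtain ⟨d, ⟨M, hM⟩, hd, hd'⟩ := hψ
  refine ⟨c + d, ⟨min N M, fun r hr => ?_⟩, fun r => (E m).add_mem (hc r) (hd r), fun z => ?_⟩
  · rw [lt_min_iff] at hr
    rw [Pi.add_apply, hN r hr.1, hM r hr.2, add_zero]
  · filter_upwards [hc' z, hd' z] with t h1 h2
    simpa [add_mul] using h1.add h2

theorem HasLaurent.const_mul {φ : (ℕ → ℂ) → ℂ} (hφ : HasLaurent Q E m φ) (a : ℂ) :
    HasLaurent Q E m (fun ζ => a * φ ζ) := by
  obtain ⟨c, ⟨N, hN⟩, hc, hc'⟩ := hφ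
  refine ⟨a • c, ⟨N, fun r hr => ?_⟩, fun r => (E m).smul_mem a (hc r), fun z => ?_⟩
  · rw [Pi.smul_apply, hN r hr, smul_zero]
  · filter_upwards [hc' z] with t h1
    simpa [mul_assoc] using h1.mul_left a

theorem coe_prod_linDenom {n : ℕ} (L : Fin n → NzForm) :
    ((fun ζ => ∏ j, (L j).1.eval ζ : (ℕ → ℂ) → ℂ) : PointGerm) =
      ((∏ j, linDenom (L j) : linDenoms) : HoloGerm).1 := by
  let c : ((ℕ → ℂ) → ℂ) →* PointGerm := Germ.coeMulHom _
  let d : linDenoms →* PointGerm := holoGerms.subtype.toMonoidHom.comp linDenoms.subtype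
  have h : ∀ j, c (L j).1.eval = d (linDenom (L j)) := fun _ => rfl
  have e : (fun ζ => ∏ j, (L j).1.eval ζ : (ℕ → ℂ) → ℂ) = ∏ j, (L j).1.eval := by
    funext ζ
    simp
  rw [e]
  change c (∏ j, (L j).1.eval) = d (∏ j, linDenom (L j))
  rw [map_prod, map_prod]
  exact Finset.prod_congr rfl fun j _ => h j

theorem hasLaurent_of_mem_meroMinus {f : Mero} (hf : f ∈ meroMinus Q) :
    ∃ φ : (ℕ → ℂ) → ℂ, val f = (φ : Germ genericNhds ℂ) ∧
      ∀ᶠ m in atTop, HasLaurent Q (polarFun Q) m φ := by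
  induction hf using Submodule.span_induction with
  | mem f hf =>
    obtain ⟨k, n, F, hF, ℓ, L, hn, ho, rfl⟩ := hf
    refine ⟨_, val_mk (H := fun ζ => F fun i => (ℓ i).eval ζ) rfl (coe_prod_linDenom L), ?_⟩
    filter_upwards [eventually_all.2 fun j => (L j).1.eventually_supportedBelow] with m hm
    obtain ⟨c, h1, h2, h3⟩ := exists_laurent_coeff hF.1 ℓ (fun j => (L j).1) hm ho
    refine ⟨c, ⟨_, h1⟩, fun r => ?_, h3⟩
    refine (le_iSup (fun W : {W : Submodule ℝ (Fin m → ℝ) // W ≠ ⊥} =>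
      tame volume (Q.formOn m) W.1) ⟨_, ?_⟩) (h2 r)
    -- The requirement `n ≥ 1` on polar germs enters here: the span contains the nonzero form `L 0`.
    intro hb
    have hz : (fun i : Fin m => (L ⟨0, hn⟩).1 i) = 0 :=
      Submodule.span_eq_bot.1 hb _ ⟨⟨0, hn⟩, rfl⟩
    refine (L ⟨0, hn⟩).2 ?_
    rw [← emb_restrict (hm ⟨0, hn⟩), hz, map_zero]
  | zero =>
    refine ⟨fun _ => 0, map_zero _, .of_forall fun m => ⟨0, ⟨0, fun _ _ => rfl⟩,
      fun _ => Submodule.zero_mem _, fun z => .of_forall fun t => ?_⟩⟩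
    simp
  | add f g _ _ hf hg =>
    obtain ⟨φ, hφ, hφ'⟩ := hf
    obtain ⟨ψ, hψ, hψ'⟩ := hg
    refine ⟨φ + ψ, by rw [map_add, hφ, hψ]; rfl, ?_⟩
    filter_upwards [hφ', hψ'] with m h1 h2
    exact h1.add h2
  | smul a f _ hf =>
    obtain ⟨φ, hφ, hφ'⟩ := hf
    refine ⟨fun ζ => (a : ℂ) * φ ζ, ?_, ?_⟩
    · rw [Algebra.smul_def, map_mul, hφ, IsScalarTower.algebraMap_apply ℝ HoloGerm Mero,
        val_algebraMap]
      rfl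
    · filter_upwards [hφ'] with m h1
      exact h1.const_mul _

/-- For `x = u + i v` with real `u` and `v`, the function `t ↦ F (u + t v)` of one variable vanishes
for small real `t`, hence on the disc of radius `2`, and in particular at `t = i`. -/
theorem eventually_eq_zero_of_real {m : ℕ} {F : (Fin m → ℂ) → ℂ} (hF : AnalyticAt ℂ F 0)
    (h : ∀ᶠ t : Fin m → ℝ in 𝓝 0, F (fun i => (t i : ℂ)) = 0) : ∀ᶠ x in 𝓝 0, F x = 0 := by
  obtain ⟨ε, hε, hball⟩ := Metric.eventually_nhds_iff_ball.1 hF.eventually_analyticAt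
  obtain ⟨δ, hδ, hreal⟩ := Metric.eventually_nhds_iff_ball.1 h
  -- The factor `3` comes from `‖u + t v‖ ≤ ‖x‖ + 2 ‖x‖` for `|t| < 2`.
  have hpos : 0 < min (ε / 3) (δ / 3) := by positivity
  filter_upwards [Metric.ball_mem_nhds (0 : Fin m → ℂ) hpos] with x hx
  rw [mem_ball_zero_iff, lt_min_iff] at hx
  let u : Fin m → ℂ := fun i => ((x i).re : ℂ)
  let v : Fin m → ℂ := fun i => ((x i).im : ℂ)
  have hu : ‖u‖ ≤ ‖x‖ := (pi_norm_le_iff_of_nonneg (norm_nonneg _)).2 fun i => by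
    rw [Complex.norm_real]
    exact (Complex.abs_re_le_norm _).trans (norm_le_pi_norm x i)
  have hv : ‖v‖ ≤ ‖x‖ := (pi_norm_le_iff_of_nonneg (norm_nonneg _)).2 fun i => by
    rw [Complex.norm_real]
    exact (Complex.abs_im_le_norm _).trans (norm_le_pi_norm x i)
  have hmem : ∀ t ∈ Metric.ball (0 : ℂ) 2, u + t • v ∈ Metric.ball (0 : Fin m → ℂ) ε := by
    intro t ht
    have ht : ‖t‖ < 2 := by simpa using ht
    have : ‖u + t • v‖ ≤ ‖x‖ + 2 * ‖x‖ := by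
      refine (norm_add_le _ _).trans (add_le_add hu ?_)
      rw [norm_smul]
      gcongr
    rw [mem_ball_zero_iff]
    linarith [hx.1]
  have han : AnalyticOnNhd ℂ (fun t : ℂ => F (u + t • v)) (Metric.ball 0 2) := fun t ht =>
    AnalyticAt.fun_comp (g := F) (f := fun t : ℂ => u + t • v) (hball _ (hmem t ht))
      (analyticAt_const.add (analyticAt_id.smul analyticAt_const))
  have hfreq : ∃ᶠ t in 𝓝[≠] (0 : ℂ), F (u + t • v) = 0 := by
    have ht : Tendsto (fun s : ℝ => (s : ℂ)) (𝓝[≠] 0) (𝓝[≠] 0) := by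
      refine tendsto_nhdsWithin_iff.2 ⟨(Complex.continuous_ofReal.tendsto' _ _ rfl).mono_left
        nhdsWithin_le_nhds, ?_⟩
      filter_upwards [self_mem_nhdsWithin] with s hs
      exact Complex.ofReal_ne_zero.2 hs
    refine ht.frequently (Eventually.frequently ?_)
    filter_upwards [nhdsWithin_le_nhds (Metric.ball_mem_nhds (0 : ℝ) one_pos)] with s hs
    have hs : |s| < 1 := by simpa using hs
    have := hreal (fun i => (x i).re + s * (x i).im) (by
      rw [mem_ball_zero_iff]
      refine (pi_norm_lt_iff hδ).2 fun i => ?_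
      have h1 := (Complex.abs_re_le_norm (x i)).trans (norm_le_pi_norm x i)
      have h2 := (Complex.abs_im_le_norm (x i)).trans (norm_le_pi_norm x i)
      have h3 : ‖s * (x i).im‖ ≤ 1 * ‖x‖ := by
        rw [norm_mul]
        exact mul_le_mul hs.le h2 (norm_nonneg _) zero_le_one
      refine (norm_add_le _ _).trans_lt ?_
      have h4 : ‖(x i).re‖ ≤ ‖x‖ := h1
      linarith [hx.2])
    rw [← this]
    congr 1
    funext i
    simp [u, v]
  have := han.eqOn_zero_of_preconnected_of_frequently_eq_zero
    (convex_ball _ _).isPreconnected (Metric.mem_ball_self two_pos) hfreq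
    (show Complex.I ∈ Metric.ball (0 : ℂ) 2 by simp)
  have e : u + Complex.I • v = x := by
    funext i
    simp only [u, v, Pi.add_apply, Pi.smul_apply, smul_eq_mul]
    rw [mul_comm]
    exact Complex.re_add_im (x i)
  simp only [e] at this
  exact this

theorem ae_eval_pt_ne_zero {v : NzForm} (hv : v.1.SupportedBelow m) :
    ∀ᵐ z : Fin m → ℝ, v.1.eval (pt Q m z) ≠ 0 := by
  let K : Submodule ℝ (Fin m → ℝ) := LinearMap.ker ((Q.form v.1).comp (emb m))
  have hK : K ≠ ⊤ := by
    intro h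
    have : (fun i : Fin m => v.1 i) ∈ K := by rw [h]; trivial
    have h1 : Q.form v.1 (emb m fun i => v.1 i) = 0 := this
    rw [emb_restrict hv] at h1
    exact (Q.pos _ v.2).ne' h1
  have h0 := Measure.addHaar_submodule volume K hK
  filter_upwards [compl_mem_ae_iff.2 h0] with z hz h
  refine hz ?_
  rw [eval_pt] at h
  exact_mod_cast h

/-- The matrix of this map is the Gram matrix of `Q` on `ℝᵐ`, which is positive definite. -/
theorem surjective_pt : Function.Surjective
    fun (z : Fin m → ℝ) (i : Fin m) => Q.form (Finsupp.single (i : ℕ) 1) (emb m z) := by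
  let G : (Fin m → ℝ) →ₗ[ℝ] (Fin m → ℝ) :=
    LinearMap.pi fun i => (Q.form (Finsupp.single (i : ℕ) 1)).comp (emb m)
  refine (LinearMap.injective_iff_surjective (f := G)).1 ((injective_iff_map_eq_zero G).2 fun z hz => ?_)
  by_contra h
  refine (Q.formOn_pos m z h).ne' ?_
  have e : emb m z = ∑ i : Fin m, z i • Finsupp.single (i : ℕ) (1 : ℝ) := by
    simp [emb, LinearMap.sum_apply]
  rw [InnerProd.formOn, LinearMap.compl₁₂_apply]
  nth_rw 1 [e]
  rw [map_sum, LinearMap.sum_apply]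
  refine Finset.sum_eq_zero fun i _ => ?_
  rw [map_smul, LinearMap.smul_apply, show Q.form (Finsupp.single (i : ℕ) 1) (emb m z) = 0 from
    congrFun hz i, smul_zero]

theorem continuous_pt : Continuous (pt Q m) := by
  refine continuous_pi fun i => Complex.continuous_ofReal.comp ?_
  exact ((Q.form (Finsupp.single i 1)).comp (emb m)).continuous_of_finiteDimensional

/-- The spaces `ℳ_+` and `ℳ_-` only have `0` in common. -/
theorem eq_zero_of_mem_meroMinus {p : HoloGerm} (hp : algebraMap HoloGerm Mero p ∈ meroMinus Q) :
    p = 0 := by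
  obtain ⟨φ, hφ, hlaurent⟩ := hasLaurent_of_mem_meroMinus hp
  have hp' := p.2.eventually_exists
  rw [val_algebraMap] at hφ
  obtain ⟨H, hH⟩ : ∃ H : (ℕ → ℂ) → ℂ, (H : PointGerm) = p.1 := Quotient.exists_rep p.1
  rw [holoVal_eq hH] at hφ
  obtain ⟨T, hT⟩ := eventually_genericNhds.1 (Germ.coe_eq.1 hφ)
  obtain ⟨m, ⟨⟨F, ⟨hF, -⟩, hpF⟩, c, ⟨N, hN⟩, hc, hsum⟩, hTm⟩ := ((hp'.and hlaurent).and
    ((Finset.eventually_all T).2 fun v _ => v.1.eventually_supportedBelow)).exists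
  have hHF : ∀ᶠ ζ in 𝓝 (0 : ℕ → ℂ), H ζ = F (trunc m ζ) := Germ.coe_eq.1 (hH.trans hpF)
  have hts : ∀ z, Tendsto (fun t : ℂ => t • pt Q m z) (𝓝[≠] 0) (𝓝 0) := fun z =>
    ((continuous_id.smul continuous_const).tendsto' _ _ (zero_smul ℂ _)).mono_left
      nhdsWithin_le_nhds
  -- The Taylor expansion of `F` itself, as the case without denominators: the coefficients are tame
  -- for `W = ⊥`, that is, polynomial in all directions.
  obtain ⟨c', hN', hc', hsum'⟩ := exists_laurent_coeff (Q := Q) (m := m) (n := 0) hF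
    (fun i : Fin m => Finsupp.single (i : ℕ) 1) (fun j => j.elim0) (fun j => j.elim0)
    (fun _ j => j.elim0)
  have htr : ∀ ζ, (fun i : Fin m => LinForm.eval (Finsupp.single (i : ℕ) 1) ζ) = trunc m ζ := by
    intro ζ
    funext i
    simp [LinForm.eval, trunc]
  simp only [Finset.univ_eq_empty, Finset.prod_empty, div_one, htr] at hsum'
  have hgen : ∀ᵐ z : Fin m → ℝ, ∀ v ∈ T, v.1.eval (pt Q m z) ≠ 0 :=
    (Finset.eventually_all T).2 fun v hv => ae_eval_pt_ne_zero (hTm v hv)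
  -- Off the hyperplanes of the forms in `T`, the two expansions along the line through `z`
  -- represent the same function of `t`.
  have heq : ∀ᵐ z : Fin m → ℝ, ∀ r, c' r z = c r z := by
    filter_upwards [hgen] with z hz r
    have := laurent_coeff_eq_zero (d := fun r => c' r z - c r z) (N := min (-((0 : ℕ) : ℤ)) N)
      (fun k hk => by
        rw [lt_min_iff] at hk
        rw [hN' k hk.1, hN k hk.2]
        simp) (by
        filter_upwards [hsum z, hsum' z, (hts z).eventually hT, (hts z).eventually hHF,
          self_mem_nhdsWithin] with t h1 h2 h3 h4 ht0
        have h5 := h3 fun v hv => by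
          rw [LinForm.eval_smul_right]
          exact mul_ne_zero ht0 (hz v hv)
        rw [← h5, h4] at h1
        have h6 := h2.sub h1
        rw [sub_self] at h6
        simpa only [sub_mul] using h6)
    exact sub_eq_zero.1 (congrFun this r)
  have hbot : Submodule.span ℝ (Set.range fun (j : Fin 0) (i : Fin m) =>
      (j.elim0 : LinForm) i) = ⊥ := by
    rw [Set.range_eq_empty, Submodule.span_empty]
  have hzero : ∀ᵐ z : Fin m → ℝ, ∀ r, c' r z = 0 := by
    refine ae_all_iff.2 fun r => ?_
    refine mem_nullFun_of_mem_iSup_tame volume (Q.formOn_symm m) (Q.formOn_pos m)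
      (hbot ▸ hc' r) (hc r) ?_
    refine (mem_nullFun _).2 (heq.mono fun z hz => ?_)
    rw [Pi.sub_apply, hz r, sub_self]
  obtain ⟨ε, hε, hball⟩ := Metric.eventually_nhds_iff_ball.1 hF.eventually_analyticAt
  -- All Taylor coefficients along the line through `z` vanish. The parameters that stay in the ball
  -- form a convex set containing `0` and `1`, so `F` vanishes at the point `t = 1`; continuity will
  -- then remove the exceptional null set.
  have hae : ∀ᵐ z : Fin m → ℝ, trunc m (pt Q m z) ∈ Metric.ball (0 : Fin m → ℂ) ε →
      F (trunc m (pt Q m z)) = 0 := by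
    filter_upwards [hzero] with z hz hzε
    have hlin : ∀ t : ℂ, trunc m (t • pt Q m z) = t • trunc m (pt Q m z) := fun t => rfl
    let S : Set ℂ := {t | t • trunc m (pt Q m z) ∈ Metric.ball (0 : Fin m → ℂ) ε}
    have hS : IsPreconnected S := by
      refine Convex.isPreconnected ?_
      exact (convex_ball (0 : Fin m → ℂ) ε).is_linear_preimage
        (f := fun t : ℂ => t • trunc m (pt Q m z))
        ⟨fun a b => add_smul a b _, fun a b => smul_assoc a b _⟩
    have han : AnalyticOnNhd ℂ (fun t : ℂ => F (t • trunc m (pt Q m z))) S := fun t ht =>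
      AnalyticAt.fun_comp (g := F) (f := fun t : ℂ => t • trunc m (pt Q m z)) (hball _ ht)
        (analyticAt_id.smul analyticAt_const)
    have hfreq : ∃ᶠ t in 𝓝[≠] (0 : ℂ), F (t • trunc m (pt Q m z)) = 0 := by
      refine Eventually.frequently ((hsum' z).mono fun t ht => ?_)
      simp only [hz, zero_mul, hlin] at ht
      exact ht.unique hasSum_zero
    have h0 : (0 : ℂ) ∈ S := by simpa [S] using hε
    have h1 : (1 : ℂ) ∈ S := by simpa [S] using hzε
    simpa using han.eqOn_zero_of_preconnected_of_frequently_eq_zero hS h0 hfreq h1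
  have hcont : Continuous fun z => trunc m (pt Q m z) := (continuous_trunc m).comp continuous_pt
  let U : Set (Fin m → ℝ) := {z | trunc m (pt Q m z) ∈ Metric.ball (0 : Fin m → ℂ) ε}
  have hU : IsOpen U := Metric.isOpen_ball.preimage hcont
  have hall : Set.EqOn (fun z => F (trunc m (pt Q m z))) (fun _ => 0) U := by
    refine Measure.eqOn_open_of_ae_eq (μ := volume) ?_ hU ?_ continuousOn_const
    · exact (ae_restrict_iff' hU.measurableSet).2 (hae.mono fun z hz hzU => hz hzU)
    · intro z hz
      exact (ContinuousAt.comp (g := F) (f := fun z => trunc m (pt Q m z))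
        (hball _ hz).continuousAt hcont.continuousAt).continuousWithinAt
  have hreal : ∀ᶠ t : Fin m → ℝ in 𝓝 0, F (fun i => (t i : ℂ)) = 0 := by
    have ht : Tendsto (fun (t : Fin m → ℝ) (i : Fin m) => (t i : ℂ)) (𝓝 0) (𝓝 0) :=
      Continuous.tendsto' (by fun_prop) _ _ (by ext; simp)
    filter_upwards [ht.eventually (Metric.ball_mem_nhds 0 hε)] with t ht
    obtain ⟨z, rfl⟩ := surjective_pt (Q := Q) t
    exact hall ht
  refine Subtype.ext (hpF.trans (Germ.coe_eq.2 ?_))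
  exact (tendsto_trunc m).eventually (eventually_eq_zero_of_real hF hreal)

end

/-! ### Division of analytic functions by a coordinate -/

section Division

variable {k : ℕ}

/-- The projection that replaces the coordinate `j` by `0`. -/
def dropCoord (j : Fin k) : (Fin k → ℂ) →L[ℂ] (Fin k → ℂ) :=
  ContinuousLinearMap.pi fun i => if i = j then 0 else ContinuousLinearMap.proj i

theorem dropCoord_apply (j : Fin k) (z : Fin k → ℂ) : dropCoord j z = Function.update z j 0 := by
  funext i
  by_cases h : i = j
  · subst h; simp [dropCoord]
  · simp [dropCoord, h]

theorem norm_dropCoord_le (j : Fin k) : ‖dropCoord j‖ ≤ 1 := by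
  refine ContinuousLinearMap.opNorm_le_bound _ zero_le_one fun z => ?_
  rw [one_mul, dropCoord_apply]
  refine (pi_norm_le_iff_of_nonneg (norm_nonneg _)).2 fun i => ?_
  by_cases h : i = j
  · subst h; simp
  · rw [Function.update_of_ne h]; exact norm_le_pi_norm z i

/-- The power series of `(G(z) - G(z with zⱼ = 0)) / zⱼ`, for `G` with power series `p`. -/
def divSeries (p : FormalMultilinearSeries ℂ (Fin k → ℂ) ℂ) (j : Fin k) :
    FormalMultilinearSeries ℂ (Fin k → ℂ) ℂ := fun n =>
  ∑ i : Fin (n + 1), ((p (n + 1)).curryMid i (Pi.single j 1)).compContinuousLinearMap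
    fun l => if i.succAbove l < i then ContinuousLinearMap.id ℂ _ else dropCoord j

/-- A telescoping sum: the arguments `z` are replaced one at a time by `z` with `z_j = 0`, and the
slot being changed contributes the difference `z_j e_j`. -/
theorem mul_divSeries_apply (p : FormalMultilinearSeries ℂ (Fin k → ℂ) ℂ) (j : Fin k) (n : ℕ)
    (z : Fin k → ℂ) : z j * divSeries p j n (fun _ => z) =
      p (n + 1) (fun _ => z) - p (n + 1) (fun _ => Function.update z j 0) := by
  classical
  have h := (p (n + 1)).toMultilinearMap.map_sub_map_piecewise (fun _ => z)
    (fun _ => Function.update z j 0) Finset.univ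
  rw [Finset.piecewise_univ] at h
  refine Eq.trans ?_ h.symm
  rw [divSeries, sum_apply, Finset.mul_sum]
  refine Finset.sum_congr rfl fun i _ => ?_
  rw [ContinuousMultilinearMap.compContinuousLinearMap_apply, ContinuousMultilinearMap.curryMid_apply]
  let m : Fin (n + 1) → Fin k → ℂ := i.insertNth (Pi.single j 1) fun l =>
    (if i.succAbove l < i then ContinuousLinearMap.id ℂ _ else dropCoord j) z
  have hm : m = Function.update m i (Pi.single j 1) := by simp [m]
  change z j * (p (n + 1)).toMultilinearMap m = _
  rw [hm, ← smul_eq_mul, ← (p (n + 1)).toMultilinearMap.map_update_smul]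
  refine congrArg _ (funext fun l => ?_)
  by_cases hl : l = i
  · subst hl
    rw [Function.update_self, if_neg (by simp), if_pos rfl]
    funext i
    by_cases h : i = j
    · subst h; simp
    · simp [h]
  · obtain ⟨l, rfl⟩ := Fin.exists_succAbove_eq hl
    rw [Function.update_of_ne hl]
    simp only [m, Fin.insertNth_apply_succAbove, Finset.mem_univ, true_imp_iff, if_neg (Ne.symm hl)]
    split_ifs with h
    · rfl
    · exact dropCoord_apply j z

theorem norm_divSeries_le (p : FormalMultilinearSeries ℂ (Fin k → ℂ) ℂ) (j : Fin k) (n : ℕ) :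
    ‖divSeries p j n‖ ≤ (n + 1) * ‖p (n + 1)‖ := by
  have h : ∀ i : Fin (n + 1), ‖((p (n + 1)).curryMid i (Pi.single j 1)).compContinuousLinearMap
      fun l => if i.succAbove l < i then ContinuousLinearMap.id ℂ _ else dropCoord j‖ ≤
        ‖p (n + 1)‖ := by
    intro i
    refine (ContinuousMultilinearMap.norm_compContinuousLinearMap_le _ _).trans ?_
    have h1 : ‖(p (n + 1)).curryMid i (Pi.single j 1)‖ ≤ ‖p (n + 1)‖ := by
      refine (((p (n + 1)).curryMid i).le_opNorm _).trans ?_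
      rw [ContinuousMultilinearMap.norm_curryMid, Pi.norm_single, norm_one, mul_one]
    refine (mul_le_of_le_one_right (norm_nonneg _) (Finset.prod_le_one (fun _ _ => norm_nonneg _)
      fun l _ => ?_)).trans h1
    split_ifs
    · exact ContinuousLinearMap.norm_id_le
    · exact norm_dropCoord_le j
  refine (norm_sum_le_of_le _ fun i _ => h i).trans ?_
  simp

theorem divSeries_radius_pos {p : FormalMultilinearSeries ℂ (Fin k → ℂ) ℂ} (hp : 0 < p.radius)
    (j : Fin k) : 0 < (divSeries p j).radius := by
  obtain ⟨r, hr0, hr⟩ := ENNReal.lt_iff_exists_nnreal_btwn.1 hp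
  obtain ⟨C, hC, hb⟩ := p.norm_mul_pow_le_of_lt_radius hr
  have hr0' : (0 : ℝ) < r := by exact_mod_cast hr0
  have : ((r / 2 : NNReal) : ENNReal) ≤ (divSeries p j).radius := by
    refine FormalMultilinearSeries.le_radius_of_bound _ (C / r) fun n => ?_
    have h1 := hb (n + 1)
    -- Halving the radius absorbs the factor `n + 1` from the number of telescoping terms.
    have h2 : ((n : ℝ) + 1) ≤ 2 ^ n := by exact_mod_cast Nat.lt_two_pow_self
    calc ‖divSeries p j n‖ * ((r / 2 : NNReal) : ℝ) ^ n
        ≤ ((n + 1) * ‖p (n + 1)‖) * ((r / 2 : NNReal) : ℝ) ^ n := by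
          gcongr; exact norm_divSeries_le p j n
      _ = ((n + 1) / 2 ^ n) * (‖p (n + 1)‖ * (r : ℝ) ^ (n + 1)) / r := by
          rw [NNReal.coe_div, NNReal.coe_ofNat, div_pow, pow_succ]
          field_simp
      _ ≤ 1 * C / r := by
          gcongr
          exact div_le_one_of_le₀ h2 (by positivity)
      _ = C / r := by rw [one_mul]
  refine lt_of_lt_of_le ?_ this
  exact_mod_cast half_pos (show 0 < r by exact_mod_cast hr0)

theorem exists_analytic_div {G : (Fin k → ℂ) → ℂ} (hG : AnalyticAt ℂ G 0) (j : Fin k) :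
    ∃ K : (Fin k → ℂ) → ℂ, AnalyticAt ℂ K 0 ∧
      ∀ᶠ z in 𝓝 0, G z - G (Function.update z j 0) = z j * K z := by
  obtain ⟨p, hp⟩ := hG
  have hq := (divSeries p j).hasFPowerSeriesOnBall (divSeries_radius_pos hp.radius_pos j)
  refine ⟨(divSeries p j).sum, hq.analyticAt, ?_⟩
  have ht : Tendsto (fun z : Fin k → ℂ => Function.update z j 0) (𝓝 0) (𝓝 0) := by
    have : (fun z : Fin k → ℂ => Function.update z j 0) = dropCoord j :=
      funext fun z => (dropCoord_apply j z).symm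
    rw [this]
    exact (dropCoord j).continuous.tendsto' _ _ (map_zero _)
  filter_upwards [hp.eventually_hasSum, ht.eventually hp.eventually_hasSum,
    hq.hasFPowerSeriesAt.eventually_hasSum] with z h1 h2 h3
  rw [zero_add] at h1 h2 h3
  have h4 := (hasSum_nat_add_iff' 1).2 (h1.sub h2)
  have h5 := h3.mul_left (z j)
  simp only [mul_divSeries_apply] at h5
  have h6 : (p 0 fun _ => z) = p 0 fun _ => Function.update z j 0 :=
    congrArg _ (funext fun i => i.elim0)
  simp only [Finset.range_one, Finset.sum_singleton, h6, sub_self, sub_zero] at h4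
  exact h4.unique h5

/-- At real points with `t_j ≠ 0` the quotient is visibly real; on the hyperplane `t_j = 0` its
imaginary part vanishes by continuity. -/
theorem exists_isRealHolo_div {G : (Fin k → ℂ) → ℂ} (hG : IsRealHolo G) (j : Fin k) :
    ∃ K : (Fin k → ℂ) → ℂ, IsRealHolo K ∧
      ∀ᶠ z in 𝓝 0, G z - G (Function.update z j 0) = z j * K z := by
  obtain ⟨K, hK, hGK⟩ := exists_analytic_div hG.1 j
  refine ⟨K, ⟨hK, ?_⟩, hGK⟩
  have hcoe : Continuous fun (t : Fin k → ℝ) (i : Fin k) => (t i : ℂ) := by fun_prop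
  have hcoe0 : Tendsto (fun (t : Fin k → ℝ) (i : Fin k) => (t i : ℂ)) (𝓝 0) (𝓝 0) :=
    hcoe.tendsto' _ _ (by ext; simp)
  have hupd : Continuous fun t : Fin k → ℝ => Function.update t j 0 :=
    continuous_id.update j continuous_const
  have h1 : ∀ᶠ t : Fin k → ℝ in 𝓝 0, (t j ≠ 0 → (K fun i => (t i : ℂ)).im = 0) ∧
      ContinuousAt K fun i => (t i : ℂ) := by
    filter_upwards [hcoe0.eventually hGK, hG.2,
      (hupd.tendsto' 0 0 (by simp)).eventually hG.2,
      hcoe0.eventually (hK.eventually_analyticAt.mono fun _ h => h.continuousAt)] with t h1 h2 h3 h4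
    refine ⟨fun hj => ?_, h4⟩
    obtain ⟨a, ha⟩ := h2
    obtain ⟨b, hb⟩ := h3
    have e : Function.update (fun i => (t i : ℂ)) j 0 =
        fun i => ((Function.update t j 0 i : ℝ) : ℂ) := by
      funext i
      by_cases h : i = j
      · subst h; simp
      · simp [h]
    rw [ha, e, hb] at h1
    have : (K fun i => (t i : ℂ)) = ((a - b) / t j : ℝ) := by
      push_cast
      rw [h1, mul_div_cancel_left₀ _ (Complex.ofReal_ne_zero.2 hj)]
    rw [this, Complex.ofReal_im]
  filter_upwards [h1.eventually_nhds] with t ht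
  refine ⟨(K fun i => (t i : ℂ)).re, Complex.ext rfl ?_⟩
  rw [Complex.ofReal_im]
  obtain ⟨h2, h3⟩ := ht.self_of_nhds
  by_cases hj : t j = 0
  · have hs : Tendsto (fun s : ℝ => Function.update t j s) (𝓝[≠] 0) (𝓝 t) := by
      refine ((continuous_const.update j continuous_id).tendsto' 0 t ?_).mono_left
        nhdsWithin_le_nhds
      rw [← hj]
      exact Function.update_eq_self j t
    have h4 : Tendsto (fun s : ℝ => (K fun i => (Function.update t j s i : ℂ)).im) (𝓝[≠] 0)
        (𝓝 (K fun i => (t i : ℂ)).im) :=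
      (Complex.continuous_im.tendsto _).comp ((h3.tendsto.comp (hcoe.tendsto t)).comp hs)
    refine tendsto_nhds_unique (h4.congr' ?_) tendsto_const_nhds
    filter_upwards [hs.eventually ht, self_mem_nhdsWithin] with s hs1 hs2
    exact hs1.1 (by simpa using hs2)
  · exact h2 hj

theorem IsRealHolo.comp_real {k m : ℕ} {F : (Fin k → ℂ) → ℂ} (hF : IsRealHolo F)
    (A : (Fin m → ℂ) →L[ℂ] (Fin k → ℂ)) (A' : (Fin m → ℝ) → (Fin k → ℝ))
    (hA : ∀ t : Fin m → ℝ, A (fun i => (t i : ℂ)) = fun i => (A' t i : ℂ)) :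
    IsRealHolo fun z => F (A z) := by
  refine ⟨AnalyticAt.fun_comp (g := F) (by rw [map_zero]; exact hF.1) (A.analyticAt 0), ?_⟩
  -- `A'` is determined by `A`, which gives its continuity and its value at `0`.
  have hA' : A' = fun t i => (A (fun i => (t i : ℂ)) i).re := by
    funext t i
    rw [hA, Complex.ofReal_re]
  have ht : Tendsto A' (𝓝 0) (𝓝 0) := by
    have hc : Continuous A' := by rw [hA']; fun_prop
    refine hc.tendsto' _ _ ?_
    rw [hA']
    funext i
    have : (fun i => ((0 : Fin m → ℝ) i : ℂ)) = 0 := by ext; simp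
    change (A (fun i => ((0 : Fin m → ℝ) i : ℂ)) i).re = 0
    rw [this, map_zero, Pi.zero_apply, Complex.zero_re]
  filter_upwards [ht.eventually hF.2] with t ⟨r, hr⟩
  exact ⟨r, by rw [hA, hr]⟩

/-- Hadamard's lemma for the variables in a finite set. -/
theorem exists_hadamard {G : (Fin k → ℂ) → ℂ} (hG : IsRealHolo G) (S : Finset (Fin k)) :
    ∃ K : Fin k → (Fin k → ℂ) → ℂ, (∀ j, IsRealHolo (K j)) ∧
      ∀ᶠ z in 𝓝 0, G z = G (fun i => if i ∈ S then 0 else z i) + ∑ j ∈ S, z j * K j z := by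
  classical
  induction S using Finset.induction_on with
  | empty => exact ⟨fun _ _ => 0, fun _ => ⟨analyticAt_const, .of_forall fun _ => ⟨0, by simp⟩⟩,
      by simp⟩
  | insert j S hj ih =>
    obtain ⟨K, hK, hGK⟩ := ih
    let A : (Fin k → ℂ) →L[ℂ] (Fin k → ℂ) :=
      ContinuousLinearMap.pi fun i => if i ∈ S then 0 else ContinuousLinearMap.proj i
    have hA : ∀ z, A z = fun i => if i ∈ S then 0 else z i := by
      intro z
      funext i
      by_cases h : i ∈ S <;> simp [A, h]
    have hGA : IsRealHolo fun z => G (A z) :=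
      hG.comp_real A (fun t i => if i ∈ S then 0 else t i) fun t => by
        rw [hA]
        funext i
        by_cases h : i ∈ S <;> simp [h]
    -- The division is applied to the remainder, in which the variables of `S` are already zero;
    -- setting `z_j = 0` there gives the new remainder.
    obtain ⟨K', hK', hGK'⟩ := exists_isRealHolo_div hGA j
    refine ⟨Function.update K j K', fun i => ?_, ?_⟩
    · by_cases h : i = j
      · subst h; simpa using hK'
      · rw [Function.update_of_ne h]; exact hK i
    · filter_upwards [hGK, hGK'] with z h1 h2
      rw [Finset.sum_insert hj, Function.update_self, Finset.sum_congr rfl fun i hi => by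
        rw [Function.update_of_ne (ne_of_mem_of_not_mem hi hj)], ← add_assoc, ← h2, h1, hA, hA]
      have e : (fun i => if i ∈ insert j S then 0 else z i) =
          fun i => if i ∈ S then 0 else Function.update z j 0 i := by
        funext i
        by_cases h : i = j
        · subst h; simp
        · simp [h]
      rw [e]
      ring

end Division

section

/-! ### Germs in the linear forms of a given subspace -/

/-- Unlike `IsHoloGerm.map₂`, this keeps track of the linear forms used, as needed for germs in the
forms of a subspace. -/
theorem map₂_compGerm (op : ℂ → ℂ → ℂ) (opR : ℝ → ℝ → ℝ)
    (hop : ∀ a b : ℝ, op a b = (opR a b : ℝ))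
    (han : ∀ (n : ℕ) (F G : (Fin n → ℂ) → ℂ), AnalyticAt ℂ F 0 → AnalyticAt ℂ G 0 →
      AnalyticAt ℂ (fun z => op (F z) (G z)) 0)
    {k m : ℕ} {F : (Fin k → ℂ) → ℂ} {G : (Fin m → ℂ) → ℂ} (hF : IsRealHolo F) (hG : IsRealHolo G)
    (ℓ : Fin k → LinForm) (ℓ' : Fin m → LinForm) :
    ∃ H : (Fin (k + m) → ℂ) → ℂ, IsRealHolo H ∧
      Germ.map₂ op (compGerm F ℓ) (compGerm G ℓ') = compGerm H (Fin.append ℓ ℓ') := by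
  let A : (Fin (k + m) → ℂ) →L[ℂ] (Fin k → ℂ) :=
    ContinuousLinearMap.pi fun i => ContinuousLinearMap.proj (Fin.castAdd m i)
  let A' : (Fin (k + m) → ℂ) →L[ℂ] (Fin m → ℂ) :=
    ContinuousLinearMap.pi fun i => ContinuousLinearMap.proj (Fin.natAdd k i)
  have h1 := hF.comp_real A (fun t i => t (Fin.castAdd m i)) fun _ => rfl
  have h2 := hG.comp_real A' (fun t i => t (Fin.natAdd k i)) fun _ => rfl
  refine ⟨fun z => op (F (A z)) (G (A' z)), ⟨han _ _ _ h1.1 h2.1, ?_⟩, ?_⟩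
  · filter_upwards [h1.2, h2.2] with t ⟨a, ha⟩ ⟨b, hb⟩
    exact ⟨opR a b, by rw [ha, hb, hop]⟩
  · refine Germ.coe_eq.2 (.of_forall fun ζ => ?_)
    change op (F fun i => (ℓ i).eval ζ) (G fun i => (ℓ' i).eval ζ) =
      op (F fun i => (Fin.append ℓ ℓ' (Fin.castAdd m i)).eval ζ)
        (G fun i => (Fin.append ℓ ℓ' (Fin.natAdd k i)).eval ζ)
    simp only [Fin.append_left, Fin.append_right]

/-- The holomorphic germs in linear forms from `V`. -/
def holoIn (V : Submodule ℝ LinForm) : Subring HoloGerm where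
  carrier := {p | ∃ (k : ℕ) (F : (Fin k → ℂ) → ℂ) (ℓ : Fin k → LinForm), IsRealHolo F ∧
    (∀ i, ℓ i ∈ V) ∧ p.1 = compGerm F ℓ}
  zero_mem' := ⟨0, fun _ => 0, Fin.elim0, ⟨analyticAt_const, .of_forall fun _ => ⟨0, by simp⟩⟩,
    fun i => i.elim0, rfl⟩
  one_mem' := ⟨0, fun _ => 1, Fin.elim0, ⟨analyticAt_const, .of_forall fun _ => ⟨1, by simp⟩⟩,
    fun i => i.elim0, rfl⟩
  add_mem' := by
    rintro p q ⟨k, F, ℓ, hF, hℓ, hp⟩ ⟨m, G, ℓ', hG, hℓ', hq⟩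
    obtain ⟨H, hH, e⟩ := map₂_compGerm (· + ·) (· + ·) (fun a b => by push_cast; rfl)
      (fun _ _ _ hF hG => hF.add hG) hF hG ℓ ℓ'
    have h : ∀ i, Fin.append ℓ ℓ' i ∈ V := Fin.addCases (by simpa using hℓ) (by simpa using hℓ')
    refine ⟨_, H, _, hH, h, ?_⟩
    rw [← e, ← hp, ← hq]
    rfl
  mul_mem' := by
    rintro p q ⟨k, F, ℓ, hF, hℓ, hp⟩ ⟨m, G, ℓ', hG, hℓ', hq⟩
    obtain ⟨H, hH, e⟩ := map₂_compGerm (· * ·) (· * ·) (fun a b => by push_cast; rfl)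
      (fun _ _ _ hF hG => hF.mul hG) hF hG ℓ ℓ'
    have h : ∀ i, Fin.append ℓ ℓ' i ∈ V := Fin.addCases (by simpa using hℓ) (by simpa using hℓ')
    refine ⟨_, H, _, hH, h, ?_⟩
    rw [← e, ← hp, ← hq]
    rfl
  neg_mem' := by
    rintro p ⟨k, F, ℓ, hF, hℓ, hp⟩
    refine ⟨k, fun z => -F z, ℓ, ⟨hF.1.neg, hF.2.mono fun t ⟨r, hr⟩ => ⟨-r, by simp [hr]⟩⟩, hℓ, ?_⟩
    change -p.1 = _
    rw [hp]
    rfl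

theorem holoIn_mono {V W : Submodule ℝ LinForm} (h : V ≤ W) : holoIn V ≤ holoIn W := by
  rintro p ⟨k, F, ℓ, hF, hℓ, hp⟩
  exact ⟨k, F, ℓ, hF, fun i => h (hℓ i), hp⟩

theorem mem_holoIn_top (p : HoloGerm) : p ∈ holoIn ⊤ := by
  obtain ⟨k, F, ℓ, hF, hp⟩ := p.2
  exact ⟨k, F, ℓ, hF, fun _ => trivial, hp⟩

theorem linGerm_mem_holoIn {V : Submodule ℝ LinForm} {v : LinForm} (hv : v ∈ V) :
    linGerm v ∈ holoIn V :=
  ⟨1, fun z => z 0, fun _ => v,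
    ⟨(ContinuousLinearMap.proj (R := ℂ) (φ := fun _ : Fin 1 => ℂ) 0).analyticAt 0,
      .of_forall fun t => ⟨t 0, rfl⟩⟩, fun _ => hv, rfl⟩

/-- Products of nonzero linear forms from `V`. -/
def denomsIn (V : Submodule ℝ LinForm) : Submonoid linDenoms :=
  Submonoid.closure {s | ∃ v : NzForm, v.1 ∈ V ∧ s = linDenom v}

theorem mem_denomsIn_top (s : linDenoms) : s ∈ denomsIn ⊤ := by
  have h : ({s | ∃ v : NzForm, v.1 ∈ (⊤ : Submodule ℝ LinForm) ∧ s = linDenom v} :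
      Set linDenoms) = ((↑) : linDenoms → HoloGerm) ⁻¹' {h | ∃ v : NzForm, h = linGerm v.1} := by
    ext s
    simp only [Submodule.mem_top, true_and, Set.mem_ofPred_eq, Set.mem_preimage]
    exact exists_congr fun v => Subtype.ext_iff
  rw [denomsIn, h]
  have := Submonoid.closure_closure_coe_preimage
    (s := {h : HoloGerm | ∃ v : NzForm, h = linGerm v.1})
  exact this ▸ Submonoid.mem_top s

theorem exists_prod_of_mem_denomsIn {V : Submodule ℝ LinForm} {s : linDenoms}
    (hs : s ∈ denomsIn V) :
    ∃ (n : ℕ) (L : Fin n → NzForm), (∀ j, (L j).1 ∈ V) ∧ s = ∏ j, linDenom (L j) := by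
  induction hs using Submonoid.closure_induction with
  | mem s hs =>
    obtain ⟨v, hv, rfl⟩ := hs
    exact ⟨1, fun _ => v, fun _ => hv, by simp⟩
  | one => exact ⟨0, Fin.elim0, fun j => j.elim0, by simp⟩
  | mul s t _ _ hs ht =>
    obtain ⟨n, L, hL, rfl⟩ := hs
    obtain ⟨m, M, hM, rfl⟩ := ht
    refine ⟨n + m, Fin.append L M, Fin.addCases (by simpa using hL) (by simpa using hM), ?_⟩
    simp [Fin.prod_univ_add]

/-- The meromorphic germs in linear forms from `V`. -/
def meroIn (V : Submodule ℝ LinForm) : Subring Mero where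
  carrier := {f | ∃ h ∈ holoIn V, ∃ s ∈ denomsIn V, f = Localization.mk h s}
  zero_mem' := ⟨0, (holoIn V).zero_mem, 1, (denomsIn V).one_mem, (Localization.mk_zero 1).symm⟩
  one_mem' := ⟨1, (holoIn V).one_mem, 1, (denomsIn V).one_mem, Localization.mk_one.symm⟩
  add_mem' := by
    rintro _ _ ⟨h, hh, s, hs, rfl⟩ ⟨h', hh', s', hs', rfl⟩
    have hd : ∀ s ∈ denomsIn V, (s : HoloGerm) ∈ holoIn V := by
      intro s hs
      induction hs using Submonoid.closure_induction with
      | mem s hs =>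
        obtain ⟨v, hv, rfl⟩ := hs
        exact linGerm_mem_holoIn hv
      | one => exact (holoIn V).one_mem
      | mul s t _ _ hs ht => exact (holoIn V).mul_mem hs ht
    exact ⟨_, (holoIn V).add_mem ((holoIn V).mul_mem (hd s hs) hh')
      ((holoIn V).mul_mem (hd s' hs') hh), _, (denomsIn V).mul_mem hs hs',
      Localization.add_mk _ _ _ _⟩
  mul_mem' := by
    rintro _ _ ⟨h, hh, s, hs, rfl⟩ ⟨h', hh', s', hs', rfl⟩
    exact ⟨_, (holoIn V).mul_mem hh hh', _, (denomsIn V).mul_mem hs hs',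
      Localization.mk_mul _ _ _ _⟩
  neg_mem' := by
    rintro _ ⟨h, hh, s, hs, rfl⟩
    exact ⟨_, (holoIn V).neg_mem hh, s, hs, Localization.neg_mk _ _⟩

theorem mem_meroIn_top (f : Mero) : f ∈ meroIn ⊤ := by
  induction f using Localization.induction_on with
  | H x => exact ⟨x.1, mem_holoIn_top _, x.2, mem_denomsIn_top _, rfl⟩

variable (Q : InnerProd)

/-- The linear forms orthogonal to all `L j`. -/
def orthTo {n : ℕ} (L : Fin n → NzForm) : Submodule ℝ LinForm :=
  ⨅ j, LinearMap.ker (Q.form (L j).1)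

theorem mem_orthTo {n : ℕ} {L : Fin n → NzForm} {v : LinForm} :
    v ∈ orthTo Q L ↔ ∀ j, Q.form (L j).1 v = 0 := by
  simp [orthTo, Submodule.mem_iInf]

/-- The polar germs in linear forms from `V`. -/
def polarIn (V : Submodule ℝ LinForm) : Set Mero :=
  {f | ∃ (n : ℕ) (L : Fin n → NzForm), 0 < n ∧ (∀ j, (L j).1 ∈ V) ∧
    ∃ h ∈ holoIn (V ⊓ orthTo Q L), f = Localization.mk h (∏ j, linDenom (L j))}

/-- The span of the polar germs in linear forms from `V`. -/
def minusIn (V : Submodule ℝ LinForm) : Submodule ℝ Mero := Submodule.span ℝ (polarIn Q V)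

variable {Q}

theorem isPolarGerm_of_mem_holoIn {n : ℕ} (L : Fin n → NzForm) (hn : 0 < n) {h : HoloGerm}
    (hh : h ∈ holoIn (orthTo Q L)) :
    IsPolarGerm Q (Localization.mk h (∏ j, linDenom (L j))) := by
  obtain ⟨k, F, ℓ, hF, hℓ, hp⟩ := hh
  refine ⟨k, n, F, hF, ℓ, L, hn, fun i j => ?_, ?_⟩
  · rw [Q.symm]
    exact (mem_orthTo Q).1 (hℓ i) j
  · congr 1
    exact Subtype.ext hp

theorem minusIn_le (V : Submodule ℝ LinForm) : minusIn Q V ≤ meroMinus Q := by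
  refine Submodule.span_mono ?_
  rintro _ ⟨n, L, hn, -, h, hh, rfl⟩
  exact isPolarGerm_of_mem_holoIn L hn (holoIn_mono inf_le_right hh)

/-! ### Splitting off polar germs -/

theorem mk_linGerm_mul {n : ℕ} (L : Fin (n + 1) → NzForm) (j : Fin (n + 1)) (h : HoloGerm) :
    Localization.mk (linGerm (L j).1 * h) (∏ i, linDenom (L i)) =
      Localization.mk h (∏ i, linDenom (L (j.succAbove i))) := by
  rw [Fin.prod_univ_succAbove _ j, ← Localization.mk_mul]
  have : Localization.mk (linGerm (L j).1) (linDenom (L j)) = 1 := Localization.mk_self (linDenom (L j))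
  rw [this, one_mul]

/-- Each variable is `ℓ_i = ∑ c_ij L_j + q_i` with `q_i` orthogonal to all `L_j`. Hadamard's lemma
in the variables `L_j` leaves the remainder `F(q)`. All forms stay in `V` because the `L_j` belong
to `V`. -/
theorem exists_holo_decomposition {V : Submodule ℝ LinForm} {n : ℕ} (L : Fin n → NzForm)
    (hL : ∀ j, (L j).1 ∈ V) {h : HoloGerm} (hh : h ∈ holoIn V) :
    ∃ h₀ ∈ holoIn (V ⊓ orthTo Q L), ∃ h' : Fin n → HoloGerm, (∀ j, h' j ∈ holoIn V) ∧
      h = h₀ + ∑ j, linGerm (L j).1 * h' j := by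
  obtain ⟨k, F, ℓ, hF, hℓ, hp⟩ := hh
  let W : Submodule ℝ LinForm := Submodule.span ℝ (Set.range fun j => (L j).1)
  have : FiniteDimensional ℝ W := FiniteDimensional.span_of_finite ℝ (Set.finite_range _)
  have hWV : W ≤ V := Submodule.span_le.2 (by rintro _ ⟨j, rfl⟩; exact hL j)
  choose w hw q hq hwq using fun i => exists_orthogonal_decomposition Q.form Q.symm Q.pos W (ℓ i)
  choose c hc using fun i => (Submodule.mem_span_range_iff_exists_fun ℝ).1 (hw i)
  have hqV : ∀ i, q i ∈ V := by
    intro i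
    have : q i = ℓ i - w i := by rw [hwq i]; abel
    rw [this]
    exact V.sub_mem (hℓ i) (hWV (hw i))
  have hqL : ∀ i, q i ∈ V ⊓ orthTo Q L := fun i =>
    ⟨hqV i, (mem_orthTo Q).2 fun j => hq i _ (Submodule.subset_span ⟨j, rfl⟩)⟩
  -- The first `n` variables stand for the `L_j`, the last `k` for the `q_i`. The `L_j` may be
  -- linearly dependent: the identity is proved in independent variables and only then evaluated.
  let A : (Fin (n + k) → ℂ) →L[ℂ] (Fin k → ℂ) := ContinuousLinearMap.pi fun i =>
    ∑ j, (c i j : ℂ) • ContinuousLinearMap.proj (Fin.castAdd k j) +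
      ContinuousLinearMap.proj (Fin.natAdd n i)
  have hA : ∀ z i, A z i = ∑ j, (c i j : ℂ) * z (Fin.castAdd k j) + z (Fin.natAdd n i) := by
    intro z i
    simp [A]
  have hG : IsRealHolo fun z => F (A z) := by
    refine hF.comp_real A (fun t i => ∑ j, c i j * t (Fin.castAdd k j) + t (Fin.natAdd n i))
      fun t => ?_
    funext i
    rw [hA]
    push_cast
    rfl
  obtain ⟨K, hK, hGK⟩ := exists_hadamard hG (Finset.univ.map (Fin.castAddEmb k))
  let M : Fin (n + k) → LinForm := Fin.append (fun j => (L j).1) q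
  have hM : ∀ i, M i ∈ V := Fin.addCases (by simpa [M] using hL) (by simpa [M] using hqV)
  refine ⟨⟨compGerm F q, ⟨k, F, q, hF, rfl⟩⟩, ⟨k, F, q, hF, hqL, rfl⟩,
    fun j => ⟨compGerm (K (Fin.castAdd k j)) M, ⟨_, _, M, hK _, rfl⟩⟩,
    fun j => ⟨_, _, M, hK _, hM, rfl⟩, Subtype.ext ?_⟩
  have hsum : ((∑ j, linGerm (L j).1 * (⟨compGerm (K (Fin.castAdd k j)) M, ⟨_, _, M, hK _, rfl⟩⟩ :
      HoloGerm) : HoloGerm) : PointGerm) = ((fun ζ => ∑ j, (L j).1.eval ζ *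
        K (Fin.castAdd k j) fun i => (M i).eval ζ : (ℕ → ℂ) → ℂ) : PointGerm) := by
    have e : (fun ζ => ∑ j, (L j).1.eval ζ * K (Fin.castAdd k j) fun i => (M i).eval ζ :
        (ℕ → ℂ) → ℂ) = ∑ j, fun ζ => (L j).1.eval ζ * K (Fin.castAdd k j) fun i => (M i).eval ζ := by
      funext ζ
      simp
    rw [e]
    change holoGerms.subtype _ = Germ.coeAddHom _ _
    rw [map_sum, map_sum]
    rfl
  have e1 : h.1 = compGerm (fun z => F (A z)) M := by
    rw [hp]
    refine Germ.coe_eq.2 (.of_forall fun ζ => congrArg F (funext fun i => ?_))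
    rw [hA]
    simp only [M, Fin.append_left, Fin.append_right]
    rw [hwq i, LinForm.eval_add, ← hc i, LinForm.eval_sum]
    simp only [LinForm.eval_smul]
  have ht : Tendsto (fun (ζ : ℕ → ℂ) i => (M i).eval ζ) (𝓝 0) (𝓝 0) :=
    (continuous_pi fun i => (M i).continuous_eval).tendsto' _ _
      (funext fun i => (M i).eval_zero_right)
  change h.1 = compGerm F q + _
  rw [hsum, e1]
  refine Germ.coe_eq.2 ((ht.eventually hGK).mono fun ζ hζ => hζ.trans ?_)
  rw [Finset.sum_map]
  refine congrArg₂ (· + ·) (congrArg F (funext fun i => ?_)) (Finset.sum_congr rfl fun j _ => ?_)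
  · rw [hA]
    have hne : ∀ j : Fin n, Fin.castAdd k j ≠ Fin.natAdd n i := fun j h => by
      simp [Fin.ext_iff] at h
      omega
    simp [M, hne]
  · simp [M]

/-- Every meromorphic germ is the sum of a holomorphic germ and of polar germs, in the same linear
forms. -/
theorem exists_decomposition {V : Submodule ℝ LinForm} {f : Mero} (hf : f ∈ meroIn V) :
    ∃ p ∈ holoIn V, ∃ g ∈ minusIn Q V, f = algebraMap HoloGerm Mero p + g := by
  obtain ⟨h, hh, s, hs, rfl⟩ := hf
  obtain ⟨n, L, hL, rfl⟩ := exists_prod_of_mem_denomsIn hs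
  clear hs
  induction n generalizing h with
  | zero =>
    refine ⟨h, hh, 0, Submodule.zero_mem _, ?_⟩
    rw [add_zero, Finset.univ_eq_empty, Finset.prod_empty, Localization.mk_one_eq_algebraMap]
  | succ n ih =>
    obtain ⟨h₀, hh₀, h', hh', rfl⟩ := exists_holo_decomposition (Q := Q) L hL hh
    -- The factor `L_j` in the numerator cancels one denominator, leaving `n` of them.
    choose p hp g hg hpg using fun j => ih (h' j) (hh' j)
      (fun i => L (j.succAbove i)) fun i => hL _
    refine ⟨∑ j, p j, Subring.sum_mem _ fun j _ => hp j,
      Localization.mk h₀ (∏ j, linDenom (L j)) + ∑ j, g j, Submodule.add_mem _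
      (Submodule.subset_span ⟨n + 1, L, n.succ_pos, hL, h₀, hh₀, rfl⟩)
      (Submodule.sum_mem _ fun j _ => hg j), ?_⟩
    have hadd : ∀ a b : HoloGerm, Localization.mk (a + b) (∏ j, linDenom (L j)) =
        Localization.mk a (∏ j, linDenom (L j)) + Localization.mk b (∏ j, linDenom (L j)) :=
      fun a b => (Localization.add_mk_self _ _ _).symm
    have hsum : Localization.mk (∑ j, linGerm (L j).1 * h' j) (∏ j, linDenom (L j)) =
        ∑ j, Localization.mk (linGerm (L j).1 * h' j) (∏ j, linDenom (L j)) :=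
      map_sum (⟨⟨fun a => Localization.mk a (∏ j, linDenom (L j)), Localization.mk_zero _⟩, hadd⟩ :
        HoloGerm →+ Mero) _ _
    rw [hadd, hsum, Finset.sum_congr rfl fun j _ => (mk_linGerm_mul L j (h' j)).trans (hpg j),
      Finset.sum_add_distrib, map_sum]
    abel

end

/-! ### The integral `∫ y^{-s} / (y + x) dy` -/

theorem cpow_eq_exp_log {a : ℝ} (ha : 0 < a) (w : ℂ) :
    (a : ℂ) ^ w = Complex.exp ((Real.log a : ℂ) * w) := by
  rw [Complex.cpow_def_of_ne_zero (Complex.ofReal_ne_zero.2 ha.ne'), Complex.ofReal_log ha.le]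

/-- For `y = x u / (1 - u)` one has `y + x = x / (1 - u)` and `dy = x / (1 - u) ^ 2 du`, which
yields the integrand of `B(1 - s, s)`. -/
theorem beta_substitution {s : ℂ} {x u : ℝ} (hx : 0 < x) (hu : u ∈ Set.Ioo (0 : ℝ) 1) :
    |x / (1 - u) ^ 2| • (((x * u / (1 - u) : ℝ) : ℂ) ^ (-s) / (((x * u / (1 - u) : ℝ) : ℂ) + x)) =
      (x : ℂ) ^ (-s) * ((u : ℂ) ^ ((1 - s) - 1) * (1 - (u : ℂ)) ^ (s - 1)) := by
  obtain ⟨h0, h1⟩ := hu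
  have h1' : 0 < 1 - u := sub_pos.2 h1
  have hc : (1 - (u : ℂ)) = ((1 - u : ℝ) : ℂ) := by push_cast; rfl
  have hne : ((1 - u : ℝ) : ℂ) ≠ 0 := Complex.ofReal_ne_zero.2 h1'.ne'
  have hxne : (x : ℂ) ≠ 0 := Complex.ofReal_ne_zero.2 hx.ne'
  have e1 : ((x * u / (1 - u) : ℝ) : ℂ) + x = (x : ℂ) / ((1 - u : ℝ) : ℂ) := by
    rw [← Complex.ofReal_add, ← Complex.ofReal_div]
    congr 1
    field_simp
    ring
  have e2 : ((x * u / (1 - u) : ℝ) : ℂ) ^ (-s) =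
      (x : ℂ) ^ (-s) * ((u : ℂ) ^ (-s) * ((1 - u : ℝ) : ℂ) ^ s) := by
    rw [cpow_eq_exp_log (by positivity), cpow_eq_exp_log hx, cpow_eq_exp_log h0,
      cpow_eq_exp_log h1', ← Complex.exp_add, ← Complex.exp_add, Real.log_div (by positivity)
      h1'.ne', Real.log_mul hx.ne' h0.ne']
    congr 1
    push_cast
    ring
  rw [e1, e2, hc, Complex.cpow_sub _ _ hne, Complex.cpow_one, abs_of_pos (by positivity),
    Complex.real_smul, show (1 - s) - 1 = -s by ring]
  push_cast [← hc]
  rw [hc]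
  field_simp

theorem integral_cpow_div_add {s : ℂ} (h0 : 0 < s.re) (h1 : s.re < 1) {x : ℝ} (hx : 0 < x) :
    IntegrableOn (fun y : ℝ => (y : ℂ) ^ (-s) / ((y : ℂ) + x)) (Set.Ioi 0) ∧
      ∫ y in Set.Ioi (0 : ℝ), (y : ℂ) ^ (-s) / ((y : ℂ) + x) =
        Complex.Gamma s * Complex.Gamma (1 - s) * (x : ℂ) ^ (-s) := by
  let f : ℝ → ℝ := fun u => x * u / (1 - u)
  have hs : MeasurableSet (Set.Ioo (0 : ℝ) 1) := measurableSet_Ioo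
  have hf' : ∀ u ∈ Set.Ioo (0 : ℝ) 1,
      HasDerivWithinAt f (x / (1 - u) ^ 2) (Set.Ioo (0 : ℝ) 1) u := by
    intro u hu
    have h1' : 1 - u ≠ 0 := (sub_pos.2 hu.2).ne'
    have h := ((hasDerivAt_id u).const_mul x).div ((hasDerivAt_id u).const_sub 1) h1'
    refine HasDerivAt.hasDerivWithinAt (h.congr_deriv ?_)
    simp only [id]
    congr 1
    ring
  have hinj : Set.InjOn f (Set.Ioo (0 : ℝ) 1) := by
    intro u hu v hv h
    have hu' : 1 - u ≠ 0 := (sub_pos.2 hu.2).ne'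
    have hv' : 1 - v ≠ 0 := (sub_pos.2 hv.2).ne'
    simp only [f] at h
    rw [div_eq_div_iff hu' hv'] at h
    have : x * (u - v) = 0 := by linear_combination h
    rcases mul_eq_zero.1 this with h | h
    · exact absurd h hx.ne'
    · exact sub_eq_zero.1 h
  have himg : f '' Set.Ioo (0 : ℝ) 1 = Set.Ioi 0 := by
    ext y
    constructor
    · rintro ⟨u, hu, rfl⟩
      exact div_pos (mul_pos hx hu.1) (sub_pos.2 hu.2)
    · intro hy
      have hy : 0 < y := hy
      refine ⟨y / (y + x), ⟨by positivity, (div_lt_one (by positivity)).2 (by linarith)⟩, ?_⟩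
      simp only [f]
      field_simp
      simp [hx.ne']
  have h1s : 0 < (1 - s).re := by simpa using h1
  have hbeta := Complex.betaIntegral_convergent h1s h0
  rw [intervalIntegrable_iff_integrableOn_Ioo_of_le zero_le_one] at hbeta
  have hval : ∫ u in Set.Ioo (0 : ℝ) 1, (u : ℂ) ^ ((1 - s) - 1) * (1 - (u : ℂ)) ^ (s - 1) =
      Complex.Gamma s * Complex.Gamma (1 - s) := by
    have := Complex.Gamma_mul_Gamma_eq_betaIntegral h1s h0
    rw [sub_add_cancel, Complex.Gamma_one, one_mul, Complex.betaIntegral,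
      intervalIntegral.integral_of_le zero_le_one, integral_Ioc_eq_integral_Ioo] at this
    rw [← this, mul_comm]
  constructor
  · rw [← himg, integrableOn_image_iff_integrableOn_abs_deriv_smul hs hf' hinj]
    have hb : IntegrableOn (fun u : ℝ => (x : ℂ) ^ (-s) *
        ((u : ℂ) ^ ((1 - s) - 1) * (1 - (u : ℂ)) ^ (s - 1))) (Set.Ioo 0 1) := hbeta.const_mul _
    refine hb.congr_fun (fun u hu => ?_) hs
    exact (beta_substitution hx hu).symm
  · rw [← himg, integral_image_eq_integral_abs_deriv_smul hs hf' hinj,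
      setIntegral_congr_fun hs fun u hu => beta_substitution hx hu, integral_const_mul, hval,
      mul_comm]

/-! ### Existence of the elements `ℐ^L(x^ℓ)` -/

/-- The function `z ↦ Γ(1 + z) Γ(1 - z)`. -/
def gammaProd (z : ℂ) : ℂ := Complex.Gamma (1 + z) * Complex.Gamma (1 - z)

theorem analyticAt_gammaProd : AnalyticAt ℂ gammaProd 0 := by
  have h : DifferentiableOn ℂ gammaProd (Metric.ball 0 1) := by
    intro z hz
    have hz : ‖z‖ < 1 := by simpa using hz
    have hre := (Complex.abs_re_le_norm z).trans_lt hz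
    rw [abs_lt] at hre
    have hG : ∀ w : ℂ, 0 < w.re → DifferentiableAt ℂ Complex.Gamma w := by
      intro w hw
      refine Complex.differentiableAt_Gamma w fun m h => ?_
      rw [h] at hw
      simp at hw
      have := m.cast_nonneg (α := ℝ)
      linarith
    have h1 : DifferentiableAt ℂ (fun z => Complex.Gamma (1 + z)) z :=
      DifferentiableAt.comp (g := Complex.Gamma) z (hG (1 + z) (by simp; linarith))
        ((differentiableAt_const 1).add differentiableAt_id)
    have h2 : DifferentiableAt ℂ (fun z => Complex.Gamma (1 - z)) z :=
      DifferentiableAt.comp (g := Complex.Gamma) z (hG (1 - z) (by simp; linarith))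
        ((differentiableAt_const 1).sub differentiableAt_id)
    exact (h1.mul h2).differentiableWithinAt
  exact h.analyticAt (Metric.ball_mem_nhds 0 one_pos)

theorem gammaProd_zero : gammaProd 0 = 1 := by simp [gammaProd]

theorem isRealHolo_gammaProd : IsRealHolo fun z : Fin 1 → ℂ => gammaProd (z 0) := by
  refine ⟨AnalyticAt.fun_comp (g := gammaProd) (f := fun z : Fin 1 → ℂ => z 0)
    analyticAt_gammaProd
    ((ContinuousLinearMap.proj (R := ℂ) (φ := fun _ : Fin 1 => ℂ) 0).analyticAt 0),
    .of_forall fun t => ⟨Real.Gamma (1 + t 0) * Real.Gamma (1 - t 0), ?_⟩⟩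
  simp only [gammaProd]
  rw [Complex.ofReal_mul, ← Complex.Gamma_ofReal, ← Complex.Gamma_ofReal]
  push_cast
  rfl

/-- The germ `Γ(1 + a) Γ(1 - a)`. -/
def gammaGerm (a : LinForm) : HoloGerm :=
  ⟨compGerm (fun z : Fin 1 → ℂ => gammaProd (z 0)) fun _ => a, 1, _, _, isRealHolo_gammaProd, rfl⟩

/-- The germ `Γ(a) Γ(1 - a) = Γ(1 + a) Γ(1 - a) / a`. -/
def gammaMero (a : NzForm) : Mero :=
  Localization.mk (gammaGerm a.1) (linDenom a)

theorem eq_zero_of_holoVal {p : HoloGerm} (hp : holoVal p = 0) : p = 0 := by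
  obtain ⟨m, F, ⟨hF, -⟩, hpF⟩ := p.2.eventually_exists.exists
  rw [holoVal_eq hpF.symm] at hp
  refine Subtype.ext (hpF.trans (Germ.coe_eq.2 ?_))
  exact eventually_eq_zero_of_halfSpace hF ⟨Finsupp.single 0 1, by simp⟩
    ((Germ.coe_eq.1 hp).mono fun ζ hζ _ => hζ)

/-- The numerator has value `1` at `0`. Nonvanishing ensures that the support of the monomial is
exactly one exponent. -/
theorem gammaMero_ne_zero (a : NzForm) : gammaMero a ≠ 0 := by
  intro h
  have h1 : algebraMap HoloGerm Mero (gammaGerm a.1) = 0 := by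
    rw [gammaMero, Localization.mk_eq_mk'] at h
    rw [← IsLocalization.mk'_spec Mero (gammaGerm a.1) (linDenom a), h, zero_mul]
  have h2 : gammaGerm a.1 = 0 := eq_zero_of_holoVal (by rw [← val_algebraMap, h1, map_zero])
  have h3 : Germ.value (gammaGerm a.1).1 = gammaProd (a.1.eval 0) := rfl
  rw [h2, a.1.eval_zero_right, gammaProd_zero] at h3
  exact zero_ne_one h3

theorem isIntegralElt_single {L ℓ : LinForm} (h : L - ℓ ≠ 0) :
    IsIntegralElt L ℓ (AddMonoidAlgebra.single (ℓ - L) (gammaMero ⟨L - ℓ, h⟩)) := by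
  have hsupp : (AddMonoidAlgebra.single (ℓ - L) (gammaMero ⟨L - ℓ, h⟩)).coeff.support =
      {ℓ - L} := by
    rw [AddMonoidAlgebra.coeff_single]
    exact Finsupp.support_single _ (gammaMero_ne_zero _)
  refine ⟨fun _ ζ => gammaProd ((L - ℓ).eval ζ) / (L - ℓ).eval ζ, fun μ hμ => ?_, ?_⟩
  · rw [hsupp, Finset.mem_singleton] at hμ
    subst hμ
    rw [AddMonoidAlgebra.coeff_single, Finsupp.single_eq_same]
    refine ⟨gammaGerm (L - ℓ), linDenom ⟨L - ℓ, h⟩, _, _, rfl, rfl, rfl, ?_⟩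
    filter_upwards [self_mem_nhdsWithin] with ζ hζ
    refine ⟨fun h0 => ?_, rfl⟩
    have hζ : 0 < ((L - ℓ).eval ζ).re := hζ
    rw [h0] at hζ
    exact lt_irrefl _ hζ
  -- Convergence at infinity needs a positive real part; convergence at `0` needs it to be less than
  -- `1`, which holds automatically near `ζ = 0`.
  · have hlt : ∀ᶠ ζ in 𝓝 (0 : ℕ → ℂ), ((L - ℓ).eval ζ).re < 1 := by
      refine (Complex.continuous_re.comp (L - ℓ).continuous_eval).continuousAt.eventually
        (gt_mem_nhds ?_)
      simp [LinForm.eval_zero_right]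
    filter_upwards [self_mem_nhdsWithin, nhdsWithin_le_nhds hlt] with ζ h0 h1 x hx
    have h0 : 0 < ((L - ℓ).eval ζ).re := h0
    obtain ⟨i1, i2⟩ := integral_cpow_div_add h0 h1 hx
    have hcongr : ∀ y ∈ Set.Ioi (0 : ℝ), (y : ℂ) ^ (-(L - ℓ).eval ζ) / ((y : ℂ) + x) =
        (y : ℂ) ^ ℓ.eval ζ * (y : ℂ) ^ (-L.eval ζ) / ((y : ℂ) + x) := by
      intro y hy
      rw [← Complex.cpow_add _ _ (Complex.ofReal_ne_zero.2 (ne_of_gt hy)), LinForm.eval_sub]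
      congr 2
      ring
    refine ⟨i1.congr_fun hcongr measurableSet_Ioi, ?_⟩
    rw [← setIntegral_congr_fun measurableSet_Ioi hcongr, i2, hsupp, Finset.sum_singleton]
    have hne : (L - ℓ).eval ζ ≠ 0 := fun hz => by
      rw [hz] at h0
      exact lt_irrefl _ h0
    rw [gammaProd, add_comm, Complex.Gamma_add_one _ hne]
    have hneg : (ℓ - L).eval ζ = -(L - ℓ).eval ζ := by
      rw [LinForm.eval_sub, LinForm.eval_sub]
      ring
    rw [hneg]
    field_simp

/-! ### Uniqueness of the elements `ℐ^L(x^ℓ)` -/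

/-- The character `t ↦ exp(t w)` of the additive group of real numbers. -/
def expChar (w : ℂ) : Multiplicative ℝ →* ℂ where
  toFun t := Complex.exp ((t.toAdd : ℂ) * w)
  map_one' := by simp
  map_mul' s t := by
    rw [toAdd_mul, ← Complex.exp_add]
    push_cast
    ring_nf

/-- The exponent is recovered as the derivative at `0`. -/
theorem expChar_injective : Function.Injective expChar := by
  intro w w' h
  have hd : ∀ w : ℂ, HasDerivAt (fun t : ℝ => Complex.exp ((t : ℂ) * w)) w 0 := by
    intro w
    have h1 : HasDerivAt (fun t : ℝ => (t : ℂ) * w) w 0 := by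
      simpa using (Complex.ofRealCLM.hasDerivAt (x := (0 : ℝ))).mul_const w
    simpa using h1.cexp
  have e : (fun t : ℝ => Complex.exp ((t : ℂ) * w)) = fun t : ℝ => Complex.exp ((t : ℂ) * w') :=
    funext fun t => DFunLike.congr_fun h (Multiplicative.ofAdd t)
  exact (hd w).unique (e ▸ hd w')

/-- For `x = e^t` the powers are distinct characters of `(ℝ, +)`, linearly independent by Dedekind's
theorem. -/
theorem coeff_eq_zero_of_sum_cpow {T : Finset LinForm} {ζ : ℕ → ℂ}
    (hT : ∀ μ ∈ T, ∀ ν ∈ T, μ.eval ζ = ν.eval ζ → μ = ν) (d : LinForm → ℂ)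
    (h : ∀ x : ℝ, 0 < x → ∑ μ ∈ T, d μ * (x : ℂ) ^ μ.eval ζ = 0) : ∀ μ ∈ T, d μ = 0 := by
  have hinj : Function.Injective fun μ : T => expChar (μ.1.eval ζ) := fun μ ν hμν =>
    Subtype.ext (hT μ μ.2 ν ν.2 (expChar_injective hμν))
  have hli := (linearIndependent_monoidHom (Multiplicative ℝ) ℂ).comp _ hinj
  rw [Fintype.linearIndependent_iff] at hli
  intro μ hμ
  refine hli (fun μ => d μ) ?_ ⟨μ, hμ⟩
  funext t
  have := h (Real.exp t.toAdd) (Real.exp_pos _)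
  simp only [cpow_eq_exp_log (Real.exp_pos _), Real.log_exp] at this
  rw [Finset.sum_apply, Pi.zero_apply, ← this, ← Finset.sum_coe_sort T]
  rfl

theorem HasValues.exists_val {f : Mero} {U : Set (ℕ → ℂ)} {φ : (ℕ → ℂ) → ℂ}
    (h : HasValues f U φ) :
    ∃ ψ : (ℕ → ℂ) → ℂ, val f = (ψ : Germ genericNhds ℂ) ∧ ∀ᶠ ζ in 𝓝[U] 0, φ ζ = ψ ζ := by
  obtain ⟨h, s, H, S, rfl, hH, hS, hφ⟩ := h
  exact ⟨_, val_mk hH hS, hφ.mono fun ζ hζ => hζ.2⟩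

theorem isIntegralElt_unique {L ℓ : LinForm} (hne : L - ℓ ≠ 0) {u v : MeroL}
    (hu : IsIntegralElt L ℓ u) (hv : IsIntegralElt L ℓ v) : u = v := by
  classical
  obtain ⟨c, hc, hcu⟩ := hu
  obtain ⟨d, hd, hdv⟩ := hv
  -- The coefficient functions are extended by `0` outside the support, so that both elements can be
  -- compared on the union of their supports.
  have key : ∀ (w : MeroL) (e : LinForm → (ℕ → ℂ) → ℂ),
      (∀ μ ∈ w.coeff.support, HasValues (w.coeff μ) {ζ | 0 < ((L - ℓ).eval ζ).re} (e μ)) →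
      ∀ μ, ∃ ψ : (ℕ → ℂ) → ℂ, val (w.coeff μ) = (ψ : Germ genericNhds ℂ) ∧
        ∀ᶠ ζ in 𝓝[{ζ | 0 < ((L - ℓ).eval ζ).re}] 0,
          (if μ ∈ w.coeff.support then e μ ζ else 0) = ψ ζ := by
    intro w e he μ
    by_cases hμ : μ ∈ w.coeff.support
    · simpa only [hμ, if_true] using (he μ hμ).exists_val
    · refine ⟨fun _ => 0, ?_, .of_forall fun ζ => if_neg hμ⟩
      rw [Finsupp.notMem_support_iff.1 hμ, map_zero]
      rfl
  refine AddMonoidAlgebra.coeff_injective (Finsupp.ext fun μ => ?_)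
  by_cases hμ : μ ∈ u.coeff.support ∪ v.coeff.support
  swap
  · rw [Finset.mem_union, not_or, Finsupp.notMem_support_iff, Finsupp.notMem_support_iff] at hμ
    rw [hμ.1, hμ.2]
  obtain ⟨φ, hφ, hφ'⟩ := key u c hc μ
  obtain ⟨ψ, hψ, hψ'⟩ := key v d hd μ
  refine sub_eq_zero.1 (eq_zero_of_val_halfSpace (φ := φ - ψ) (by rw [map_sub, hφ, hψ]; rfl)
    ⟨L - ℓ, hne⟩ ?_)
  -- Distinct exponents take distinct values where their difference, a nonzero form, does not
  -- vanish.
  have hsep : ∀ᶠ ζ in genericNhds, ∀ α ∈ u.coeff.support ∪ v.coeff.support,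
      ∀ β ∈ u.coeff.support ∪ v.coeff.support, α.eval ζ = β.eval ζ → α = β := by
    refine (Finset.eventually_all _).2 fun α _ => (Finset.eventually_all _).2 fun β _ => ?_
    by_cases hαβ : α = β
    · exact .of_forall fun _ _ => hαβ
    · filter_upwards [eventually_eval_ne_zero ⟨α - β, sub_ne_zero.2 hαβ⟩] with ζ hζ h
      rw [LinForm.eval_sub, h, sub_self] at hζ
      exact absurd rfl hζ
  have hin : ∀ {p : (ℕ → ℂ) → Prop}, (∀ᶠ ζ in 𝓝[{ζ | 0 < ((L - ℓ).eval ζ).re}] 0, p ζ) →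
      ∀ᶠ ζ in genericNhds, 0 < ((L - ℓ).eval ζ).re → p ζ := fun h =>
    genericNhds_le (eventually_nhdsWithin_iff.1 h)
  filter_upwards [hsep, hin hφ', hin hψ', hin hcu, hin hdv] with ζ h1 h2 h3 h4 h5 hpos
  rw [Pi.sub_apply, ← h2 hpos, ← h3 hpos]
  refine coeff_eq_zero_of_sum_cpow h1 (fun μ => (if μ ∈ u.coeff.support then c μ ζ else 0) -
    if μ ∈ v.coeff.support then d μ ζ else 0) (fun x hx => ?_) μ hμ
  have e1 : ∑ μ ∈ u.coeff.support ∪ v.coeff.support,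
      (if μ ∈ u.coeff.support then c μ ζ else 0) * (x : ℂ) ^ μ.eval ζ =
        ∑ μ ∈ u.coeff.support, c μ ζ * (x : ℂ) ^ μ.eval ζ := by
    rw [← Finset.sum_subset Finset.subset_union_left fun μ _ hμ => by rw [if_neg hμ, zero_mul]]
    exact Finset.sum_congr rfl fun μ hμ => by rw [if_pos hμ]
  have e2 : ∑ μ ∈ u.coeff.support ∪ v.coeff.support,
      (if μ ∈ v.coeff.support then d μ ζ else 0) * (x : ℂ) ^ μ.eval ζ =
        ∑ μ ∈ v.coeff.support, d μ ζ * (x : ℂ) ^ μ.eval ζ := by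
    rw [← Finset.sum_subset Finset.subset_union_right fun μ _ hμ => by rw [if_neg hμ, zero_mul]]
    exact Finset.sum_congr rfl fun μ hμ => by rw [if_pos hμ]
  simp only [sub_mul, Finset.sum_sub_distrib]
  rw [e1, e2, ← (h4 hpos x hx).2, ← (h5 hpos x hx).2, sub_self]

theorem existsUnique_isIntegralElt {L ℓ : LinForm} (h : L ≠ ℓ) : ∃! u, IsIntegralElt L ℓ u :=
  ⟨_, isIntegralElt_single (sub_ne_zero.2 h),
    fun _ hu => isIntegralElt_unique (sub_ne_zero.2 h) hu (isIntegralElt_single _)⟩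

theorem integralElt_of_ne {L ℓ : LinForm} (h : L ≠ ℓ) :
    integralElt L ℓ =
      AddMonoidAlgebra.single (ℓ - L) (gammaMero ⟨L - ℓ, sub_ne_zero.2 h⟩) := by
  have hex : L ≠ ℓ ∧ ∃ u, IsIntegralElt L ℓ u := ⟨h, (existsUnique_isIntegralElt h).exists⟩
  rw [integralElt, dif_pos hex]
  exact isIntegralElt_unique (sub_ne_zero.2 h) hex.2.choose_spec (isIntegralElt_single _)

theorem integralElt_self (L : LinForm) : integralElt L L = 0 :=
  dif_neg fun h => h.1 rfl

section

variable {Q : InnerProd}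

/-! ### The projection onto the holomorphic germs -/

theorem isHoloPart_unique {f : Mero} {p q : HoloGerm} (hp : IsHoloPart Q f p)
    (hq : IsHoloPart Q f q) : p = q := by
  refine sub_eq_zero.1 (eq_zero_of_mem_meroMinus (Q := Q) ?_)
  have := (meroMinus Q).sub_mem hq hp
  rwa [sub_sub_sub_cancel_left, ← map_sub] at this

theorem existsUnique_isHoloPart (f : Mero) : ∃! p, IsHoloPart Q f p := by
  obtain ⟨p, -, g, hg, rfl⟩ := exists_decomposition (Q := Q) (mem_meroIn_top f)
  have h : IsHoloPart Q (algebraMap HoloGerm Mero p + g) p := by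
    rw [IsHoloPart, add_sub_cancel_left]
    exact minusIn_le _ hg
  exact ⟨p, h, fun q hq => isHoloPart_unique hq h⟩

theorem piPlus_spec (f : Mero) : IsHoloPart Q f (piPlus Q f) := by
  have h : ∃ p, IsHoloPart Q f p := (existsUnique_isHoloPart f).exists
  rw [piPlus, dif_pos h]
  exact h.choose_spec

theorem piPlus_eq {f : Mero} {p : HoloGerm} (h : IsHoloPart Q f p) : piPlus Q f = p :=
  isHoloPart_unique (piPlus_spec f) h

theorem piPlus_add (f g : Mero) : piPlus Q (f + g) = piPlus Q f + piPlus Q g := by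
  refine piPlus_eq ?_
  rw [IsHoloPart, map_add, add_sub_add_comm]
  exact (meroMinus Q).add_mem (piPlus_spec f) (piPlus_spec g)

theorem algebraMap_smul_holo (r : ℝ) (p : HoloGerm) :
    algebraMap HoloGerm Mero (r • p) = r • algebraMap HoloGerm Mero p := by
  rw [Algebra.smul_def, map_mul, Algebra.smul_def, IsScalarTower.algebraMap_apply ℝ HoloGerm Mero]

theorem piPlus_smul (r : ℝ) (f : Mero) : piPlus Q (r • f) = r • piPlus Q f := by
  refine piPlus_eq ?_
  rw [IsHoloPart, algebraMap_smul_holo]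
  have h := (meroMinus Q).smul_mem r (piPlus_spec f)
  exact (smul_sub r f _).symm ▸ h

theorem piPlus_one : piPlus Q 1 = 1 := by
  refine piPlus_eq ?_
  rw [IsHoloPart, map_one, sub_self]
  exact Submodule.zero_mem _

/-! ### Multiplicativity of the projection on orthogonal germs -/

/-- The spaces `V` and `W` of linear forms are orthogonal. -/
def Perp (Q : InnerProd) (V W : Submodule ℝ LinForm) : Prop := ∀ v ∈ V, ∀ w ∈ W, Q.form v w = 0

theorem Perp.symm {V W : Submodule ℝ LinForm} (h : Perp Q V W) : Perp Q W V :=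
  fun w hw v hv => (Q.symm w v).trans (h v hv w hw)

theorem Perp.le_orthTo {V W : Submodule ℝ LinForm} (h : Perp Q V W) {n : ℕ} {L : Fin n → NzForm}
    (hL : ∀ j, (L j).1 ∈ V) : W ≤ orthTo Q L :=
  fun w hw => (mem_orthTo Q).2 fun j => h _ (hL j) w hw

/-- The forms of `p` lie in `W`, hence are orthogonal to every denominator from `V`, so they may
join the numerator of a polar germ. -/
theorem holo_mul_mem_meroMinus {V W : Submodule ℝ LinForm} (h : Perp Q V W) {p : HoloGerm}
    (hp : p ∈ holoIn W) {g : Mero} (hg : g ∈ minusIn Q V) :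
    algebraMap HoloGerm Mero p * g ∈ meroMinus Q := by
  induction hg using Submodule.span_induction with
  | mem g hg =>
    obtain ⟨n, L, hn, hL, q, hq, rfl⟩ := hg
    refine Submodule.subset_span ?_
    rw [← Localization.mk_one_eq_algebraMap, Localization.mk_mul, one_mul]
    exact isPolarGerm_of_mem_holoIn L hn ((holoIn _).mul_mem
      (holoIn_mono (h.le_orthTo hL) hp) (holoIn_mono inf_le_right hq))
  | zero => rw [mul_zero]; exact Submodule.zero_mem _
  | add g g' _ _ hg hg' => rw [mul_add]; exact Submodule.add_mem _ hg hg'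
  | smul r g _ hg => rw [mul_smul_comm]; exact Submodule.smul_mem _ r hg

/-- Each numerator is orthogonal to its own denominators by polarity and to those of the other
factor because `V` and `W` are orthogonal. This is why polar germs must be confined to the forms of
`V` and `W`. -/
theorem polar_mul_mem_meroMinus {V W : Submodule ℝ LinForm} (h : Perp Q V W) {f g : Mero}
    (hf : f ∈ polarIn Q V) (hg : g ∈ polarIn Q W) : f * g ∈ meroMinus Q := by
  obtain ⟨n, L, hn, hL, p, hp, rfl⟩ := hf
  obtain ⟨m, M, hm, hM, q, hq, rfl⟩ := hg
  refine Submodule.subset_span ?_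
  have e : (∏ j, linDenom (L j)) * ∏ j, linDenom (M j) =
      ∏ j, linDenom (Fin.append L M j) := by simp [Fin.prod_univ_add]
  rw [Localization.mk_mul, e]
  have hle : orthTo Q L ⊓ orthTo Q M ≤ orthTo Q (Fin.append L M) := by
    rintro v ⟨h1, h2⟩
    refine (mem_orthTo Q).2 (Fin.addCases (fun j => ?_) fun j => ?_)
    · rw [Fin.append_left]; exact (mem_orthTo Q).1 h1 j
    · rw [Fin.append_right]; exact (mem_orthTo Q).1 h2 j
  refine isPolarGerm_of_mem_holoIn _ (by omega) ((holoIn _).mul_mem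
    (holoIn_mono (le_trans ?_ hle) hp) (holoIn_mono (le_trans ?_ hle) hq))
  · exact le_inf inf_le_right (inf_le_left.trans (h.symm.le_orthTo hM))
  · exact le_inf (inf_le_left.trans (h.le_orthTo hL)) inf_le_right

theorem minus_mul_mem_meroMinus {V W : Submodule ℝ LinForm} (h : Perp Q V W) {f g : Mero}
    (hf : f ∈ minusIn Q V) (hg : g ∈ minusIn Q W) : f * g ∈ meroMinus Q := by
  induction hf using Submodule.span_induction with
  | mem f hf =>
    induction hg using Submodule.span_induction with
    | mem g hg => exact polar_mul_mem_meroMinus h hf hg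
    | zero => rw [mul_zero]; exact Submodule.zero_mem _
    | add g g' _ _ hg hg' => rw [mul_add]; exact Submodule.add_mem _ hg hg'
    | smul r g _ hg => rw [mul_smul_comm]; exact Submodule.smul_mem _ r hg
  | zero => rw [zero_mul]; exact Submodule.zero_mem _
  | add g g' _ _ hg hg' => rw [add_mul]; exact Submodule.add_mem _ hg hg'
  | smul r g _ hg => rw [smul_mul_assoc]; exact Submodule.smul_mem _ r hg

/-- With `f = p + f'` and `g = q + g'` decomposed inside `V` and `W`, the three terms of `f g` other
than `p q` lie in `ℳ_-`. -/
theorem piPlus_mul {V W : Submodule ℝ LinForm} (h : Perp Q V W) {f g : Mero} (hf : f ∈ meroIn V)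
    (hg : g ∈ meroIn W) : piPlus Q (f * g) = piPlus Q f * piPlus Q g := by
  obtain ⟨p, hp, f', hf', rfl⟩ := exists_decomposition (Q := Q) hf
  obtain ⟨q, hq, g', hg', rfl⟩ := exists_decomposition (Q := Q) hg
  have h1 : piPlus Q (algebraMap HoloGerm Mero p + f') = p := piPlus_eq (by
    rw [IsHoloPart, add_sub_cancel_left]; exact minusIn_le _ hf')
  have h2 : piPlus Q (algebraMap HoloGerm Mero q + g') = q := piPlus_eq (by
    rw [IsHoloPart, add_sub_cancel_left]; exact minusIn_le _ hg')
  rw [h1, h2]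
  refine piPlus_eq ?_
  have e : (algebraMap HoloGerm Mero p + f') * (algebraMap HoloGerm Mero q + g') -
      algebraMap HoloGerm Mero (p * q) =
      algebraMap HoloGerm Mero p * g' + algebraMap HoloGerm Mero q * f' + f' * g' := by
    rw [map_mul]
    ring
  rw [IsHoloPart, e]
  exact Submodule.add_mem _ (Submodule.add_mem _ (holo_mul_mem_meroMinus h.symm hp hg')
    (holo_mul_mem_meroMinus h hq hf')) (minus_mul_mem_meroMinus h hf' hg')

/-! ### Evaluations -/

theorem evZero_add (p q : HoloGerm) : evZero (p + q) = evZero p + evZero q :=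
  map_add (Germ.valueRingHom (X := ℕ → ℂ) (E := ℂ)) p.1 q.1

theorem evZero_mul (p q : HoloGerm) : evZero (p * q) = evZero p * evZero q :=
  map_mul (Germ.valueRingHom (X := ℕ → ℂ) (E := ℂ)) p.1 q.1

theorem evZero_one : evZero 1 = 1 := rfl

theorem evZero_smul (r : ℝ) (p : HoloGerm) : evZero (r • p) = r • evZero p := by
  rw [Algebra.smul_def, evZero_mul, Complex.real_smul]
  rfl

theorem evOne_single (L : LinForm) (f : Mero) : evOne (AddMonoidAlgebra.single L f) = f := by
  rw [evOne, AddMonoidAlgebra.coeff_single, Finsupp.sum_single_index rfl]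

theorem evOne_zero : evOne 0 = 0 := Finsupp.sum_zero_index

theorem evOne_add (u v : MeroL) : evOne (u + v) = evOne u + evOne v := by
  rw [evOne, AddMonoidAlgebra.coeff_add, Finsupp.sum_add_index' (fun _ => rfl) fun _ _ _ => rfl]
  rfl

theorem evOne_mul (u v : MeroL) : evOne (u * v) = evOne u * evOne v := by
  induction u using AddMonoidAlgebra.induction_linear with
  | zero => rw [zero_mul, evOne_zero, zero_mul]
  | add u u' hu hu' => rw [add_mul, evOne_add, evOne_add, hu, hu', add_mul]
  | single L f =>
    induction v using AddMonoidAlgebra.induction_linear with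
    | zero => rw [mul_zero, evOne_zero, mul_zero]
    | add v v' hv hv' => rw [mul_add, evOne_add, evOne_add, hv, hv', mul_add]
    | single M g =>
      rw [AddMonoidAlgebra.single_mul_single, evOne_single, evOne_single, evOne_single]

theorem evOne_smul (r : ℝ) (u : MeroL) : evOne (r • u) = r • evOne u := by
  induction u using AddMonoidAlgebra.induction_linear with
  | zero => rw [smul_zero, evOne_zero, smul_zero]
  | add u u' hu hu' => rw [smul_add, evOne_add, evOne_add, hu, hu', smul_add]
  | single L f => rw [AddMonoidAlgebra.smul_single, evOne_single, evOne_single]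

theorem evOne_one : evOne 1 = 1 := by
  rw [AddMonoidAlgebra.one_def, evOne_single]

/-! ### The linear forms occurring in the branched integrals -/

/-- The elements `∑ fᵢ x^{Lᵢ}` with all `fᵢ` and `Lᵢ` in linear forms from `V`. -/
def meroLIn (V : Submodule ℝ LinForm) : AddSubmonoid MeroL :=
  AddSubmonoid.closure {u | ∃ L ∈ V, ∃ f ∈ meroIn V, u = AddMonoidAlgebra.single L f}

theorem one_mem_meroLIn (V : Submodule ℝ LinForm) : 1 ∈ meroLIn V :=
  AddSubmonoid.subset_closure ⟨0, V.zero_mem, 1, (meroIn V).one_mem, rfl⟩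

theorem mul_mem_meroLIn {V : Submodule ℝ LinForm} {u v : MeroL} (hu : u ∈ meroLIn V)
    (hv : v ∈ meroLIn V) : u * v ∈ meroLIn V := by
  induction hu using AddSubmonoid.closure_induction with
  | mem u hu =>
    obtain ⟨L, hL, f, hf, rfl⟩ := hu
    induction hv using AddSubmonoid.closure_induction with
    | mem v hv =>
      obtain ⟨M, hM, g, hg, rfl⟩ := hv
      exact AddSubmonoid.subset_closure ⟨L + M, V.add_mem hL hM, f * g, (meroIn V).mul_mem hf hg,
        AddMonoidAlgebra.single_mul_single _ _ _ _⟩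
    | zero => rw [mul_zero]; exact AddSubmonoid.zero_mem _
    | add v v' _ _ hv hv' => rw [mul_add]; exact AddSubmonoid.add_mem _ hv hv'
  | zero => rw [zero_mul]; exact AddSubmonoid.zero_mem _
  | add u u' _ _ hu hu' => rw [add_mul]; exact AddSubmonoid.add_mem _ hu hu'

theorem evOne_mem_meroIn {V : Submodule ℝ LinForm} {u : MeroL} (hu : u ∈ meroLIn V) :
    evOne u ∈ meroIn V := by
  induction hu using AddSubmonoid.closure_induction with
  | mem u hu =>
    obtain ⟨L, hL, f, hf, rfl⟩ := hu
    rwa [evOne_single]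
  | zero => rw [evOne_zero]; exact (meroIn V).zero_mem
  | add u u' _ _ hu hu' => rw [evOne_add]; exact (meroIn V).add_mem hu hu'

theorem gammaMero_mem_meroIn {V : Submodule ℝ LinForm} (a : NzForm) (ha : a.1 ∈ V) :
    gammaMero a ∈ meroIn V :=
  ⟨gammaGerm a.1, ⟨1, _, _, isRealHolo_gammaProd, fun _ => ha, rfl⟩, linDenom a,
    Submonoid.subset_closure ⟨a, ha, rfl⟩, rfl⟩

/-- By the explicit formula, `ℐ^L(x^ℓ)` only involves the form `L - ℓ`; the default value `0` for `ℓ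
= L` does no harm. -/
theorem integralOp_mem_meroLIn {V : Submodule ℝ LinForm} {L : LinForm} (hL : L ∈ V) {u : MeroL}
    (hu : u ∈ meroLIn V) : integralOp L u ∈ meroLIn V := by
  induction hu using AddSubmonoid.closure_induction with
  | mem u hu =>
    obtain ⟨ℓ, hℓ, f, hf, rfl⟩ := hu
    rw [integralOp, AddMonoidAlgebra.coeff_single, Finsupp.sum_single_index
      (h := fun ℓ (f : Mero) => f • integralElt L ℓ) (zero_smul _ _)]
    by_cases h : L = ℓ
    · subst h
      rw [integralElt_self, smul_zero]
      exact AddSubmonoid.zero_mem _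
    · rw [integralElt_of_ne h, AddMonoidAlgebra.smul_single]
      exact AddSubmonoid.subset_closure ⟨_, V.sub_mem hℓ hL, _, (meroIn V).mul_mem hf
        (gammaMero_mem_meroIn _ (V.sub_mem hL hℓ)), rfl⟩
  | zero =>
    rw [integralOp, AddMonoidAlgebra.coeff_zero, Finsupp.sum_zero_index]
    exact AddSubmonoid.zero_mem _
  | add u u' _ _ hu hu' =>
    have : integralOp L (u + u') = integralOp L u + integralOp L u' := by
      rw [integralOp, AddMonoidAlgebra.coeff_add, Finsupp.sum_add_index'
        (h := fun ℓ (f : Mero) => f • integralElt L ℓ) (fun _ => zero_smul _ _)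
        fun _ _ _ => add_smul _ _ _]
      rfl
    rw [this]
    exact AddSubmonoid.add_mem _ hu hu'

theorem branchedPlanar_mem_meroLIn {V : Submodule ℝ LinForm} (s : PForest NzForm)
    (hs : ∀ L ∈ s.decs, L.1 ∈ V) : branchedPlanar s ∈ meroLIn V := by
  induction s with
  | nil => exact one_mem_meroLIn V
  | cons L c s hc hs' =>
    simp only [PForest.decs, Multiset.mem_cons, Multiset.mem_add] at hs
    exact mul_mem_meroLIn (integralOp_mem_meroLIn (hs L (Or.inl rfl))
      (hc fun M hM => hs M (Or.inr (Or.inl hM)))) (hs' fun M hM => hs M (Or.inr (Or.inr hM)))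

/-- The space spanned by the decorations of a forest. -/
def decSpan (F : Forest NzForm) : Submodule ℝ LinForm :=
  Submodule.span ℝ {v | ∃ L ∈ F.decs, v = L.1}

theorem branchedForest_mem_meroLIn (F : Forest NzForm) : branchedForest F ∈ meroLIn (decSpan F) := by
  rcases F with ⟨s⟩
  exact branchedPlanar_mem_meroLIn s fun L hL => Submodule.subset_span ⟨L, hL, rfl⟩

theorem perp_decSpan {F G : Forest NzForm} (h : Forest.Indep (orth Q) F G) :
    Perp Q (decSpan F) (decSpan G) := by
  intro v hv w hw
  induction hv using Submodule.span_induction with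
  | mem v hv =>
    obtain ⟨L, hL, rfl⟩ := hv
    induction hw using Submodule.span_induction with
    | mem w hw =>
      obtain ⟨M, hM, rfl⟩ := hw
      exact h L hL M hM
    | zero => exact map_zero _
    | add w w' _ _ hw hw' => rw [map_add, hw, hw', add_zero]
    | smul c w _ hw => rw [map_smul, hw, smul_zero]
  | zero => rw [map_zero, LinearMap.zero_apply]
  | add v v' _ _ hv hv' => rw [map_add, LinearMap.add_apply, hv, hv', add_zero]
  | smul c v _ hv => rw [map_smul, LinearMap.smul_apply, hv, smul_zero]

/-! ### The renormalised character -/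

/-- The renormalised map on the span of all forests. -/
def renormalisedAll (Q : InnerProd) : MonoidAlgebra ℝ (Forest NzForm) →ₗ[ℝ] ℂ where
  toFun a := evZero (piPlus Q (evOne (MonoidAlgebra.lift ℝ MeroL (Forest NzForm) branchedForest a)))
  map_add' a b := by rw [map_add, evOne_add, piPlus_add, evZero_add]
  map_smul' r a := by rw [map_smul, evOne_smul, piPlus_smul, evZero_smul, RingHom.id_apply]

/-- The only factor of the composite that is not multiplicative in general is `π_+`; independence
puts the two germs into orthogonal spaces of forms, where it is. -/
theorem renormalisedAll_mul_of_indep {F G : Forest NzForm} (h : Forest.Indep (orth Q) F G)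
    (r s : ℝ) :
    renormalisedAll Q (MonoidAlgebra.single F r * MonoidAlgebra.single G s) =
      renormalisedAll Q (MonoidAlgebra.single F r) *
        renormalisedAll Q (MonoidAlgebra.single G s) := by
  have hs : ∀ (H : Forest NzForm) (t : ℝ), renormalisedAll Q (MonoidAlgebra.single H t) =
      t • evZero (piPlus Q (evOne (branchedForest H))) := by
    intro H t
    change evZero (piPlus Q (evOne (MonoidAlgebra.lift ℝ MeroL (Forest NzForm) branchedForest _))) = _
    rw [MonoidAlgebra.lift_single, evOne_smul, piPlus_smul, evZero_smul]
  rw [MonoidAlgebra.single_mul_single, hs, hs, hs, map_mul, evOne_mul,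
    piPlus_mul (perp_decSpan h) (evOne_mem_meroIn (branchedForest_mem_meroLIn F))
      (evOne_mem_meroIn (branchedForest_mem_meroLIn G)), evZero_mul, smul_mul_smul_comm]

theorem renormalisedAll_mul {a b : MonoidAlgebra ℝ (Forest NzForm)}
    (h : SpanIndep (orth Q) a b) :
    renormalisedAll Q (a * b) = renormalisedAll Q a * renormalisedAll Q b := by
  rw [← MonoidAlgebra.sum_coeff_single a, ← MonoidAlgebra.sum_coeff_single b, Finsupp.sum,
    Finsupp.sum, Finset.sum_mul_sum, map_sum, map_sum, map_sum, Finset.sum_mul_sum]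
  refine Finset.sum_congr rfl fun F hF => ?_
  rw [map_sum]
  exact Finset.sum_congr rfl fun G hG => renormalisedAll_mul_of_indep (h F hF G hG) _ _

theorem isLocalityCharacter_renormalised (Q : InnerProd) :
    IsLocalityCharacter (orthForestAlgebra Q) (renormalised Q) where
  linear := ⟨fun a b => map_add (renormalisedAll Q) a.1 b.1,
    fun r a => map_smul (renormalisedAll Q) r a.1⟩
  map_rel _ _ _ := trivial
  map_mul _ _ h _ := renormalisedAll_mul h
  map_one := by
    change evZero (piPlus Q (evOne (MonoidAlgebra.lift ℝ MeroL (Forest NzForm) branchedForest 1))) =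
      1
    rw [map_one, evOne_one, piPlus_one, evZero_one]

end

end BranchedRen

end

theorem mainTheorem9 (Q : BranchedRen.InnerProd) :
    (∀ L ℓ : BranchedRen.LinForm, L ≠ ℓ → ∃! u, BranchedRen.IsIntegralElt L ℓ u) ∧
    (∀ f : BranchedRen.Mero, ∃! p, BranchedRen.IsHoloPart Q f p) ∧
    BranchedRen.IsLocalityCharacter (BranchedRen.orthForestAlgebra Q)
      (BranchedRen.renormalised Q) :=
  ⟨fun _ _ h => BranchedRen.existsUnique_isIntegralElt h,
    fun f => BranchedRen.existsUnique_isHoloPart f,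
    BranchedRen.isLocalityCharacter_renormalised Q⟩
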